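/- A \emph{Petri net} $\mathcal N$ has finite disjoint sets $\mathcal P$ of places and $\mathcal T$ of transitions, an initial marking $\mathit{In}$, and, for each $t\in\mathcal T$, a precondition $\mathrm{pre}(t)$ and a postcondition $\mathrm{post}(t)$; markings, pre- and postconditions are finite multisets over $\mathcal P$. A transition $t$ is enabled in $M$ if $\mathrm{pre}(t)\subseteq M$, and firing it leads to $M-\mathrm{pre}(t)+\mathrm{post}(t)$. Reachable markings are those reached from $\mathit{In}$ by firing finitely many transitions. A \emph{Petri game with good and bad markings} is a Petri net whose places are partitioned into system places $\mathcal P_S$ and environment places $\mathcal P_E$, together with two disjoint sets $\mathcal M_G,\mathcal M_B$ of reachable markings. Tokens on system (environment) places are the system (environment) players. Write $\le$ for the reflexive transitive closure of the flow relation on nodes. Two nodes $x,y$ are in conflict if there are distinct transitions $t_1\le x$, $t_2\le y$ with a common place in their preconditions, and they are concurrent if they are neither related by $\le$ nor in conflict. An \emph{occurrence net} is a possibly infinite net in which pre- and postconditions and the initial marking are sets, the initial places are exactly the places without ingoing transition, every other place has exactly one ingoing transition, the inverse flow relation is well-founded, and no transition is in conflict with itself. A \emph{branching process} of $\mathcal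 N$ is an occurrence net with a labelling $\lambda$ of its places and transitions by places and transitions of $\mathcal N$ that preserves the initial marking and all pre- and postconditions as multisets and is injective on transitions with the same precondition. A \emph{strategy} is a branching process $\sigma$ of $\mathcal N$ such that (1) (justified refusal) whenever $C$ is a set of pairwise concurrent places of $\sigma$ and $t\in\mathcal T$ satisfies $\lambda[C]=\mathrm{pre}(t)$, either some transition of $\sigma$ with label $t$ has precondition $C$, or some $p\in C$ with $\lambda(p)\in\mathcal P_S$ has no outgoing transition labelled $t$; (2) (determinism) for every reachable marking $M$ of $\sigma$ and every $p\in M$ with $\lambda(p)\in\mathcal P_S$, at most one outgoing transition of $p$ is enabled in $M$. A \emph{play} of $\sigma$ is a branching process of $\mathcal N$ that is a subnet of $\sigma$ with the same initial marking and with the restricted labelling, in which every place has at most one outgoing transition. It is \emph{maximal} if, whenever $C$ is a set of pairwise concurrent places of the play that is the precondition of a transition of $\sigma$, some $p\in C$ has an outgoing transition in the play. The strategy is \emph{winning} if, for every maximal play and every finite or infinite firing sequence of the play from its initial marking in which every transition of the play occurs, the visited markings $M_0,M_1,M_2,\dots$ satisfy: there is $i\ge 0$ with $\lambda[M_i]\in\mathcal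 M_G$ and $\lambda[M_j]\notin\mathcal M_B$ for all $j<i$. \textbf{Theorem.} For Petri games with good and bad markings and at least two system players and one environment player, it is undecidable whether the system players have a winning strategy. More precisely, for all integers $s\ge 2$ and $e\ge 1$ there is no algorithm that halts with the correct answer to this question on every Petri game with good and bad markings (given by explicit finite lists) in which every reachable marking has exactly $s$ tokens on system places and exactly $e$ tokens on environment places. Consequently no algorithm does so for any larger class of Petri games. -/

import Mathlib

/-- A (possibly infinite) Petri net whose places are named by elements of `α` and whose transitions
are named by elements of `β`. The flow relation is given by the multisets `pre t` and `post t`;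
the initial marking is `init`. Values of `pre` and `post` outside `transitions` are irrelevant. -/
structure PetriNet (α β : Type) where
  places : Set α
  transitions : Set β
  pre : β → Multiset α
  post : β → Multiset α
  init : Multiset α

namespace PetriNet

variable {α β α' β' : Type}

/-- The flow relation and the initial marking only use places of the net. -/
structure WellFormed (N : PetriNet α β) : Prop where
  pre_mem : ∀ t ∈ N.transitions, ∀ p ∈ N.pre t, p ∈ N.places
  post_mem : ∀ t ∈ N.transitions, ∀ p ∈ N.post t, p ∈ N.places
  init_mem : ∀ p ∈ N.init, p ∈ N.places

/-- `t` is enabled in the marking `M`. -/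
def Enabled (N : PetriNet α β) (M : Multiset α) (t : β) : Prop :=
  t ∈ N.transitions ∧ N.pre t ≤ M

/-- `t` is enabled in `M` and firing it leads to `M' = M - pre t + post t`. -/
def Fires (N : PetriNet α β) (M : Multiset α) (t : β) (M' : Multiset α) : Prop :=
  N.Enabled M t ∧ M' + N.pre t = M + N.post t

/-- The reachable markings. -/
inductive Reachable (N : PetriNet α β) : Multiset α → Prop
  | init : Reachable N N.init
  | step {M M' : Multiset α} {t : β} : Reachable N M → N.Fires M t M' → Reachable N M'

/-- `x ⋖ y`: there is an arc of the flow relation from the node `x` to the node `y`. -/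
def Arc (N : PetriNet α β) : α ⊕ β → α ⊕ β → Prop
  | Sum.inl p, Sum.inr t => t ∈ N.transitions ∧ p ∈ N.pre t
  | Sum.inr t, Sum.inl p => t ∈ N.transitions ∧ p ∈ N.post t
  | _, _ => False

/-- The causal order `x ≤ y`: the reflexive transitive closure of `⋖`. -/
def Causal (N : PetriNet α β) : α ⊕ β → α ⊕ β → Prop :=
  Relation.ReflTransGen N.Arc

/-- `x` and `y` are in conflict: they causally depend on two distinct transitions that consume
from a common place. -/
def Conflict (N : PetriNet α β) (x y : α ⊕ β) : Prop :=
  ∃ p ∈ N.places, ∃ t₁ ∈ N.transitions, ∃ t₂ ∈ N.transitions, t₁ ≠ t₂ ∧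
    p ∈ N.pre t₁ ∧ p ∈ N.pre t₂ ∧ N.Causal (Sum.inr t₁) x ∧ N.Causal (Sum.inr t₂) y

/-- `x` and `y` are neither causally related nor in conflict. -/
def Concurrent (N : PetriNet α β) (x y : α ⊕ β) : Prop :=
  ¬ N.Causal x y ∧ ¬ N.Causal y x ∧ ¬ N.Conflict x y

/-- `C` is a (finite) set of pairwise concurrent places of `N`. -/
def ConcurrentPlaces (N : PetriNet α β) (C : Finset α) : Prop :=
  (∀ p ∈ C, p ∈ N.places) ∧
    ∀ p ∈ C, ∀ q ∈ C, p ≠ q → N.Concurrent (Sum.inl p) (Sum.inl q)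

/-- Occurrence nets. -/
structure IsOccurrenceNet (N : PetriNet α β) : Prop where
  wellFormed : N.WellFormed
  pre_nodup : ∀ t ∈ N.transitions, (N.pre t).Nodup
  post_nodup : ∀ t ∈ N.transitions, (N.post t).Nodup
  init_nodup : N.init.Nodup
  mem_init_iff : ∀ p ∈ N.places, p ∈ N.init ↔ ∀ t ∈ N.transitions, p ∉ N.post t
  existsUnique_pre : ∀ p ∈ N.places, p ∉ N.init → ∃! t, t ∈ N.transitions ∧ p ∈ N.post t
  wellFounded : WellFounded N.Arc
  not_selfConflict : ∀ t ∈ N.transitions, ¬ N.Conflict (Sum.inr t) (Sum.inr t)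

/-- Initial homomorphisms from `N₁` to `N₂`: `f` on places and `g` on transitions respect the
node types, the pre- and postconditions of transitions and the initial marking (as multisets). -/
structure IsInitialHom (N₁ : PetriNet α' β') (N₂ : PetriNet α β) (f : α' → α) (g : β' → β) :
    Prop where
  map_place : ∀ p ∈ N₁.places, f p ∈ N₂.places
  map_transition : ∀ t ∈ N₁.transitions, g t ∈ N₂.transitions
  map_pre : ∀ t ∈ N₁.transitions, (N₁.pre t).map f = N₂.pre (g t)
  map_post : ∀ t ∈ N₁.transitions, (N₁.post t).map f = N₂.post (g t)
  map_init : N₁.init.map f = N₂.init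

/-- `(B, (f, g))` is an (initial) branching process of `N`. -/
structure IsBranchingProcess (N : PetriNet α β) (B : PetriNet α' β') (f : α' → α) (g : β' → β) :
    Prop where
  occurrenceNet : B.IsOccurrenceNet
  hom : IsInitialHom B N f g
  injective : ∀ t ∈ B.transitions, ∀ t' ∈ B.transitions, B.pre t = B.pre t' → g t = g t' → t = t'

open Classical in
/-- `N'` is a subnet of `N`: fewer nodes, the same initial marking, and the flow relation of `N`
restricted to the nodes of `N'`. -/
structure IsSubnet (N' N : PetriNet α β) : Prop where
  places_subset : N'.places ⊆ N.places
  transitions_subset : N'.transitions ⊆ N.transitions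
  init_eq : N'.init = N.init
  pre_eq : ∀ t ∈ N'.transitions, N'.pre t = (N.pre t).filter (fun p => p ∈ N'.places)
  post_eq : ∀ t ∈ N'.transitions, N'.post t = (N.post t).filter (fun p => p ∈ N'.places)

/-- `t 0, t 1, …` is a finite or infinite firing sequence of `N` from the initial marking, and
`M 0, M 1, …` are the markings that it visits. The value `none` marks the end of a finite sequence,
after which the last marking is repeated. -/
structure IsFiringSequence (N : PetriNet α β) (t : ℕ → Option β) (M : ℕ → Multiset α) : Prop where
  init : M 0 = N.init
  step : ∀ i a, t i = some a → N.Fires (M i) a (M (i + 1))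
  stutter : ∀ i, t i = none → t (i + 1) = none ∧ M (i + 1) = M i

/-- A firing sequence is complete if each transition of the net occurs. -/
def IsCompleteFiringSequence (N : PetriNet α β) (t : ℕ → Option β) (M : ℕ → Multiset α) : Prop :=
  N.IsFiringSequence t M ∧ ∀ a ∈ N.transitions, ∃ i, t i = some a

end PetriNet

/-- The data of a Petri game whose winning condition is a pair of good and bad markings. -/
structure PetriGame (α β : Type) where
  net : PetriNet α β
  sysPlaces : Set α
  envPlaces : Set α
  good : Set (Multiset α)
  bad : Set (Multiset α)

namespace PetriGame

variable {α β α' β' : Type}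

/-- The requirements on a Petri game with good and bad markings: the net is finite, its places are
partitioned into system and environment places, and the good and the bad markings are disjoint sets
of reachable markings. -/
structure IsPetriGame (G : PetriGame α β) : Prop where
  wellFormed : G.net.WellFormed
  finite_places : G.net.places.Finite
  finite_transitions : G.net.transitions.Finite
  union_eq : G.sysPlaces ∪ G.envPlaces = G.net.places
  disjoint_places : Disjoint G.sysPlaces G.envPlaces
  good_reachable : ∀ M ∈ G.good, G.net.Reachable M
  bad_reachable : ∀ M ∈ G.bad, G.net.Reachable M
  disjoint_markings : Disjoint G.good G.bad

open Classical in
/-- There are `s` system players and `e` environment players: every reachable marking has exactly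
`s` tokens on system places and exactly `e` tokens on environment places. -/
def HasPlayers (G : PetriGame α β) (s e : ℕ) : Prop :=
  ∀ M, G.net.Reachable M →
    (M.filter (fun p => p ∈ G.sysPlaces)).card = s ∧
    (M.filter (fun p => p ∈ G.envPlaces)).card = e

/-- Justified refusal: a transition that is possible in the net is present in the branching process
unless a participating system place never allows it. -/
def JustifiedRefusal (G : PetriGame α β) (B : PetriNet α' β') (f : α' → α) (g : β' → β) : Prop :=
  ∀ C : Finset α', B.ConcurrentPlaces C → ∀ t ∈ G.net.transitions, C.val.map f = G.net.pre t →
    (∃ t' ∈ B.transitions, g t' = t ∧ B.pre t' = C.val) ∨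
    (∃ p ∈ C, f p ∈ G.sysPlaces ∧ ∀ t' ∈ B.transitions, p ∈ B.pre t' → g t' ≠ t)

/-- Determinism: for each system place in a reachable marking, at most one outgoing transition is
enabled in that marking. -/
def Deterministic (G : PetriGame α β) (B : PetriNet α' β') (f : α' → α) : Prop :=
  ∀ M, B.Reachable M → ∀ p ∈ M, f p ∈ G.sysPlaces → ∀ t₁ t₂,
    p ∈ B.pre t₁ → p ∈ B.pre t₂ → B.Enabled M t₁ → B.Enabled M t₂ → t₁ = t₂

/-- Strategies for the system players. -/
structure IsStrategy (G : PetriGame α β) (B : PetriNet α' β') (f : α' → α) (g : β' → β) :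
    Prop where
  branchingProcess : PetriNet.IsBranchingProcess G.net B f g
  justifiedRefusal : G.JustifiedRefusal B f g
  deterministic : G.Deterministic B f

/-- `A`, labelled by the restrictions of `f` and `g`, is a play of the strategy `(B, (f, g))`: a
subprocess in which every place has at most one outgoing transition. -/
structure IsPlay (G : PetriGame α β) (B : PetriNet α' β') (f : α' → α) (g : β' → β)
    (A : PetriNet α' β') : Prop where
  subnet : PetriNet.IsSubnet A B
  branchingProcess : PetriNet.IsBranchingProcess G.net A f g
  post_le_one : ∀ p ∈ A.places, ∀ t₁ ∈ A.transitions, ∀ t₂ ∈ A.transitions,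
    p ∈ A.pre t₁ → p ∈ A.pre t₂ → t₁ = t₂

/-- The play `A` of the strategy with net `B` is maximal. -/
def IsMaximal (B A : PetriNet α' β') : Prop :=
  ∀ C : Finset α', A.ConcurrentPlaces C → ∀ t ∈ B.transitions, C.val = B.pre t →
    ∃ p ∈ C, ∃ t' ∈ A.transitions, p ∈ A.pre t'

/-- The strategy `(B, (f, g))` is winning for good and bad markings: every complete firing sequence
of every maximal play reaches a good marking before which no bad marking is reached. -/
def IsWinning (G : PetriGame α β) (B : PetriNet α' β') (f : α' → α) (g : β' → β) : Prop :=
  ∀ A : PetriNet α' β', G.IsPlay B f g A → IsMaximal B A →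
    ∀ t M, A.IsCompleteFiringSequence t M →
      ∃ i, (M i).map f ∈ G.good ∧ ∀ j < i, (M j).map f ∉ G.bad

/-- The system players have a winning strategy. (Every branching process of a finite net is
countable, so it suffices to let the nodes of strategies range over types in `Type`.) -/
def HasWinningStrategy (G : PetriGame α β) : Prop :=
  ∃ (α' β' : Type) (B : PetriNet α' β') (f : α' → α) (g : β' → β),
    G.IsStrategy B f g ∧ G.IsWinning B f g

end PetriGame

/-- Finite presentations of Petri games as inputs of algorithms: a list that tells for each of the
places `0, 1, …` whether it is a system place (`true`) or an environment place (`false`), the list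
of transitions, each with its pre- and postcondition, the initial marking, the list of good markings
and the list of bad markings. A multiset of places is given by a list with repetitions. -/
abbrev PetriGameCode : Type :=
  List Bool × List (List ℕ × List ℕ) × List ℕ × List (List ℕ) × List (List ℕ)

/-- The Petri game that is presented by a code. -/
def PetriGameCode.toGame : PetriGameCode → PetriGame ℕ ℕ
  | (kinds, arcs, start, good, bad) =>
    { net :=
        { places := {p | p < kinds.length}
          transitions := {t | t < arcs.length}
          pre := fun t => ↑(arcs.getD t ([], [])).1
          post := fun t => ↑(arcs.getD t ([], [])).2
          init := ↑start }
      sysPlaces := {p | kinds[p]? = some true}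
      envPlaces := {p | kinds[p]? = some false}
      good := {M | ∃ l ∈ good, M = (l : Multiset ℕ)}
      bad := {M | ∃ l ∈ bad, M = (l : Multiset ℕ)} }

/-- The question whether an input satisfies `p` is decidable on the inputs from the class `C`: some
partial computable function halts with the right answer on every input from `C` (and may do anything
on other inputs). -/
def DecidableOn {ι : Type} [Primcodable ι] (C p : ι → Prop) : Prop :=
  ∃ f : ι →. Bool, Partrec f ∧ ∀ c, C c → ∃ b, b ∈ f c ∧ (b = true ↔ p c)

/-! ### A fixed finite machine with undecidable halting on inputs of the form `x y … y`. -/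

section TuringMachines

open Turing Turing.ToPartrec

/-! The reduction starts from the halting problem of one fixed finite Turing machine on the inputs
`x y … y` with `n + 1` letters `y` (`exists_undecidable_machine`). A halting computation is a
space-time diagram, and such a diagram, read row by row, is a word over a finite set of tiles. The
word has a row length `K` that the machine does not know in advance, neighbouring tiles satisfy
`hor`, and tiles at distance `K` satisfy `ver`. Hence the machine halts on the `n`-th input iff the
tile system `tiles` is solvable (`solvable_tiles_iff`).

A tile system becomes a game as follows. Each of two system players walks through tiles and so
spells a word. Every transition of the net has exactly one place on each side, so nobody ever
synchronises, and the players learn nothing about each other or about the environment. The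
environment player makes a single move, by which it chooses one of three checks: both words reach a
final tile, both words agree and respect `hor`, or rows respect `ver`. All remaining players are
idle.

The difficulty is that the markings compared in a play depend on the interleaving, which is
arbitrary. The good markings repair this. Tile numbers carry a phase modulo 3 that advances with
every move, so a marking reveals the difference of the two positions modulo 3. For the check of
agreement the intended schedule alternates between the players; for the vertical check the first
player moves `K` times alone and then they alternate. A departure from the schedule makes the
difference wrong by -1 or 2, both congruent to 2, and such a marking is good at once. So only
intended schedules can hurt the system players, and along these the bad markings are exactly the
violated tile constraints.

If a solution exists, both players spell it and win under every interleaving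
(`IsSolution.exists_good`, `Solvable.hasWinningStrategy`). Conversely, in a winning strategy one
follows one path of each player; the plays for the three checks under the intended schedules show
that the path of the first player contains a solution (`solvable_of_runs`,
`solvable_of_hasWinningStrategy`). As the map from `n` to the game is primitive recursive
(`primrec_code_tiles`), an algorithm for the games would decide halting. -/

theorem PosNum.cast_ones_add_one (k : ℕ) :
    (((PosNum.bit1)^[k] PosNum.one : PosNum) : ℕ) + 1 = 2 ^ (k + 1) := by
  induction k with
  | zero => rfl
  | succ k ih =>
    rw [Function.iterate_succ_apply', PosNum.cast_bit1, pow_succ, ← ih]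
    ring

theorem trPosNum_ones (k : ℕ) :
    PartrecToTM2.trPosNum ((PosNum.bit1)^[k] PosNum.one) =
      List.replicate (k + 1) PartrecToTM2.Γ'.bit1 := by
  induction k with
  | zero => rfl
  | succ k ih =>
    rw [Function.iterate_succ_apply', PartrecToTM2.trPosNum, ih, ← List.replicate_succ]

/-- Numbers whose binary digits are all 1 give inputs that repeat a single letter. Only the length
of such an input has to be built into the tiles. -/
theorem trNat_two_pow_sub_one (k : ℕ) :
    PartrecToTM2.trNat (2 ^ (k + 1) - 1) = List.replicate (k + 1) PartrecToTM2.Γ'.bit1 := by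
  have h : 2 ^ (k + 1) - 1 = (((Num.pos ((PosNum.bit1)^[k] PosNum.one) : Num)) : ℕ) := by
    have := PosNum.cast_ones_add_one k
    rw [Num.cast_pos]
    omega
  rw [PartrecToTM2.trNat, h, Num.of_to_nat, PartrecToTM2.trNum, trPosNum_ones]

/-- Every partial recursive function is defined at `2 ^ (n + 1) - 1` iff some fixed finite machine
halts on the input `x y y … y` with `n + 1` copies of `y`. -/
theorem Partrec.exists_finite_machine {f : ℕ →. ℕ} (hf : Partrec f) :
    ∃ (Γ Λ : Type) (_ : Inhabited Γ) (_ : Inhabited Λ) (_ : Finite Γ) (_ : Finite Λ)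
      (M : TM0.Machine Γ Λ) (x y : Γ), ∀ n : ℕ,
        (StateTransition.eval (TM0.step M) (TM0.init (x :: List.replicate (n + 1) y))).Dom ↔
          (f (2 ^ (n + 1) - 1)).Dom := by
  classical
  obtain ⟨c, hc⟩ := Code.exists_code (Nat.Partrec'.part_iff₁.2 hf)
  let iΛ : Inhabited PartrecToTM2.Λ' := ⟨PartrecToTM2.trNormal c PartrecToTM2.Cont'.halt⟩
  have hs2 := PartrecToTM2.tr_supports c PartrecToTM2.Cont'.halt
  have hs1 := TM2to1.tr_supports PartrecToTM2.tr hs2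
  let M1 := TM2to1.tr (Γ := fun _ : PartrecToTM2.K' => PartrecToTM2.Γ')
    PartrecToTM2.tr
  have hs0 := TM1to0.tr_supports M1 hs1
  let M0 := TM1to0.tr M1
  -- The compiled machine has infinitely many states, but those reachable from the code lie in this
  -- finite set. The machine is restricted to it, and states outside are sent to the default.
  let S : Set (TM1to0.Λ' M1) := ↑(TM1to0.trStmts M1
    (TM2to1.trSupp PartrecToTM2.tr
      (PartrecToTM2.codeSupp c PartrecToTM2.Cont'.halt)))
  have hfin : S.Finite := Finset.finite_toSet _
  have hdef : (default : TM1to0.Λ' M1) ∈ S := hs0.1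
  let iS : Inhabited S := ⟨⟨default, hdef⟩⟩
  let Γ1 := TM2to1.Γ' PartrecToTM2.K' (fun _ => PartrecToTM2.Γ')
  let fid : PointedMap Γ1 Γ1 := ⟨id, rfl⟩
  let g1 : PointedMap (TM1to0.Λ' M1) S :=
    ⟨fun q => if h : q ∈ S then ⟨q, h⟩ else default, by
      rw [dif_pos hdef]; rfl⟩
  have hresp := TM0.Machine.map_respects M0 fid fid g1 Subtype.val hs0
    (fun _ => rfl) (by intro q hq; change ((if h : q ∈ S then (⟨q, h⟩ : S) else default : S) : _) = q
                       rw [dif_pos hq])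
  let emb : PartrecToTM2.Γ' → (PartrecToTM2.K' → Option PartrecToTM2.Γ') := fun a =>
    Function.update (fun _ => Option.none) PartrecToTM2.K'.main (some a)
  -- The tape holds the stack from the bottom up, so the separator `cons` comes first. The flag
  -- `true` marks the bottom of the stacks.
  let x : Γ1 := (true, emb PartrecToTM2.Γ'.cons)
  let y : Γ1 := (false, emb PartrecToTM2.Γ'.bit1)
  have hK : Finite PartrecToTM2.K' := Finite.of_surjective
    (fun i : Fin 4 => match i with
      | 0 => PartrecToTM2.K'.main
      | 1 => PartrecToTM2.K'.rev
      | 2 => PartrecToTM2.K'.aux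
      | 3 => PartrecToTM2.K'.stack)
    (fun k => by cases k; exacts [⟨0, rfl⟩, ⟨1, rfl⟩, ⟨2, rfl⟩, ⟨3, rfl⟩])
  have hΓ : Finite Γ1 :=
    inferInstanceAs (Finite (Bool × (PartrecToTM2.K' → Option PartrecToTM2.Γ')))
  refine ⟨Γ1, S, inferInstance, iS, hΓ, hfin.to_subtype,
    M0.map fid fid g1 Subtype.val, x, y, fun n => ?_⟩
  have hinit : TM2to1.trInit (Γ := fun _ => PartrecToTM2.Γ') PartrecToTM2.K'.main
      (PartrecToTM2.trList [2 ^ (n + 1) - 1]) = x :: List.replicate (n + 1) y := by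
    have h : (PartrecToTM2.trList [2 ^ (n + 1) - 1]).reverse =
        PartrecToTM2.Γ'.cons :: List.replicate (n + 1) PartrecToTM2.Γ'.bit1 := by
      simp [trNat_two_pow_sub_one]
    unfold TM2to1.trInit
    rw [h]
    have hm : ∀ e : PartrecToTM2.Γ' → Γ1,
        List.map e (PartrecToTM2.Γ'.cons :: List.replicate (n + 1) PartrecToTM2.Γ'.bit1) =
          e PartrecToTM2.Γ'.cons :: List.replicate (n + 1) (e PartrecToTM2.Γ'.bit1) := fun e => by
      rw [List.map_cons, List.map_replicate]
    exact congrArg (fun L : List Γ1 => ((true, L.headI.2) : Γ1) :: L.tail)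
      (hm fun a => (false, emb a))
  rw [← hinit]
  set l := TM2to1.trInit (Γ := fun _ => PartrecToTM2.Γ') PartrecToTM2.K'.main
      (PartrecToTM2.trList [2 ^ (n + 1) - 1])
  have e0 : TM0.init (Λ := S) l = (TM0.init (Λ := TM1to0.Λ' M1) l).map fid g1 := by
    rw [TM0.map_init]
    congr 1
    exact (List.map_id l).symm
  have h0 := StateTransition.tr_eval_dom hresp (a₁ := TM0.init (Λ := TM1to0.Λ' M1) l)
    ⟨hdef, rfl⟩
  rw [e0, h0]
  have h1 : (StateTransition.eval (TM0.step M0) (TM0.init l)).Dom ↔ (TM0.eval M0 l).Dom := Iff.rfl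
  rw [h1, TM1to0.tr_eval]
  refine (TM2to1.tr_eval_dom PartrecToTM2.tr PartrecToTM2.K'.main _).trans ?_
  have h2 : (TM2.eval PartrecToTM2.tr PartrecToTM2.K'.main
      (PartrecToTM2.trList [2 ^ (n + 1) - 1])).Dom ↔
      (StateTransition.eval (TM2.step PartrecToTM2.tr)
        (PartrecToTM2.init c [2 ^ (n + 1) - 1])).Dom := by
    have : TM2.init PartrecToTM2.K'.main (PartrecToTM2.trList [2 ^ (n + 1) - 1]) =
        PartrecToTM2.init c [2 ^ (n + 1) - 1] := by
      unfold TM2.init PartrecToTM2.init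
      congr 1
      funext k
      cases k <;> rfl
    rw [← this]
    rfl
  rw [h2, PartrecToTM2.tr_eval]
  have h3 := hc ⟨[2 ^ (n + 1) - 1], rfl⟩
  change _ = pure <$> f (2 ^ (n + 1) - 1) at h3
  change (PartrecToTM2.halt <$> c.eval [2 ^ (n + 1) - 1]).Dom ↔ _
  change c.eval [2 ^ (n + 1) - 1] = _ at h3
  rw [h3]
  rfl

theorem exists_undecidable_machine :
    ∃ (Γ Λ : Type) (_ : Inhabited Γ) (_ : Inhabited Λ) (_ : Finite Γ) (_ : Finite Λ)
      (M : TM0.Machine Γ Λ) (x y : Γ), ¬ ComputablePred fun n : ℕ =>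
        (StateTransition.eval (TM0.step M) (TM0.init (x :: List.replicate (n + 1) y))).Dom := by
  -- A primitive recursive left inverse of `n ↦ 2 ^ (n + 1) - 1`, which recovers the index of a
  -- program from the all-ones input.
  let lg : ℕ → ℕ := fun x => Nat.findGreatest (fun k => 2 ^ (k + 1) ≤ x + 1) x
  have hlg : Primrec lg := by
    refine Primrec.nat_findGreatest Primrec.id ?_
    have hpow : Primrec₂ ((· ^ ·) : ℕ → ℕ → ℕ) := Primrec₂.unpaired'.1 Nat.Primrec.pow
    exact Primrec.nat_le.comp (hpow.comp (Primrec.const 2) (Primrec.succ.comp Primrec.snd))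
      (Primrec.succ.comp Primrec.fst)
  have hlgv : ∀ n, lg (2 ^ (n + 1) - 1) = n := by
    intro n
    have h2 : 1 ≤ 2 ^ (n + 1) := Nat.one_le_two_pow
    have h3 : n < 2 ^ n := Nat.lt_two_pow_self
    have h4 : 2 ^ (n + 1) = 2 * 2 ^ n := by rw [pow_succ]; ring
    refine Nat.findGreatest_eq_iff.2 ⟨by omega, fun _ => by omega, fun k hk _ => ?_⟩
    rw [Nat.sub_add_cancel h2, not_le]
    exact Nat.pow_lt_pow_right (by norm_num) (by omega)
  let f : ℕ →. ℕ := fun x =>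
    Nat.Partrec.Code.eval (Denumerable.ofNat Nat.Partrec.Code (lg x)) 0
  have hf : Partrec f :=
    Nat.Partrec.Code.eval_part.comp ((Computable.ofNat _).comp hlg.to_comp) (Computable.const 0)
  obtain ⟨Γ, Λ, i1, i2, i3, i4, M, x, y, h⟩ := hf.exists_finite_machine
  refine ⟨Γ, Λ, i1, i2, i3, i4, M, x, y, fun hc => ?_⟩
  refine ComputablePred.halting_problem 0 (ComputablePred.computable_of_manyOneReducible
    ⟨Encodable.encode, Computable.encode, fun c => ?_⟩ hc)
  rw [h]
  simp only [f, hlgv, Denumerable.ofNat_encode]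

end TuringMachines

/-! ### Tile systems and the good and bad markings of their games. -/

/-- A system of tiles `0, …, size - 1`. A solution is a word of tiles that starts with `start` and
ends with a `final` tile, with consecutive tiles related by `hor`; the tiles with `first` form an
initial segment (the first row), and tiles at the distance of its length are related by `ver`. -/
structure TileSystem where
  size : ℕ
  start : ℕ
  hor : ℕ → ℕ → Bool
  ver : ℕ → ℕ → Bool
  first : ℕ → Bool
  final : ℕ → Bool

namespace TileSystem

/-- `w 0, …, w L` is a solution with rows of length `K`. -/
structure IsSolution (T : TileSystem) (L K : ℕ) (w : ℕ → ℕ) : Prop where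
  pos : 0 < K
  le : K ≤ L
  zero : w 0 = T.start
  lt_size : ∀ i ≤ L, w i < T.size
  phase : ∀ i < L, w (i + 1) % 3 = (w i + 1) % 3
  hor : ∀ i < L, T.hor (w i) (w (i + 1)) = true
  first : ∀ i ≤ L, T.first (w i) = true ↔ i < K
  phase_row : w K % 3 = T.start % 3
  ver : ∀ i, i + K ≤ L → T.ver (w i) (w (i + K)) = true
  final : T.final (w L) = true

def Solvable (T : TileSystem) : Prop :=
  ∃ L K w, T.IsSolution L K w

structure IsProper (T : TileSystem) : Prop where
  three_le : 3 ≤ T.size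
  start_lt : T.start < T.size
  first_start : T.first T.start = true
  first_of_hor : ∀ x y, T.hor x y = true → T.first y = true → T.first x = true
  phase_of_hor : ∀ x y, T.hor x y = true → T.first x = true → T.first y = false →
    y % 3 = T.start % 3
  first_of_final : ∀ x, T.final x = true → T.first x = false

/-- The good markings: the two system players are at the tiles `a` and `b` and `m` is the state
of the environment, where `0` is the initial state, and `1`, `2`, `3` stand for the check that the
players terminate, that they play the same word of horizontally matching tiles, and that rows
match vertically. -/
def good (T : TileSystem) (a b m : ℕ) : Bool :=
  if m = 0 then !(decide (a = T.start)) || !(decide (b = T.start))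
  else if m = 1 then T.final a && T.final b
  else if m = 2 then decide (a % 3 = (b + 2) % 3) || (decide (a = b) && T.final a)
  else if T.first a then !(decide (b = T.start)) else decide (a % 3 = (b + 2) % 3)

/-- The markings that are bad unless they are good. -/
def bad (T : TileSystem) (a b m : ℕ) : Bool :=
  if m = 2 then (decide (a % 3 = b % 3) && !(decide (a = b))) ||
    (decide (a % 3 = (b + 1) % 3) && !(T.hor b a))
  else if m = 3 then !(T.first a) && (decide (a % 3 = b % 3) && !(T.ver b a))
  else false

/-! ### Playing a solution wins under every interleaving. -/

section Verification

variable {T : TileSystem}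

theorem IsSolution.phase_add {L K : ℕ} {w : ℕ → ℕ} (h : T.IsSolution L K w) :
    ∀ i ≤ L, w i % 3 = (T.start + i) % 3 := by
  intro i hi
  induction i with
  | zero => rw [h.zero, Nat.add_zero]
  | succ i ih =>
    have := h.phase i (by omega)
    have := ih (by omega)
    omega

/-- The phase advances by one per tile and is back to its initial value at index `K`. Thus a delay
by a whole row does not change the comparison of phases. -/
theorem IsSolution.dvd {L K : ℕ} {w : ℕ → ℕ} (h : T.IsSolution L K w) : K % 3 = 0 := by
  have h1 := h.phase_add K h.le
  have h2 := h.phase_row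
  omega

/-- One step of the state `(i, j, m)` of a play: `i` and `j` count the moves of the system players,
and `m` is the state of the environment. -/
def Move (L : ℕ) (S S' : ℕ × ℕ × ℕ) : Prop :=
  S' = S ∨ (S.1 < L ∧ S' = (S.1 + 1, S.2.1, S.2.2)) ∨ (S.2.1 < L ∧ S' = (S.1, S.2.1 + 1, S.2.2)) ∨
    (S.2.2 = 0 ∧ ∃ m, 1 ≤ m ∧ m ≤ 3 ∧ S' = (S.1, S.2.1, m))

/-- The states that are visited before the first good one. -/
def Neutral (L K : ℕ) (S : ℕ × ℕ × ℕ) : Prop :=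
  S.1 ≤ L ∧ S.2.1 ≤ L ∧ S.2.2 ≤ 3 ∧
  (S.2.2 = 0 → S.1 = 0 ∧ S.2.1 = 0) ∧
  (S.2.2 = 2 → S.1 = S.2.1 ∨ S.1 = S.2.1 + 1) ∧
  (S.2.2 = 3 → (S.1 < K ∧ S.2.1 = 0) ∨ S.1 = K + S.2.1 ∨ S.1 = K + S.2.1 + 1)

/-- In neutral states the tests compare only equal positions, consecutive positions, or positions at
distance `K`, and there the solution meets its constraints. At distance `K + 1` the phases differ,
so no test applies. -/
theorem IsSolution.not_bad {L K : ℕ} {w : ℕ → ℕ} (h : T.IsSolution L K w) {S : ℕ × ℕ × ℕ}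
    (hS : Neutral L K S) : T.bad (w S.1) (w S.2.1) S.2.2 = false := by
  obtain ⟨i, j, m⟩ := S
  obtain ⟨hi, hj, hm, h0, h2, h3⟩ := hS
  dsimp only at *
  have pi := h.phase_add i hi
  have pj := h.phase_add j hj
  have hd := h.dvd
  unfold bad
  split_ifs with e2 e3
  · rcases h2 e2 with rfl | rfl
    · have : ¬ (w i % 3 = (w i + 1) % 3) := by omega
      simp [this]
    · have : ¬ (w (j + 1) % 3 = w j % 3) := by omega
      simp [this, h.hor j (by omega)]
  · have hf := h.first i hi
    rcases h3 e3 with ⟨h4, rfl⟩ | rfl | rfl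
    · simp [hf.2 h4]
    · have := h.ver j (by omega)
      rw [Nat.add_comm] at this
      simp [this]
    · have : ¬ (w (K + j + 1) % 3 = w j % 3) := by omega
      simp [this]
  · rfl

/-- A move off the intended schedule is good. Before the choice of the environment a moved player
has left the start tile; during the first row of the vertical check the second player must still be
on it; otherwise the difference of the positions, reduced by `K` in the vertical check, becomes -1
or 2, which the phases show as 2 modulo 3. -/
theorem IsSolution.neutral_of_move {L K : ℕ} {w : ℕ → ℕ}
    (h : T.IsSolution L K w) {S S' : ℕ × ℕ × ℕ} (hS : Neutral L K S) (hm : Move L S S')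
    (hg : T.good (w S'.1) (w S'.2.1) S'.2.2 = false) : Neutral L K S' := by
  obtain ⟨i, j, m⟩ := S
  obtain ⟨i', j', m'⟩ := S'
  obtain ⟨hi, hj, hm3, h0, h2, h3⟩ := hS
  dsimp only at *
  have hst : ∀ n, n < L → n = 0 → w (n + 1) ≠ T.start := by
    rintro n hn rfl e
    have := h.phase_add 1 (by omega)
    simp only [Nat.zero_add] at e
    omega
  have hd := h.dvd
  have hpos := h.pos
  simp only [Move, Prod.mk.injEq] at hm
  rcases hm with ⟨rfl, rfl, rfl⟩ | ⟨hl, rfl, rfl, rfl⟩ | ⟨hl, rfl, rfl, rfl⟩ |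
    ⟨hm0, m, h1, h3', rfl, rfl, rfl⟩
  · exact ⟨hi, hj, hm3, h0, h2, h3⟩
  · have pi := h.phase_add (i + 1) hl
    have pj := h.phase_add j' hj
    refine ⟨hl, hj, hm3, fun e => ?_, fun e => ?_, fun e => ?_⟩
    · exfalso
      subst e
      have := hst i hl (h0 rfl).1
      simp [good, this] at hg
    · subst e
      simp only [good, if_false, if_true, Bool.or_eq_false_iff,
        decide_eq_false_iff_not, OfNat.ofNat_ne_zero, OfNat.ofNat_ne_one] at hg
      dsimp only
      rcases h2 rfl with rfl | rfl <;> omega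
    · subst e
      have hf := h.first (i + 1) hl
      simp only [good, Nat.reduceEqDiff, if_false, OfNat.ofNat_ne_zero, OfNat.ofNat_ne_one] at hg
      dsimp only
      split_ifs at hg with hfi
      · rcases h3 rfl with ⟨h4, rfl⟩ | h4
        · exact Or.inl ⟨hf.1 hfi, rfl⟩
        · have := hf.1 hfi
          omega
      · simp only [decide_eq_false_iff_not] at hg
        have : ¬ i + 1 < K := fun h => hfi (hf.2 h)
        rcases h3 rfl with ⟨h4, rfl⟩ | h4 | h4 <;> omega
  · have pi := h.phase_add i' hi
    have pj := h.phase_add (j + 1) hl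
    refine ⟨hi, hl, hm3, fun e => ?_, fun e => ?_, fun e => ?_⟩
    · exfalso
      subst e
      have := hst j hl (h0 rfl).2
      simp [good, this] at hg
    · subst e
      simp only [good, if_false, if_true, Bool.or_eq_false_iff,
        decide_eq_false_iff_not, OfNat.ofNat_ne_zero, OfNat.ofNat_ne_one] at hg
      dsimp only
      rcases h2 rfl with rfl | rfl <;> omega
    · subst e
      have hf := h.first i' hi
      simp only [good, Nat.reduceEqDiff, if_false, OfNat.ofNat_ne_zero, OfNat.ofNat_ne_one] at hg
      dsimp only
      split_ifs at hg with hfi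
      · exfalso
        simp only [Bool.not_eq_false', decide_eq_true_eq] at hg
        rcases h3 rfl with ⟨h4, rfl⟩ | h4
        · exact hst 0 hl rfl hg
        · have := hf.1 hfi
          omega
      · simp only [decide_eq_false_iff_not] at hg
        have : ¬ i' < K := fun h => hfi (hf.2 h)
        rcases h3 rfl with ⟨h4, rfl⟩ | h4 | h4 <;> omega
  · obtain ⟨rfl, rfl⟩ := h0 hm0
    exact ⟨hi, hj, h3', fun e => by dsimp only at *; omega, fun _ => Or.inl rfl,
      fun _ => Or.inl ⟨hpos, rfl⟩⟩

/-- Whatever the environment and the scheduler do, a good state is reached before any bad one if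
the system players play a solution. -/
theorem IsSolution.exists_good {L K : ℕ} {w : ℕ → ℕ} (h : T.IsSolution L K w)
    {S : ℕ → ℕ × ℕ × ℕ} (h0 : S 0 = (0, 0, 0)) (hS : ∀ k, Move L (S k) (S (k + 1)))
    (hend : ∃ k, (S k).1 = L ∧ (S k).2.1 = L ∧ (S k).2.2 ≠ 0) :
    ∃ k, T.good (w (S k).1) (w (S k).2.1) (S k).2.2 = true ∧
      ∀ k' < k, T.bad (w (S k').1) (w (S k').2.1) (S k').2.2 = false := by
  have hN0 : Neutral L K (S 0) := by
    rw [h0]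
    simp [Neutral]
  have hN : ∀ k, (∀ k' ≤ k, T.good (w (S k').1) (w (S k').2.1) (S k').2.2 = false) →
      Neutral L K (S k) := by
    intro k
    induction k with
    | zero => exact fun _ => hN0
    | succ k ih =>
      intro hk
      exact h.neutral_of_move (ih fun k' hk' => hk k' (by omega)) (hS k) (hk _ le_rfl)
  classical
  have hex : ∃ k, T.good (w (S k).1) (w (S k).2.1) (S k).2.2 = true := by
    by_contra hno
    push Not at hno
    obtain ⟨k, hi, hj, hm⟩ := hend
    have hng := hno k
    have := hN k fun k' _ => by simpa using hno k'
    obtain ⟨-, -, h3, -, -, h33⟩ := this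
    have hpos := h.pos
    have hle := h.le
    rw [hi, hj] at hng
    have hcases : (S k).2.2 = 1 ∨ (S k).2.2 = 2 ∨ (S k).2.2 = 3 := by omega
    rcases hcases with e | e | e
    · simp [good, e, h.final] at hng
    · simp [good, e, h.final] at hng
    -- In the vertical check the final state is not neutral, because both players are at `L` while
    -- `K > 0`. So a good state must have occurred.
    · have := h33 e
      omega
  refine ⟨Nat.find hex, Nat.find_spec hex, fun k' hk' => h.not_bad (hN k' fun k'' hk'' => ?_)⟩
  simpa using Nat.find_min hex (lt_of_le_of_lt hk'' hk')

end Verification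

/-! ### Extracting a solution from winning runs under alternating schedules. -/

section Extraction

open Classical in
/-- The numbers of moves of the system players after one more move, where `OA i` and `OB j` tell
whether they have a next move, and the first player is preferred iff `c` is true. -/
noncomputable def nextRun (OA OB : ℕ → Prop) (c : Bool) (S : ℕ × ℕ) : ℕ × ℕ :=
  if OA S.1 ∧ (c = true ∨ ¬ OB S.2) then (S.1 + 1, S.2)
  else if OB S.2 then (S.1, S.2 + 1)
  else S

noncomputable def run (OA OB : ℕ → Prop) (c : ℕ → Bool) : ℕ → ℕ × ℕ
  | 0 => (0, 0)
  | k + 1 => nextRun OA OB (c k) (run OA OB c k)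

/-- The schedule in which the first player makes `K` moves and then both players alternate. -/
def alternating (K k : ℕ) : Bool :=
  decide (k < K ∨ (k - K) % 2 = 0)

variable {OA OB : ℕ → Prop} {c : ℕ → Bool}

theorem run_fst_lt (i k : ℕ) (h : i < (run OA OB c k).1) : OA i := by
  induction k with
  | zero => simp [run] at h
  | succ k ih =>
    rw [run, nextRun] at h
    split_ifs at h with h1 h2
    · rcases Nat.lt_succ_iff_lt_or_eq.1 h with h | h
      · exact ih h
      · exact h ▸ h1.1
    · exact ih h
    · exact ih h

theorem run_snd_lt (j k : ℕ) (h : j < (run OA OB c k).2) : OB j := by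
  induction k with
  | zero => simp [run] at h
  | succ k ih =>
    rw [run, nextRun] at h
    split_ifs at h with h1 h2
    · exact ih h
    · rcases Nat.lt_succ_iff_lt_or_eq.1 h with h | h
      · exact ih h
      · exact h ▸ h2
    · exact ih h

theorem run_alternating_le {K : ℕ} (hA : ∀ i < K, OA i) :
    ∀ k ≤ K, run OA OB (alternating K) k = (k, 0) := by
  intro k hk
  induction k with
  | zero => rfl
  | succ k ih =>
    rw [run, ih (by omega), nextRun, if_pos]
    exact ⟨hA k hk, Or.inl (by simp [alternating]; omega)⟩

/-- As long as both players have moves, the schedule is followed literally: after the solo part the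
first player moves at even steps and the second at odd steps. -/
theorem run_alternating {K n : ℕ} (hA : ∀ i < K + n, OA i) (hB : ∀ j < n, OB j) :
    ∀ k ≤ 2 * n, run OA OB (alternating K) (K + k) = (K + (k + 1) / 2, k / 2) := by
  intro k hk
  induction k with
  | zero =>
    rw [Nat.add_zero, run_alternating_le (fun i hi => hA i (by omega)) K le_rfl]
  | succ k ih =>
    rw [← Nat.add_assoc, run, ih (by omega), nextRun]
    dsimp only
    have hb := hB (k / 2) (by omega)
    rcases Nat.mod_two_eq_zero_or_one k with h | h
    · rw [if_pos ⟨hA _ (by omega), Or.inl (by simp [alternating, h])⟩]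
      simp only [Prod.mk.injEq]
      omega
    · rw [if_neg, if_pos hb]
      · simp only [Prod.mk.injEq]
        omega
      · simp [alternating, hb, h]

theorem run_succ (k : ℕ) :
    (OA (run OA OB c k).1 ∧
        run OA OB c (k + 1) = ((run OA OB c k).1 + 1, (run OA OB c k).2)) ∨
      (OB (run OA OB c k).2 ∧
        run OA OB c (k + 1) = ((run OA OB c k).1, (run OA OB c k).2 + 1)) ∨
      (¬ OA (run OA OB c k).1 ∧ ¬ OB (run OA OB c k).2 ∧
        run OA OB c (k + 1) = run OA OB c k) := by
  rw [run, nextRun]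
  split_ifs with h1 h2
  · exact Or.inl ⟨h1.1, rfl⟩
  · exact Or.inr (Or.inl ⟨h2, rfl⟩)
  · refine Or.inr (Or.inr ⟨fun h => h1 ⟨h, Or.inr h2⟩, h2, rfl⟩)

theorem exists_alternating (K k₀ : ℕ) (b : Bool) : ∃ k ≥ k₀, alternating K k = b := by
  cases b
  · exact ⟨K + (2 * k₀ + 1), by omega, by simp [alternating]⟩
  · exact ⟨K + 2 * k₀, by omega, by simp [alternating]⟩

/-- A discrete intermediate value argument: a counter that rises by at most one per step cannot skip
a value. It locates the moment at which a given transition fires. -/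
theorem exists_step_eq {u : ℕ → ℕ} (h0 : u 0 = 0) (hu : ∀ k, u (k + 1) ≤ u k + 1) {i : ℕ}
    (hi : ∃ k, i < u k) : ∃ k, u k = i ∧ u (k + 1) = i + 1 := by
  classical
  have h := Nat.find_spec hi
  have hmin := fun k => Nat.find_min (H := hi) (m := k)
  obtain ⟨k, hk⟩ : ∃ k, Nat.find hi = k + 1 := by
    rcases Nat.eq_zero_or_eq_succ_pred (Nat.find hi) with e | e
    · rw [e, h0] at h
      omega
    · exact ⟨_, e⟩
  rw [hk] at h hmin
  have h1 := hmin k (by omega)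
  have h2 := hu k
  exact ⟨k, by omega, by omega⟩

/-- Fairness: a player that is preferred infinitely often makes every move that it has, even if the
other player never stops. -/
theorem exists_run_fst (hc : ∀ k₀, ∃ k ≥ k₀, c k = true) {i : ℕ} (hi : ∀ i' ≤ i, OA i') :
    ∃ k, (run OA OB c k).1 = i ∧ (run OA OB c (k + 1)).1 = i + 1 := by
  have hmono : Monotone fun k => (run OA OB c k).1 := monotone_nat_of_le_succ fun k => by
    rcases run_succ (OA := OA) (OB := OB) (c := c) k with ⟨_, h⟩ | ⟨_, h⟩ | ⟨_, _, h⟩ <;> simp [h]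
  refine exists_step_eq (u := fun k => (run OA OB c k).1) rfl (fun k => ?_) ?_
  · rcases run_succ (OA := OA) (OB := OB) (c := c) k with ⟨_, h⟩ | ⟨_, h⟩ | ⟨_, _, h⟩ <;> simp [h]
  · have key : ∀ n ≤ i + 1, ∃ k, n ≤ (run OA OB c k).1 := by
      intro n
      induction n with
      | zero => exact fun _ => ⟨0, Nat.zero_le _⟩
      | succ n ih =>
        intro hn
        obtain ⟨k₀, hk₀⟩ := ih (by omega)
        obtain ⟨k, hk, hck⟩ := hc k₀
        have h1 : n ≤ (run OA OB c k).1 := hk₀.trans (hmono hk)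
        rcases h1.eq_or_lt with h | h
        · refine ⟨k + 1, ?_⟩
          rw [run, nextRun, if_pos ⟨h ▸ hi n (by omega), Or.inl hck⟩, ← h]
        · exact ⟨k, h⟩
    exact key (i + 1) le_rfl

theorem exists_run_snd (hc : ∀ k₀, ∃ k ≥ k₀, c k = false) {j : ℕ} (hj : ∀ j' ≤ j, OB j') :
    ∃ k, (run OA OB c k).2 = j ∧ (run OA OB c (k + 1)).2 = j + 1 := by
  have hmono : Monotone fun k => (run OA OB c k).2 := monotone_nat_of_le_succ fun k => by
    rcases run_succ (OA := OA) (OB := OB) (c := c) k with ⟨_, h⟩ | ⟨_, h⟩ | ⟨_, _, h⟩ <;> simp [h]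
  refine exists_step_eq (u := fun k => (run OA OB c k).2) rfl (fun k => ?_) ?_
  · rcases run_succ (OA := OA) (OB := OB) (c := c) k with ⟨_, h⟩ | ⟨_, h⟩ | ⟨_, _, h⟩ <;> simp [h]
  · have key : ∀ n ≤ j + 1, ∃ k, n ≤ (run OA OB c k).2 := by
      intro n
      induction n with
      | zero => exact fun _ => ⟨0, Nat.zero_le _⟩
      | succ n ih =>
        intro hn
        obtain ⟨k₀, hk₀⟩ := ih (by omega)
        obtain ⟨k, hk, hck⟩ := hc k₀
        have h1 : n ≤ (run OA OB c k).2 := hk₀.trans (hmono hk)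
        rcases h1.eq_or_lt with h | h
        · refine ⟨k + 1, ?_⟩
          have hn' : OB (run OA OB c k).2 := h ▸ hj n (by omega)
          rw [run, nextRun, if_neg (by simp [hck, hn']), if_pos hn', ← h]
        · exact ⟨k, h⟩
    exact key (j + 1) le_rfl

/-- The tiles played by the system players form a solution if, in each mode of the environment,
good states come before bad ones in every alternating schedule. -/
theorem solvable_of_runs {T : TileSystem} (hT : T.IsProper) {wA wB : ℕ → ℕ}
    (hA0 : wA 0 = T.start) (hB0 : wB 0 = T.start)
    (hA : ∀ i, OA i → wA (i + 1) < T.size ∧ wA (i + 1) % 3 = (wA i + 1) % 3)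
    (hB : ∀ j, OB j → wB (j + 1) < T.size ∧ wB (j + 1) % 3 = (wB j + 1) % 3)
    (hrun : ∀ m, 1 ≤ m → m ≤ 3 → ∀ K, ∃ k,
      T.good (wA (run OA OB (alternating K) k).1) (wB (run OA OB (alternating K) k).2) m = true ∧
      ∀ k' < k, T.good (wA (run OA OB (alternating K) k').1)
          (wB (run OA OB (alternating K) k').2) m = false ∧
        T.bad (wA (run OA OB (alternating K) k').1)
          (wB (run OA OB (alternating K) k').2) m = false) :
    T.Solvable := by
  classical
  have hAp : ∀ i, (∀ i' < i, OA i') → wA i % 3 = (T.start + i) % 3 := by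
    intro i hi
    induction i with
    | zero => rw [hA0, Nat.add_zero]
    | succ i ih =>
      have := (hA i (hi i (by omega))).2
      have := ih fun i' h => hi i' (by omega)
      omega
  have hBp : ∀ i, (∀ i' < i, OB i') → wB i % 3 = (T.start + i) % 3 := by
    intro i hi
    induction i with
    | zero => rw [hB0, Nat.add_zero]
    | succ i ih =>
      have := (hB i (hi i (by omega))).2
      have := ih fun i' h => hi i' (by omega)
      omega
  have hterm : (∃ i, T.final (wA i) = true ∧ ∀ i' < i, OA i') ∧
      ∃ j, T.final (wB j) = true ∧ ∀ j' < j, OB j' := by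
    -- The first check forces both players to reach a final tile. The schedule plays no role here.
    obtain ⟨k, hk, -⟩ := hrun 1 le_rfl (by omega) 0
    simp only [good, Nat.one_ne_zero, if_false, if_true, Bool.and_eq_true] at hk
    exact ⟨⟨_, hk.1, fun i' h => run_fst_lt i' k h⟩, ⟨_, hk.2, fun j' h => run_snd_lt j' k h⟩⟩
  obtain ⟨hexA, hexB⟩ := hterm
  set LA := Nat.find hexA with hLA
  set LB := Nat.find hexB with hLB
  obtain ⟨hfA, hoA⟩ := Nat.find_spec hexA
  obtain ⟨hfB, hoB⟩ := Nat.find_spec hexB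
  rw [← hLA] at hfA hoA
  rw [← hLB] at hfB hoB
  have hnfA : ∀ i < LA, T.final (wA i) = false := by
    intro i hi
    have := Nat.find_min hexA hi
    by_contra h
    exact this ⟨by simpa using h, fun i' h' => hoA i' (by omega)⟩
  -- With no solo moves, the states alternate between equal positions and a lead of one for the
  -- first player.
  obtain ⟨k₂, hg₂, hb₂⟩ := hrun 2 (by omega) (by omega) 0
  set L := min LA LB with hL
  have hLA' : L ≤ LA := min_le_left _ _
  have hLB' : L ≤ LB := min_le_right _ _
  have hr₂ : ∀ k ≤ 2 * L, run OA OB (alternating 0) k = ((k + 1) / 2, k / 2) := by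
    intro k hk
    have := run_alternating (K := 0) (n := L) (fun i hi => hoA i (by omega))
      (fun j hj => hoB j (by omega)) k hk
    simpa using this
  -- No good state comes earlier: the difference of the positions is 0 or 1, and equal tiles can
  -- occur only at equal positions, where the first player is not yet at a final tile.
  have hk₂ : 2 * L ≤ k₂ := by
    by_contra hlt
    rw [hr₂ k₂ (by omega)] at hg₂
    have pA := hAp ((k₂ + 1) / 2) fun i' hi' => hoA i' (by omega)
    have pB := hBp (k₂ / 2) fun i' hi' => hoB i' (by omega)
    simp only [good, if_true, if_false, Bool.or_eq_true, decide_eq_true_eq, Bool.and_eq_true,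
      OfNat.ofNat_ne_zero, OfNat.ofNat_ne_one] at hg₂
    rcases hg₂ with h | ⟨h, h'⟩
    · omega
    · rcases Nat.mod_two_eq_zero_or_one k₂ with e | e
      · rw [hnfA _ (by omega)] at h'
        cases h'
      · rw [h] at pA
        omega
  have hbad : ∀ k < 2 * L, wA ((k + 1) / 2) % 3 = wB (k / 2) % 3 → wA ((k + 1) / 2) = wB (k / 2) :=
    by
    intro k hk h
    have := (hb₂ k (by omega)).2
    rw [hr₂ k hk.le] at this
    simp only [bad, if_true, Bool.or_eq_false_iff, Bool.and_eq_false_iff,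
      decide_eq_false_iff_not, Bool.not_eq_false', decide_eq_true_eq] at this
    rcases this.1 with h' | h'
    · exact absurd h h'
    · exact h'
  have heq : ∀ i < L, wA i = wB i := by
    intro i hi
    have := hbad (2 * i) (by omega)
    have e1 : (2 * i + 1) / 2 = i := by omega
    have e2 : 2 * i / 2 = i := by omega
    rw [e1, e2] at this
    apply this
    rw [hAp i fun i' hi' => hoA i' (by omega), hBp i fun i' hi' => hoB i' (by omega)]
  have hhor : ∀ i < L, T.hor (wB i) (wA (i + 1)) = true := by
    intro i hi
    have := (hb₂ (2 * i + 1) (by omega)).2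
    rw [hr₂ _ (by omega)] at this
    have e1 : (2 * i + 1 + 1) / 2 = i + 1 := by omega
    have e2 : (2 * i + 1) / 2 = i := by omega
    have pA := hAp (i + 1) fun i' hi' => hoA i' (by omega)
    have pB := hBp i fun i' hi' => hoB i' (by omega)
    simp only [e1, e2, bad, if_true, Bool.or_eq_false_iff, Bool.and_eq_false_iff,
      decide_eq_false_iff_not, Bool.not_eq_false'] at this
    rcases this.2 with h' | h'
    · omega
    · exact h'
  -- Either the state at step `2 * L` is good, and then the tiles are equal because the phases
  -- exclude the other alternative, or it precedes the good state and is not bad.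
  have hlast : wA L = wB L := by
    have e1 : (2 * L + 1) / 2 = L := by omega
    have e2 : 2 * L / 2 = L := by omega
    have pA := hAp L fun i' hi' => hoA i' (by omega)
    have pB := hBp L fun i' hi' => hoB i' (by omega)
    rcases hk₂.eq_or_lt with h | h
    · rw [← h, hr₂ _ le_rfl, e1, e2] at hg₂
      simp only [good, if_true, if_false, Bool.or_eq_true, decide_eq_true_eq, Bool.and_eq_true,
        OfNat.ofNat_ne_zero, OfNat.ofNat_ne_one] at hg₂
      rcases hg₂ with h | h
      · omega
      · exact h.1
    · have := (hb₂ _ h).2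
      rw [hr₂ _ le_rfl, e1, e2] at this
      simp only [bad, if_true, Bool.or_eq_false_iff, Bool.and_eq_false_iff,
        decide_eq_false_iff_not, Bool.not_eq_false', decide_eq_true_eq] at this
      rcases this.1 with h' | h'
      · omega
      · exact h'
  have hfin : T.final (wA L) = true := by
    -- Whichever player reaches its final tile first, the other one is at the same tile by `hlast`.
    rcases min_choice LA LB with h | h
    · rw [hL, h]; exact hfA
    · rw [hlast, hL, h]; exact hfB
  have heq' : ∀ i ≤ L, wA i = wB i := by
    intro i hi
    rcases hi.eq_or_lt with rfl | hi
    · exact hlast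
    · exact heq i hi
  have hhor' : ∀ i < L, T.hor (wA i) (wA (i + 1)) = true := fun i hi => by
    rw [heq i hi]; exact hhor i hi
  -- The row length is not prescribed by the game. It is read off from the word as the first index
  -- outside the first row.
  have hexK : ∃ K, T.first (wA K) = false := ⟨L, hT.first_of_final _ hfin⟩
  set K := Nat.find hexK with hK
  have hKf := Nat.find_spec hexK
  rw [← hK] at hKf
  have hKL : K ≤ L := Nat.find_min' hexK (hT.first_of_final _ hfin)
  have hfirst : ∀ i < K, T.first (wA i) = true := fun i hi => by
    simpa using Nat.find_min hexK hi
  have hnfirst : ∀ d, K + d ≤ L → T.first (wA (K + d)) = false := by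
    intro d
    induction d with
    | zero => exact fun _ => hKf
    | succ d ih =>
      intro hd
      by_contra h
      have := hT.first_of_hor _ _ (hhor' (K + d) (by omega))
        (Bool.eq_true_of_not_eq_false h)
      rw [ih (by omega)] at this
      cases this
  have hKpos : 0 < K := by
    rcases Nat.eq_zero_or_pos K with h | h
    · rw [h, hA0, hT.first_start] at hKf
      cases hKf
    · exact h
  have hKphase : wA K % 3 = T.start % 3 := by
    have h1 := hhor' (K - 1) (by omega)
    rw [Nat.sub_add_cancel hKpos] at h1
    exact hT.phase_of_hor _ _ h1 (hfirst _ (by omega)) hKf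
  have hK3 : K % 3 = 0 := by
    have := hAp K fun i' hi' => hoA i' (by omega)
    omega
  -- The run exists for every number of solo moves, so it may be used for the `K` just found.
  obtain ⟨k₃, hg₃, hb₃⟩ := hrun 3 (by omega) le_rfl K
  have hr₃ : ∀ k ≤ 2 * (L - K),
      run OA OB (alternating K) (K + k) = (K + (k + 1) / 2, k / 2) :=
    run_alternating (fun i hi => hoA i (by omega)) (fun j hj => hoB j (by omega))
  -- On this schedule nothing is good up to this step: the second player waits at the start tile
  -- during the first row, and afterwards the lead is `K` or `K + 1`, with `K` divisible by 3. So
  -- all vertical tests must have been passed.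
  have hk₃ : K + 2 * (L - K) < k₃ := by
    by_contra hlt
    rcases Nat.lt_or_ge k₃ K with h | h
    · rw [run_alternating_le (fun i hi => hoA i (by omega)) k₃ h.le] at hg₃
      simp [good, hfirst _ h, hB0] at hg₃
    · obtain ⟨k, rfl⟩ := Nat.exists_eq_add_of_le h
      rw [hr₃ k (by omega)] at hg₃
      have pA := hAp (K + (k + 1) / 2) fun i' hi' => hoA i' (by omega)
      have pB := hBp (k / 2) fun i' hi' => hoB i' (by omega)
      simp only [good, if_false, OfNat.ofNat_ne_zero, OfNat.ofNat_ne_one, Nat.reduceEqDiff,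
        hnfirst _ (show K + (k + 1) / 2 ≤ L by omega), Bool.false_eq_true,
        decide_eq_true_eq] at hg₃
      omega
  refine ⟨L, K, wA, hKpos, hKL, hA0, ?_, ?_, hhor', ?_, hKphase, ?_, hfin⟩
  · intro i hi
    rcases i with _ | i
    · rw [hA0]; exact hT.start_lt
    · exact (hA i (hoA i (by omega))).1
  · exact fun i hi => (hA i (hoA i (by omega))).2
  · intro i hi
    refine ⟨fun h => ?_, hfirst i⟩
    by_contra hlt
    obtain ⟨d, rfl⟩ := Nat.exists_eq_add_of_le (not_lt.1 hlt)
    rw [hnfirst d hi] at h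
    cases h
  · intro i hi
    have := (hb₃ (K + 2 * i) (by omega)).2
    rw [hr₃ _ (by omega)] at this
    have e1 : (2 * i + 1) / 2 = i := by omega
    have e2 : 2 * i / 2 = i := by omega
    have pA := hAp (K + i) fun i' hi' => hoA i' (by omega)
    have pB := hAp i fun i' hi' => hoA i' (by omega)
    simp only [e1, e2, bad, if_true, if_false, Nat.reduceEqDiff,
      hnfirst i (by omega), Bool.not_false, Bool.true_and, Bool.and_eq_false_iff,
      decide_eq_false_iff_not, Bool.not_eq_false', ← heq' i (by omega)] at this
    rw [Nat.add_comm i K]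
    rcases this with h' | h'
    · omega
    · exact h'

end Extraction

end TileSystem

/-! ### The game of a tile system as an explicit code. -/

namespace TileSystem

/-- The list of tokens where the system players are at the tiles `a` and `b` and the environment
player is in state `m`, with `e - 1` idle environment players and `s - 2` idle system players. -/
def tokens (N s e a b m : ℕ) : List ℕ :=
  a :: (N + b) :: (2 * N + m) ::
    (List.replicate (e - 1) (2 * N + 4) ++ List.replicate (s - 2) (2 * N + 5))

def arcs (N : ℕ) : List (List ℕ × List ℕ) :=
  [([2 * N], [2 * N + 1]), ([2 * N], [2 * N + 2]), ([2 * N], [2 * N + 3])] ++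
    (List.range N).flatMap fun a => (List.range N).flatMap fun b =>
      if b % 3 = (a + 1) % 3 then [([a], [b]), ([N + a], [N + b])] else []

def tokensList (N s e : ℕ) (P : ℕ → ℕ → ℕ → Bool) : List (List ℕ) :=
  (List.range N).flatMap fun a => (List.range N).flatMap fun b => (List.range 4).flatMap fun m =>
    if P a b m = true then [tokens N s e a b m] else []

/-- The Petri game in which two system players play words of tiles independently, while the
environment player selects what is checked. -/
def code (T : TileSystem) (s e : ℕ) : PetriGameCode :=
  (List.replicate (2 * T.size) true ++ [false, false, false, false, false, true],
    arcs T.size,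
    tokens T.size s e T.start T.start 0,
    tokensList T.size s e T.good,
    -- Removing the good markings makes the disjointness of the two lists immediate.
    tokensList T.size s e fun a b m => T.bad a b m && !(T.good a b m))

/-- There is a transition from place `p` to place `q`. -/
def ArcRel (N p q : ℕ) : Prop :=
  (p < N ∧ q < N ∧ q % 3 = (p + 1) % 3) ∨
    (∃ a b, p = N + a ∧ q = N + b ∧ a < N ∧ b < N ∧ b % 3 = (a + 1) % 3) ∨
    (p = 2 * N ∧ ∃ m, 1 ≤ m ∧ m ≤ 3 ∧ q = 2 * N + m)

theorem mem_arcs {N : ℕ} {x : List ℕ × List ℕ} :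
    x ∈ arcs N ↔ ∃ p q, x = ([p], [q]) ∧ ArcRel N p q := by
  constructor
  · intro h
    rw [arcs, List.mem_append] at h
    rcases h with h | h
    · simp only [List.mem_cons, List.not_mem_nil, or_false] at h
      rcases h with rfl | rfl | rfl
      · exact ⟨_, _, rfl, Or.inr (Or.inr ⟨rfl, 1, by omega, by omega, rfl⟩)⟩
      · exact ⟨_, _, rfl, Or.inr (Or.inr ⟨rfl, 2, by omega, by omega, rfl⟩)⟩
      · exact ⟨_, _, rfl, Or.inr (Or.inr ⟨rfl, 3, by omega, by omega, rfl⟩)⟩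
    · simp only [List.mem_flatMap, List.mem_range] at h
      obtain ⟨a, ha, b, hb, h⟩ := h
      split_ifs at h with hab
      · simp only [List.mem_cons, List.not_mem_nil, or_false] at h
        rcases h with rfl | rfl
        · exact ⟨_, _, rfl, Or.inl ⟨ha, hb, hab⟩⟩
        · exact ⟨_, _, rfl, Or.inr (Or.inl ⟨a, b, rfl, rfl, ha, hb, hab⟩)⟩
      · cases h
  · rintro ⟨p, q, rfl, h⟩
    rw [arcs, List.mem_append]
    rcases h with ⟨h1, h2, h3⟩ | ⟨a, b, rfl, rfl, h1, h2, h3⟩ | ⟨rfl, m, h1, h2, rfl⟩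
    · right
      simp only [List.mem_flatMap, List.mem_range]
      exact ⟨p, h1, q, h2, by rw [if_pos h3]; simp⟩
    · right
      simp only [List.mem_flatMap, List.mem_range]
      exact ⟨a, h1, b, h2, by rw [if_pos h3]; simp⟩
    · left
      have : m = 1 ∨ m = 2 ∨ m = 3 := by omega
      rcases this with rfl | rfl | rfl <;> simp

theorem mem_tokensList {N s e : ℕ} {P : ℕ → ℕ → ℕ → Bool} {l : List ℕ} :
    l ∈ tokensList N s e P ↔
      ∃ a b m, a < N ∧ b < N ∧ m < 4 ∧ P a b m = true ∧ l = tokens N s e a b m := by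
  simp only [tokensList, List.mem_flatMap, List.mem_range]
  constructor
  · rintro ⟨a, ha, b, hb, m, hm, h⟩
    split_ifs at h with hP
    · exact ⟨a, b, m, ha, hb, hm, hP, by simpa using h⟩
    · cases h
  · rintro ⟨a, b, m, ha, hb, hm, hP, rfl⟩
    exact ⟨a, ha, b, hb, m, hm, by rw [if_pos hP]; simp⟩

variable (T : TileSystem) (s e : ℕ)

abbrev game : PetriGame ℕ ℕ := PetriGameCode.toGame (T.code s e)

/-- The tokens of the idle players. -/
def idle (N s e : ℕ) : Multiset ℕ :=
  ↑(List.replicate (e - 1) (2 * N + 4) ++ List.replicate (s - 2) (2 * N + 5))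

def marking (N s e a b m : ℕ) : Multiset ℕ :=
  a ::ₘ (N + b) ::ₘ (2 * N + m) ::ₘ idle N s e

theorem marking_eq_env (N s e a b m : ℕ) :
    marking N s e a b m = (2 * N + m) ::ₘ a ::ₘ (N + b) ::ₘ idle N s e := by
  rw [marking, Multiset.cons_swap (N + b), Multiset.cons_swap a]

theorem marking_eq_snd (N s e a b m : ℕ) :
    marking N s e a b m = (N + b) ::ₘ a ::ₘ (2 * N + m) ::ₘ idle N s e :=
  Multiset.cons_swap _ _ _

theorem coe_tokens (N s e a b m : ℕ) : (tokens N s e a b m : Multiset ℕ) = marking N s e a b m :=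
  rfl

theorem mem_idle {N s e x : ℕ} (h : x ∈ idle N s e) : x = 2 * N + 4 ∨ x = 2 * N + 5 := by
  rw [idle, Multiset.mem_coe, List.mem_append] at h
  rcases h with h | h
  · exact Or.inl (List.eq_of_mem_replicate h)
  · exact Or.inr (List.eq_of_mem_replicate h)

theorem mem_marking {N s e a b m x : ℕ} (h : x ∈ marking N s e a b m) :
    x = a ∨ x = N + b ∨ x = 2 * N + m ∨ x = 2 * N + 4 ∨ x = 2 * N + 5 := by
  simp only [marking, Multiset.mem_cons] at h
  rcases h with h | h | h | h
  · exact Or.inl h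
  · exact Or.inr (Or.inl h)
  · exact Or.inr (Or.inr (Or.inl h))
  · exact Or.inr (Or.inr (Or.inr (mem_idle h)))

theorem marking_injective {N s e a b m a' b' m' : ℕ} (ha : a < N) (ha' : a' < N) (hb : b < N)
    (hb' : b' < N) (hm : m < 4) (hm' : m' < 4)
    (h : marking N s e a b m = marking N s e a' b' m') : a = a' ∧ b = b' ∧ m = m' := by
  have h1 : a ∈ marking N s e a' b' m' := h ▸ Multiset.mem_cons_self _ _
  have h2 : N + b ∈ marking N s e a' b' m' :=
    h ▸ Multiset.mem_cons_of_mem (Multiset.mem_cons_self _ _)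
  have h3 : 2 * N + m ∈ marking N s e a' b' m' :=
    h ▸ Multiset.mem_cons_of_mem (Multiset.mem_cons_of_mem (Multiset.mem_cons_self _ _))
  have h1 := mem_marking h1
  have h2 := mem_marking h2
  have h3 := mem_marking h3
  omega

theorem mem_good {a b m : ℕ} (ha : a < T.size) (hb : b < T.size) (hm : m < 4) :
    marking T.size s e a b m ∈ (T.game s e).good ↔ T.good a b m = true := by
  constructor
  · rintro ⟨l, hl, h⟩
    obtain ⟨a', b', m', ha', hb', hm', hP, rfl⟩ := mem_tokensList.1 hl
    obtain ⟨rfl, rfl, rfl⟩ := marking_injective ha ha' hb hb' hm hm' h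
    exact hP
  · exact fun h => ⟨_, mem_tokensList.2 ⟨a, b, m, ha, hb, hm, h, rfl⟩, rfl⟩

theorem mem_bad {a b m : ℕ} (ha : a < T.size) (hb : b < T.size) (hm : m < 4) :
    marking T.size s e a b m ∈ (T.game s e).bad ↔
      T.bad a b m = true ∧ T.good a b m = false := by
  have key : ∀ a b m, (T.bad a b m && !(T.good a b m)) = true ↔
      T.bad a b m = true ∧ T.good a b m = false := by simp
  rw [← key]
  constructor
  · rintro ⟨l, hl, h⟩
    obtain ⟨a', b', m', ha', hb', hm', hP, rfl⟩ := mem_tokensList.1 hl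
    obtain ⟨rfl, rfl, rfl⟩ := marking_injective ha ha' hb hb' hm hm' h
    exact hP
  · exact fun h => ⟨_, mem_tokensList.2 ⟨a, b, m, ha, hb, hm, h, rfl⟩, rfl⟩

theorem pre_post_eq {t : ℕ} (ht : t ∈ (T.game s e).net.transitions) :
    ∃ p q, (T.game s e).net.pre t = {p} ∧ (T.game s e).net.post t = {q} ∧ ArcRel T.size p q := by
  have ht' : t < (arcs T.size).length := ht
  obtain ⟨p, q, h, hr⟩ := mem_arcs.1 (List.getElem_mem ht')
  have h' : (arcs T.size).getD t ([], []) = ([p], [q]) := by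
    rw [List.getD_eq_getElem _ _ ht', h]
  refine ⟨p, q, ?_, ?_, hr⟩
  · change (((arcs T.size).getD t ([], [])).1 : Multiset ℕ) = {p}
    rw [h']; rfl
  · change (((arcs T.size).getD t ([], [])).2 : Multiset ℕ) = {q}
    rw [h']; rfl

/-- The transition from `p` to `q`. -/
def arcIndex (N p q : ℕ) : ℕ := (arcs N).idxOf ([p], [q])

variable {T} in
theorem arcIndex_spec {p q : ℕ} (h : ArcRel T.size p q) :
    arcIndex T.size p q ∈ (T.game s e).net.transitions ∧
      (T.game s e).net.pre (arcIndex T.size p q) = {p} ∧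
      (T.game s e).net.post (arcIndex T.size p q) = {q} := by
  have hmem : ([p], [q]) ∈ arcs T.size := mem_arcs.2 ⟨p, q, rfl, h⟩
  have hlt : arcIndex T.size p q < (arcs T.size).length := List.idxOf_lt_length_of_mem hmem
  have h' : (arcs T.size).getD (arcIndex T.size p q) ([], []) = ([p], [q]) := by
    rw [List.getD_eq_getElem _ _ hlt]
    exact List.getElem_idxOf hlt
  refine ⟨hlt, ?_, ?_⟩
  · change (((arcs T.size).getD (arcIndex T.size p q) ([], [])).1 : Multiset ℕ) = {p}
    rw [h']; rfl
  · change (((arcs T.size).getD (arcIndex T.size p q) ([], [])).2 : Multiset ℕ) = {q}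
    rw [h']; rfl

/-- Justified refusal concerns the transition itself, not only its endpoints. The environment cannot
refuse, so its transitions must be determined by their endpoints; a system place may simply refuse
any other transition. -/
theorem env_transition_unique {t m : ℕ} (ht : t ∈ (T.game s e).net.transitions)
    (hpre : (T.game s e).net.pre t = {2 * T.size})
    (hpost : (T.game s e).net.post t = {2 * T.size + m}) : t + 1 = m := by
  have ht' : t < (arcs T.size).length := ht
  change (((arcs T.size).getD t ([], [])).1 : Multiset ℕ) = {2 * T.size} at hpre
  change (((arcs T.size).getD t ([], [])).2 : Multiset ℕ) = {2 * T.size + m} at hpost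
  rw [List.getD_eq_getElem _ _ ht'] at hpre hpost
  rcases Nat.lt_or_ge t 3 with h | h
  · have h3 : t = 0 ∨ t = 1 ∨ t = 2 := by omega
    rcases h3 with rfl | rfl | rfl <;>
    · simp [arcs] at hpost
      omega
  · exfalso
    have hmem : (arcs T.size)[t] ∈ (List.range T.size).flatMap fun a =>
        (List.range T.size).flatMap fun b =>
          if b % 3 = (a + 1) % 3 then [([a], [b]), ([T.size + a], [T.size + b])] else [] := by
      simp only [arcs]
      rw [List.getElem_append_right (by simpa using h)]
      exact List.getElem_mem _
    simp only [List.mem_flatMap, List.mem_range] at hmem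
    obtain ⟨a, ha, b, hb, hmem⟩ := hmem
    split_ifs at hmem with hab
    · simp only [List.mem_cons, List.not_mem_nil, or_false] at hmem
      rcases hmem with hmem | hmem <;> rw [hmem] at hpre <;> simp at hpre <;> omega
    · cases hmem

theorem mem_sysPlaces {p : ℕ} :
    p ∈ (T.game s e).sysPlaces ↔ p < 2 * T.size ∨ p = 2 * T.size + 5 := by
  change (List.replicate (2 * T.size) true ++ [false, false, false, false, false, true])[p]? =
    some true ↔ _
  rcases Nat.lt_or_ge p (2 * T.size) with h | h
  · rw [List.getElem?_append_left (by simpa using h), List.getElem?_replicate, if_pos h]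
    simp [h]
  · rw [List.getElem?_append_right (by simpa using h), List.length_replicate]
    obtain ⟨d, rfl⟩ := Nat.exists_eq_add_of_le h
    rw [Nat.add_sub_cancel_left]
    rcases d with _ | _ | _ | _ | _ | _ | d <;> simp

theorem mem_envPlaces {p : ℕ} :
    p ∈ (T.game s e).envPlaces ↔ 2 * T.size ≤ p ∧ p < 2 * T.size + 5 := by
  change (List.replicate (2 * T.size) true ++ [false, false, false, false, false, true])[p]? =
    some false ↔ _
  rcases Nat.lt_or_ge p (2 * T.size) with h | h
  · rw [List.getElem?_append_left (by simpa using h), List.getElem?_replicate, if_pos h]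
    simp
    omega
  · rw [List.getElem?_append_right (by simpa using h), List.length_replicate]
    obtain ⟨d, rfl⟩ := Nat.exists_eq_add_of_le h
    rw [Nat.add_sub_cancel_left]
    rcases d with _ | _ | _ | _ | _ | _ | d <;> simp

theorem mem_places {p : ℕ} : p ∈ (T.game s e).net.places ↔ p < 2 * T.size + 6 := by
  change p < (List.replicate (2 * T.size) true ++
    [false, false, false, false, false, true]).length ↔ _
  simp

theorem lt_of_arcRel {N p q : ℕ} (h : ArcRel N p q) : p < 2 * N + 6 ∧ q < 2 * N + 6 := by
  rcases h with ⟨h1, h2, h3⟩ | ⟨a, b, rfl, rfl, h1, h2, h3⟩ | ⟨rfl, m, h1, h2, rfl⟩ <;> omega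

end TileSystem

theorem PetriNet.Fires.eq_cons {α β : Type} {N : PetriNet α β} {M M' X : Multiset α} {t : β}
    {p q : α} (h : N.Fires M t M') (hpre : N.pre t = {p}) (hpost : N.post t = {q})
    (hM : M = p ::ₘ X) : M' = q ::ₘ X := by
  have := h.2
  rw [hpre, hpost, hM] at this
  refine Multiset.cons_inj_right p |>.1 ?_
  rw [← Multiset.singleton_add, Multiset.add_comm, this, Multiset.cons_swap,
    ← Multiset.singleton_add q, Multiset.add_comm]

theorem PetriNet.fires_cons {α β : Type} {N : PetriNet α β} {X : Multiset α} {t : β}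
    {p q : α} (ht : t ∈ N.transitions) (hpre : N.pre t = {p}) (hpost : N.post t = {q}) :
    N.Fires (p ::ₘ X) t (q ::ₘ X) := by
  refine ⟨⟨ht, ?_⟩, ?_⟩
  · rw [hpre]; exact Multiset.singleton_le.2 (Multiset.mem_cons_self _ _)
  · rw [hpre, hpost, Multiset.add_comm, Multiset.singleton_add, Multiset.add_comm _ {q},
      Multiset.singleton_add, Multiset.cons_swap]

/-! ### Reachable markings and the number of players. -/

namespace TileSystem

variable {T : TileSystem} {s e : ℕ}

theorem reachable_cases (hT : T.IsProper) {M : Multiset ℕ} (h : (T.game s e).net.Reachable M) :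
    ∃ a b m, a < T.size ∧ b < T.size ∧ m < 4 ∧ M = marking T.size s e a b m := by
  induction h with
  | init => exact ⟨T.start, T.start, 0, hT.start_lt, hT.start_lt, by omega, rfl⟩
  | @step M M' t _ hf ih =>
    obtain ⟨a, b, m, ha, hb, hm, rfl⟩ := ih
    obtain ⟨p, q, hpre, hpost, hr⟩ := T.pre_post_eq s e hf.1.1
    have hp : p ∈ marking T.size s e a b m := by
      have := hf.1.2
      rw [hpre] at this
      exact Multiset.singleton_le.1 this
    have hp' := mem_marking hp
    rcases hr with ⟨h1, h2, h3⟩ | ⟨x, y, rfl, rfl, h1, h2, h3⟩ | ⟨rfl, m', h1, h2, rfl⟩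
    · obtain rfl : p = a := by omega
      exact ⟨q, b, m, h2, hb, hm, hf.eq_cons hpre hpost rfl⟩
    · obtain rfl : x = b := by omega
      refine ⟨a, y, m, ha, h2, hm, ?_⟩
      rw [hf.eq_cons hpre hpost (marking_eq_snd _ _ _ _ _ _), marking_eq_snd]
    · obtain rfl : m = 0 := by omega
      refine ⟨a, b, m', ha, hb, by omega, ?_⟩
      rw [hf.eq_cons hpre hpost (marking_eq_env _ _ _ _ _ _), marking_eq_env]

theorem reachable_fst {a a' b m : ℕ} (h : (T.game s e).net.Reachable (marking T.size s e a b m))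
    (ha : a < T.size) (ha' : a' < T.size) (hp : a' % 3 = (a + 1) % 3) :
    (T.game s e).net.Reachable (marking T.size s e a' b m) := by
  have hs := arcIndex_spec (T := T) s e (Or.inl ⟨ha, ha', hp⟩)
  exact h.step (PetriNet.fires_cons hs.1 hs.2.1 hs.2.2)

theorem reachable_snd {a b b' m : ℕ} (h : (T.game s e).net.Reachable (marking T.size s e a b m))
    (hb : b < T.size) (hb' : b' < T.size) (hp : b' % 3 = (b + 1) % 3) :
    (T.game s e).net.Reachable (marking T.size s e a b' m) := by
  have hs := arcIndex_spec (T := T) s e (Or.inr (Or.inl ⟨b, b', rfl, rfl, hb, hb', hp⟩))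
  have := PetriNet.fires_cons (X := a ::ₘ (2 * T.size + m) ::ₘ idle T.size s e) hs.1 hs.2.1 hs.2.2
  rw [← marking_eq_snd, ← marking_eq_snd] at this
  exact h.step this

theorem reachable_env {a b m : ℕ} (h : (T.game s e).net.Reachable (marking T.size s e a b 0))
    (h1 : 1 ≤ m) (h2 : m ≤ 3) :
    (T.game s e).net.Reachable (marking T.size s e a b m) := by
  have hs := arcIndex_spec (T := T) s e (Or.inr (Or.inr ⟨rfl, m, h1, h2, rfl⟩))
  have := PetriNet.fires_cons (X := a ::ₘ (T.size + b) ::ₘ idle T.size s e) hs.1 hs.2.1 hs.2.2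
  rw [← marking_eq_env] at this
  rw [marking_eq_env] at h
  exact h.step this

/-- With at least three tiles, the tiles 0, 1, 2 represent all phases. A walk through them reaches a
tile of the phase preceding that of `y`, from which `y` is one move away. -/
theorem phase_induction {N : ℕ} (hN : 3 ≤ N) {P : ℕ → Prop} {x : ℕ} (hx : x < N) (h0 : P x)
    (hstep : ∀ a a', P a → a < N → a' < N → a' % 3 = (a + 1) % 3 → P a') :
    ∀ y < N, P y := by
  have h1 : P ((x + 1) % 3) := hstep x _ h0 hx (by omega) (by omega)
  have h2 : P ((x + 2) % 3) := hstep _ _ h1 (by omega) (by omega) (by omega)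
  have h3 : P ((x + 3) % 3) := hstep _ _ h2 (by omega) (by omega) (by omega)
  intro y hy
  have : y % 3 = (x + 1) % 3 ∨ y % 3 = (x + 2) % 3 ∨ y % 3 = (x + 3) % 3 := by omega
  rcases this with h | h | h
  · exact hstep _ _ h0 hx hy (by omega)
  · exact hstep _ _ h1 (by omega) hy (by omega)
  · exact hstep _ _ h2 (by omega) hy (by omega)

/-- In the net, moves are restricted only by the phase; the tile constraints live in the markings.
Therefore all listed good and bad markings are reachable, as a Petri game requires. -/
theorem reachable_marking (hT : T.IsProper) {a b m : ℕ} (ha : a < T.size) (hb : b < T.size)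
    (hm : m < 4) : (T.game s e).net.Reachable (marking T.size s e a b m) := by
  have h0 : (T.game s e).net.Reachable (marking T.size s e T.start T.start 0) :=
    PetriNet.Reachable.init
  have h1 : (T.game s e).net.Reachable (marking T.size s e a T.start 0) :=
    phase_induction hT.three_le hT.start_lt h0 (fun _ _ h => reachable_fst h) a ha
  have h2 : (T.game s e).net.Reachable (marking T.size s e a b 0) :=
    phase_induction hT.three_le hT.start_lt h1 (fun _ _ h => reachable_snd h) b hb
  rcases Nat.eq_zero_or_pos m with rfl | h
  · exact h2
  · exact reachable_env h2 h (by omega)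

theorem isPetriGame (hT : T.IsProper) : (T.game s e).IsPetriGame where
  wellFormed := by
    refine ⟨fun t ht p hp => ?_, fun t ht p hp => ?_, fun p hp => ?_⟩
    · obtain ⟨x, y, h1, h2, h3⟩ := T.pre_post_eq s e ht
      rw [h1, Multiset.mem_singleton] at hp
      exact (T.mem_places s e).2 (hp ▸ (lt_of_arcRel h3).1)
    · obtain ⟨x, y, h1, h2, h3⟩ := T.pre_post_eq s e ht
      rw [h2, Multiset.mem_singleton] at hp
      exact (T.mem_places s e).2 (hp ▸ (lt_of_arcRel h3).2)
    · have := mem_marking (N := T.size) (s := s) (e := e) (a := T.start) (b := T.start) (m := 0) hp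
      have := hT.start_lt
      rw [mem_places]
      omega
  finite_places := Set.finite_lt_nat _
  finite_transitions := Set.finite_lt_nat _
  union_eq := by
    ext p
    rw [Set.mem_union, mem_sysPlaces, mem_envPlaces, mem_places]
    omega
  disjoint_places := by
    rw [Set.disjoint_left]
    intro p hp hp'
    rw [mem_sysPlaces] at hp
    rw [mem_envPlaces] at hp'
    omega
  good_reachable := by
    rintro M ⟨l, hl, rfl⟩
    obtain ⟨a, b, m, ha, hb, hm, -, rfl⟩ := mem_tokensList.1 hl
    exact reachable_marking hT ha hb hm
  bad_reachable := by
    rintro M ⟨l, hl, rfl⟩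
    obtain ⟨a, b, m, ha, hb, hm, -, rfl⟩ := mem_tokensList.1 hl
    exact reachable_marking hT ha hb hm
  disjoint_markings := by
    rw [Set.disjoint_left]
    rintro M hg ⟨l, hl, rfl⟩
    obtain ⟨a, b, m, ha, hb, hm, hP, rfl⟩ := mem_tokensList.1 hl
    rw [coe_tokens, mem_good _ _ _ ha hb hm] at hg
    simp [hg] at hP

theorem hasPlayers (hT : T.IsProper) (hs : 2 ≤ s) (he : 1 ≤ e) : (T.game s e).HasPlayers s e := by
  classical
  intro M hM
  obtain ⟨a, b, m, ha, hb, hm, rfl⟩ := reachable_cases hT hM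
  have hrep : ∀ (P : ℕ → Prop) [DecidablePred P] (n x : ℕ),
      (Multiset.replicate n x).filter P = if P x then Multiset.replicate n x else 0 := by
    intro P _ n x
    split_ifs with h
    · exact Multiset.filter_eq_self.2 fun y hy => Multiset.eq_of_mem_replicate hy ▸ h
    · exact Multiset.filter_eq_nil.2 fun y hy => Multiset.eq_of_mem_replicate hy ▸ h
  have hidle : ∀ P : ℕ → Prop, ∀ [DecidablePred P], (idle T.size s e).filter P =
      (if P (2 * T.size + 4) then Multiset.replicate (e - 1) (2 * T.size + 4) else 0) +
      (if P (2 * T.size + 5) then Multiset.replicate (s - 2) (2 * T.size + 5) else 0) := by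
    intro P _
    rw [idle, ← Multiset.coe_add, Multiset.filter_add, Multiset.coe_replicate,
      Multiset.coe_replicate, hrep, hrep]
  constructor
  · have h1 : a ∈ (T.game s e).sysPlaces := (mem_sysPlaces T s e).2 (by omega)
    have h2 : T.size + b ∈ (T.game s e).sysPlaces := (mem_sysPlaces T s e).2 (by omega)
    have h3 : 2 * T.size + m ∉ (T.game s e).sysPlaces := fun h => by
      have := (mem_sysPlaces T s e).1 h
      omega
    have h4 : 2 * T.size + 4 ∉ (T.game s e).sysPlaces := fun h => by
      have := (mem_sysPlaces T s e).1 h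
      omega
    have h5 : 2 * T.size + 5 ∈ (T.game s e).sysPlaces := (mem_sysPlaces T s e).2 (by omega)
    rw [marking, Multiset.filter_cons_of_pos _ h1, Multiset.filter_cons_of_pos _ h2,
      Multiset.filter_cons_of_neg _ h3, hidle, if_neg h4, if_pos h5]
    simp
    omega
  · have h1 : a ∉ (T.game s e).envPlaces := fun h => by
      have := (mem_envPlaces T s e).1 h
      omega
    have h2 : T.size + b ∉ (T.game s e).envPlaces := fun h => by
      have := (mem_envPlaces T s e).1 h
      omega
    have h3 : 2 * T.size + m ∈ (T.game s e).envPlaces := (mem_envPlaces T s e).2 (by omega)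
    have h4 : 2 * T.size + 4 ∈ (T.game s e).envPlaces := (mem_envPlaces T s e).2 (by omega)
    have h5 : 2 * T.size + 5 ∉ (T.game s e).envPlaces := fun h => by
      have := (mem_envPlaces T s e).1 h
      omega
    rw [marking, Multiset.filter_cons_of_neg _ h1, Multiset.filter_cons_of_neg _ h2,
      Multiset.filter_cons_of_pos _ h3, hidle, if_pos h4, if_neg h5]
    simp
    omega

end TileSystem

/-! ### The strategy given by a solution. -/

namespace TileSystem

open PetriNet

section Strategy

/-- The source of a transition of `strategyNet`. -/
def src (t : ℕ × ℕ) : ℕ × ℕ := if t.1 = 2 then (2, 0) else t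

/-- The target of a transition of `strategyNet`. -/
def tgt (t : ℕ × ℕ) : ℕ × ℕ := if t.1 = 2 then t else (t.1, t.2 + 1)

/-- The unfolding in which both system players move `L` times. The places `(0, i)` and `(1, j)`
belong to them, `(2, m)` to the environment player, `(3, k)` and `(4, k)` to the idle players. -/
def strategyNet (L s e : ℕ) : PetriNet (ℕ × ℕ) (ℕ × ℕ) where
  places := {p | (p.1 ≤ 1 ∧ p.2 ≤ L) ∨ (p.1 = 2 ∧ p.2 ≤ 3) ∨ (p.1 = 3 ∧ p.2 < e - 1) ∨
    (p.1 = 4 ∧ p.2 < s - 2)}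
  transitions := {t | (t.1 ≤ 1 ∧ t.2 < L) ∨ (t.1 = 2 ∧ 1 ≤ t.2 ∧ t.2 ≤ 3)}
  pre t := {src t}
  post t := {tgt t}
  init := (0, 0) ::ₘ (1, 0) ::ₘ (2, 0) ::ₘ
    ((Multiset.range (e - 1)).map (Prod.mk 3) + (Multiset.range (s - 2)).map (Prod.mk 4))

def placeLabel (N : ℕ) (w : ℕ → ℕ) (p : ℕ × ℕ) : ℕ :=
  if p.1 = 0 then w p.2 else if p.1 = 1 then N + w p.2 else if p.1 = 2 then 2 * N + p.2
  else if p.1 = 3 then 2 * N + 4 else 2 * N + 5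

def transitionLabel (N : ℕ) (w : ℕ → ℕ) (t : ℕ × ℕ) : ℕ :=
  arcIndex N (placeLabel N w (src t)) (placeLabel N w (tgt t))

variable {L s e : ℕ}

theorem mem_init_strategyNet {p : ℕ × ℕ} : p ∈ (strategyNet L s e).init ↔
    p = (0, 0) ∨ p = (1, 0) ∨ p = (2, 0) ∨ (p.1 = 3 ∧ p.2 < e - 1) ∨
      (p.1 = 4 ∧ p.2 < s - 2) := by
  obtain ⟨c, i⟩ := p
  simp only [strategyNet, Multiset.mem_cons, Multiset.mem_add, Multiset.mem_map,
    Multiset.mem_range, Prod.mk.injEq]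
  constructor
  · rintro (h | h | h | ⟨k, hk, rfl, rfl⟩ | ⟨k, hk, rfl, rfl⟩)
    · exact Or.inl h
    · exact Or.inr (Or.inl h)
    · exact Or.inr (Or.inr (Or.inl h))
    · exact Or.inr (Or.inr (Or.inr (Or.inl ⟨rfl, hk⟩)))
    · exact Or.inr (Or.inr (Or.inr (Or.inr ⟨rfl, hk⟩)))
  · rintro (h | h | h | ⟨rfl, hk⟩ | ⟨rfl, hk⟩)
    · exact Or.inl h
    · exact Or.inr (Or.inl h)
    · exact Or.inr (Or.inr (Or.inl h))
    · exact Or.inr (Or.inr (Or.inr (Or.inl ⟨i, hk, rfl, rfl⟩)))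
    · exact Or.inr (Or.inr (Or.inr (Or.inr ⟨i, hk, rfl, rfl⟩)))

theorem src_of_ne {t : ℕ × ℕ} (h : t.1 ≠ 2) : src t = t := if_neg h

theorem tgt_of_ne {t : ℕ × ℕ} (h : t.1 ≠ 2) : tgt t = (t.1, t.2 + 1) := if_neg h

theorem src_env (m : ℕ) : src (2, m) = (2, 0) := rfl

theorem tgt_env (m : ℕ) : tgt (2, m) = (2, m) := rfl

theorem mem_transitions_cases {t : ℕ × ℕ} (ht : t ∈ (strategyNet L s e).transitions) :
    (∃ c i, t = (c, i) ∧ c ≤ 1 ∧ i < L ∧ src t = (c, i) ∧ tgt t = (c, i + 1)) ∨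
      ∃ m, t = (2, m) ∧ 1 ≤ m ∧ m ≤ 3 ∧ src t = (2, 0) ∧ tgt t = (2, m) := by
  obtain ⟨c, i⟩ := t
  rcases ht with ⟨h1, h2⟩ | ⟨h1, h2, h3⟩
  · dsimp only at h1 h2
    exact Or.inl ⟨c, i, rfl, h1, h2, src_of_ne (by dsimp only; omega),
      tgt_of_ne (by dsimp only; omega)⟩
  · dsimp only at h1 h2 h3
    subst h1
    exact Or.inr ⟨i, rfl, h2, h3, rfl, rfl⟩

/-- The rank of a node of `strategyNet` with respect to the flow relation. -/
def rank : (ℕ × ℕ) ⊕ (ℕ × ℕ) → ℕ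
  | Sum.inl p => 2 * p.2
  | Sum.inr t => 2 * (src t).2 + 1

theorem rank_lt_of_arc {x y : (ℕ × ℕ) ⊕ (ℕ × ℕ)} (h : (strategyNet L s e).Arc x y) :
    rank x < rank y := by
  rcases x with p | t <;> rcases y with q | u
  · cases h
  · obtain ⟨-, h⟩ := h
    have : p = src u := Multiset.mem_singleton.1 h
    simp [rank, this]
  · obtain ⟨ht, h⟩ := h
    have : q = tgt t := Multiset.mem_singleton.1 h
    subst this
    rcases mem_transitions_cases ht with ⟨c, i, rfl, -, -, hs, ht'⟩ | ⟨m, rfl, h1, -, hs, ht'⟩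
    · simp [rank, hs, ht']
      omega
    · simp [rank, hs, ht']
      omega
  · cases h

/-- The initial environment place is the only place that branches. Its branches end immediately and
never meet, so no transition is in conflict with itself. -/
theorem causal_env {m : ℕ} (hm : 1 ≤ m) {y : (ℕ × ℕ) ⊕ (ℕ × ℕ)}
    (h : (strategyNet L s e).Causal (Sum.inr (2, m)) y) :
    y = Sum.inr (2, m) ∨ y = Sum.inl (2, m) := by
  induction h with
  | refl => exact Or.inl rfl
  | @tail y z _ hyz ih =>
    rcases ih with rfl | rfl
    · rcases z with q | u
      · obtain ⟨-, h⟩ := hyz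
        right
        rw [Multiset.mem_singleton.1 h, tgt_env]
      · cases hyz
    · rcases z with q | u
      · cases hyz
      · obtain ⟨hu, h⟩ := hyz
        have h' : (2, m) = src u := Multiset.mem_singleton.1 h
        rcases mem_transitions_cases hu with ⟨c, i, rfl, h1, -, hs, -⟩ | ⟨m', rfl, -, -, hs, -⟩
        · rw [hs, Prod.mk.injEq] at h'
          omega
        · rw [hs, Prod.mk.injEq] at h'
          omega

theorem strategyNet_isOccurrenceNet (L s e : ℕ) : (strategyNet L s e).IsOccurrenceNet where
  wellFormed := by
    refine ⟨fun t ht p hp => ?_, fun t ht p hp => ?_, fun p hp => ?_⟩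
    · obtain rfl : p = src t := Multiset.mem_singleton.1 hp
      rcases mem_transitions_cases ht with ⟨c, i, rfl, h1, h2, hs, -⟩ | ⟨m, rfl, -, -, hs, -⟩
      · rw [hs]
        exact Or.inl ⟨h1, h2.le⟩
      · rw [hs]
        exact Or.inr (Or.inl ⟨rfl, Nat.zero_le _⟩)
    · obtain rfl : p = tgt t := Multiset.mem_singleton.1 hp
      rcases mem_transitions_cases ht with ⟨c, i, rfl, h1, h2, -, hs⟩ | ⟨m, rfl, -, h2, -, hs⟩
      · rw [hs]
        exact Or.inl ⟨h1, h2⟩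
      · rw [hs]
        exact Or.inr (Or.inl ⟨rfl, h2⟩)
    · rcases mem_init_strategyNet.1 hp with rfl | rfl | rfl | h | h
      · exact Or.inl ⟨Nat.zero_le _, Nat.zero_le _⟩
      · exact Or.inl ⟨le_rfl, Nat.zero_le _⟩
      · exact Or.inr (Or.inl ⟨rfl, Nat.zero_le _⟩)
      · exact Or.inr (Or.inr (Or.inl h))
      · exact Or.inr (Or.inr (Or.inr h))
  pre_nodup t _ := Multiset.nodup_singleton _
  post_nodup t _ := Multiset.nodup_singleton _
  init_nodup := by
    have h3 : ((Multiset.range (e - 1)).map (Prod.mk 3)).Nodup :=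
      (Multiset.nodup_map_iff_of_injective (Prod.mk_right_injective 3)).2 (Multiset.nodup_range _)
    have h4 : ((Multiset.range (s - 2)).map (Prod.mk 4)).Nodup :=
      (Multiset.nodup_map_iff_of_injective (Prod.mk_right_injective 4)).2 (Multiset.nodup_range _)
    have h34 : ((Multiset.range (e - 1)).map (Prod.mk 3) +
        (Multiset.range (s - 2)).map (Prod.mk 4)).Nodup := by
      refine (Multiset.nodup_add).2 ⟨h3, h4, Multiset.disjoint_left.2 fun hx hx' => ?_⟩
      obtain ⟨i, -, rfl⟩ := Multiset.mem_map.1 hx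
      obtain ⟨j, -, h⟩ := Multiset.mem_map.1 hx'
      simp at h
    simp only [strategyNet, Multiset.nodup_cons, Multiset.mem_cons, Multiset.mem_add,
      Multiset.mem_map, Prod.mk.injEq]
    refine ⟨?_, ?_, ?_, h34⟩ <;> simp
  mem_init_iff := by
    intro p hp
    rw [mem_init_strategyNet]
    constructor
    · intro h t ht hpt
      obtain rfl : p = tgt t := Multiset.mem_singleton.1 hpt
      rcases mem_transitions_cases ht with ⟨c, i, rfl, h1, h2, -, hs⟩ | ⟨m, rfl, h1, h2, -, hs⟩ <;>
      · simp only [hs, Prod.mk.injEq] at h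
        omega
    · intro h
      obtain ⟨c, i⟩ := p
      rcases hp with ⟨h1, h2⟩ | ⟨h1, h2⟩ | h3 | h4
      · dsimp only at h1 h2
        rcases i with _ | i
        · have : c = 0 ∨ c = 1 := by omega
          rcases this with rfl | rfl <;> simp
        · refine absurd ?_ (h (c, i) (Or.inl ⟨h1, h2⟩))
          exact Multiset.mem_singleton.2 (tgt_of_ne (t := (c, i)) (show c ≠ 2 by omega)).symm
      · dsimp only at h1 h2
        subst h1
        rcases i with _ | i
        · simp
        · refine absurd ?_ (h (2, i + 1) (Or.inr ⟨rfl, Nat.succ_pos i, h2⟩))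
          exact Multiset.mem_singleton.2 rfl
      · exact Or.inr (Or.inr (Or.inr (Or.inl h3)))
      · exact Or.inr (Or.inr (Or.inr (Or.inr h4)))
  existsUnique_pre := by
    intro p hp hi
    rw [mem_init_strategyNet] at hi
    obtain ⟨c, i⟩ := p
    have huniq : ∀ t ∈ (strategyNet L s e).transitions, ∀ t' ∈ (strategyNet L s e).transitions,
        tgt t = tgt t' → t = t' := by
      intro t ht t' ht' h
      rcases mem_transitions_cases ht with ⟨c, i, rfl, h1, h2, -, hs⟩ | ⟨m, rfl, h1, h2, -, hs⟩ <;>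
      rcases mem_transitions_cases ht' with
        ⟨c', i', rfl, h1', h2', -, hs'⟩ | ⟨m', rfl, h1', h2', -, hs'⟩ <;>
      · rw [hs, hs', Prod.mk.injEq] at h
        rw [Prod.mk.injEq]
        omega
    suffices ∃ t ∈ (strategyNet L s e).transitions, tgt t = (c, i) by
      obtain ⟨t, ht, h⟩ := this
      refine ⟨t, ⟨ht, Multiset.mem_singleton.2 h.symm⟩, fun t' ⟨ht', h'⟩ => ?_⟩
      exact huniq _ ht' _ ht (h.trans (Multiset.mem_singleton.1 h')).symm
    rcases hp with ⟨h1, h2⟩ | ⟨h1, h2⟩ | h3 | h4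
    · dsimp only at h1 h2
      rcases i with _ | i
      · have : c = 0 ∨ c = 1 := by omega
        rcases this with rfl | rfl <;> simp at hi
      · exact ⟨(c, i), Or.inl ⟨h1, h2⟩, tgt_of_ne (by dsimp only; omega)⟩
    · dsimp only at h1 h2
      subst h1
      rcases i with _ | i
      · simp at hi
      · exact ⟨(2, i + 1), Or.inr ⟨rfl, Nat.succ_pos i, h2⟩, rfl⟩
    · exact absurd (Or.inr (Or.inr (Or.inr (Or.inl h3)))) hi
    · exact absurd (Or.inr (Or.inr (Or.inr (Or.inr h4)))) hi
  wellFounded := Subrelation.wf rank_lt_of_arc (measure rank).wf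
  not_selfConflict := by
    rintro t - ⟨p, -, t₁, ht₁, t₂, ht₂, hne, hp₁, hp₂, hc₁, hc₂⟩
    have hp₁ : p = src t₁ := Multiset.mem_singleton.1 hp₁
    have hp₂ : p = src t₂ := Multiset.mem_singleton.1 hp₂
    rcases mem_transitions_cases ht₁ with ⟨c, i, rfl, h1, h2, hs, -⟩ | ⟨m, rfl, h1, h2, hs, -⟩ <;>
    rcases mem_transitions_cases ht₂ with
        ⟨c', i', rfl, h1', h2', hs', -⟩ | ⟨m', rfl, h1', h2', hs', -⟩
    · exact hne (by rw [← hs, ← hs', ← hp₁, ← hp₂])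
    · rw [hp₁, hs, hs', Prod.mk.injEq] at hp₂
      omega
    · rw [hp₁, hs, hs', Prod.mk.injEq] at hp₂
      omega
    · have e₁ := causal_env h1 hc₁
      have e₂ := causal_env h1' hc₂
      simp only [Sum.inr.injEq, reduceCtorEq, or_false] at e₁ e₂
      exact hne (e₁.symm.trans e₂)

variable {T : TileSystem} {K : ℕ} {w : ℕ → ℕ}

theorem IsSolution.arcRel (h : T.IsSolution L K w) {t : ℕ × ℕ}
    (ht : t ∈ (strategyNet L s e).transitions) :
    ArcRel T.size (placeLabel T.size w (src t)) (placeLabel T.size w (tgt t)) := by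
  rcases mem_transitions_cases ht with ⟨c, i, rfl, h1, h2, hs, ht⟩ | ⟨m, rfl, h1, h2, hs, ht⟩
  · rw [hs, ht]
    have h3 := h.lt_size i h2.le
    have h4 := h.lt_size (i + 1) h2
    have h5 := h.phase i h2
    have : c = 0 ∨ c = 1 := by omega
    rcases this with rfl | rfl
    · exact Or.inl ⟨h3, h4, h5⟩
    · exact Or.inr (Or.inl ⟨w i, w (i + 1), rfl, rfl, h3, h4, h5⟩)
  · rw [hs, ht]
    exact Or.inr (Or.inr ⟨rfl, m, h1, h2, rfl⟩)

theorem map_label_idle (N s e : ℕ) (w : ℕ → ℕ) :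
    ((Multiset.range (e - 1)).map (Prod.mk 3) + (Multiset.range (s - 2)).map (Prod.mk 4)).map
      (placeLabel N w) = idle N s e := by
  rw [idle, ← Multiset.coe_add, Multiset.map_add, Multiset.map_map, Multiset.map_map,
    Multiset.coe_replicate, Multiset.coe_replicate]
  congr 1
  · rw [Multiset.eq_replicate]
    simp [placeLabel]
  · rw [Multiset.eq_replicate]
    simp [placeLabel]

/-- The marking of `strategyNet` after `i` and `j` moves of the system players. -/
def strategyMarking (s e : ℕ) (S : ℕ × ℕ × ℕ) : Multiset (ℕ × ℕ) :=
  (0, S.1) ::ₘ (1, S.2.1) ::ₘ (2, S.2.2) ::ₘ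
    ((Multiset.range (e - 1)).map (Prod.mk 3) + (Multiset.range (s - 2)).map (Prod.mk 4))

theorem map_strategyMarking (N : ℕ) (S : ℕ × ℕ × ℕ) :
    (strategyMarking s e S).map (placeLabel N w) = marking N s e (w S.1) (w S.2.1) S.2.2 := by
  rw [strategyMarking, Multiset.map_cons, Multiset.map_cons, Multiset.map_cons, map_label_idle]
  rfl

theorem mem_strategyMarking {S : ℕ × ℕ × ℕ} {c i : ℕ} (h : (c, i) ∈ strategyMarking s e S) :
    (c = 0 ∧ i = S.1) ∨ (c = 1 ∧ i = S.2.1) ∨ (c = 2 ∧ i = S.2.2) ∨ 3 ≤ c := by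
  simp only [strategyMarking, Multiset.mem_cons, Multiset.mem_add, Multiset.mem_map,
    Multiset.mem_range, Prod.mk.injEq] at h
  rcases h with h | h | h | ⟨k, -, rfl, -⟩ | ⟨k, -, rfl, -⟩
  · exact Or.inl h
  · exact Or.inr (Or.inl h)
  · exact Or.inr (Or.inr (Or.inl h))
  · exact Or.inr (Or.inr (Or.inr le_rfl))
  · exact Or.inr (Or.inr (Or.inr (by omega)))

theorem IsSolution.isBranchingProcess (h : T.IsSolution L K w) :
    IsBranchingProcess (T.game s e).net (strategyNet L s e) (placeLabel T.size w)
      (transitionLabel T.size w) where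
  occurrenceNet := strategyNet_isOccurrenceNet L s e
  hom := by
    refine ⟨fun p hp => ?_, fun t ht => ?_, fun t ht => ?_, fun t ht => ?_, ?_⟩
    · rw [mem_places]
      obtain ⟨c, i⟩ := p
      have := h.lt_size i
      simp only [placeLabel]
      rcases hp with ⟨h1, h2⟩ | ⟨h1, h2⟩ | ⟨h1, h2⟩ | ⟨h1, h2⟩ <;> dsimp only at h1 h2 <;>
        split_ifs <;> omega
    · exact (arcIndex_spec s e (h.arcRel ht)).1
    · exact (Multiset.map_singleton _ _).trans (arcIndex_spec s e (h.arcRel ht)).2.1.symm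
    · exact (Multiset.map_singleton _ _).trans (arcIndex_spec s e (h.arcRel ht)).2.2.symm
    · refine (map_strategyMarking T.size (0, 0, 0)).trans ?_
      rw [h.zero]
      rfl
  injective := by
    intro t ht t' ht' hpre hlab
    have hsrc : src t = src t' := Multiset.singleton_inj.1 hpre
    have h1 := (arcIndex_spec s e (h.arcRel ht)).2.2
    have h2 := (arcIndex_spec s e (h.arcRel ht')).2.2
    change arcIndex _ _ _ = arcIndex _ _ _ at hlab
    rw [hlab, h2, Multiset.singleton_inj] at h1
    rcases mem_transitions_cases ht with ⟨c, i, rfl, h3, h4, hs, hg⟩ | ⟨m, rfl, h3, h4, hs, hg⟩ <;>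
    rcases mem_transitions_cases ht' with
        ⟨c', i', rfl, h3', h4', hs', hg'⟩ | ⟨m', rfl, h3', h4', hs', hg'⟩
    · rw [← hs, ← hs', hsrc]
    · rw [hs, hs', Prod.mk.injEq] at hsrc
      omega
    · rw [hs, hs', Prod.mk.injEq] at hsrc
      omega
    · rw [hg, hg'] at h1
      simp only [placeLabel, OfNat.ofNat_ne_zero, OfNat.ofNat_ne_one, if_false, if_true] at h1
      rw [Prod.mk.injEq]
      omega

/-- System places may refuse everything except the next tile of the solution, and each has at most
one outgoing transition, hence determinism. The environment place offers all three choices, and the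
environment has no other transitions in the net. -/
theorem IsSolution.isStrategy (h : T.IsSolution L K w) :
    (T.game s e).IsStrategy (strategyNet L s e) (placeLabel T.size w)
      (transitionLabel T.size w) where
  branchingProcess := IsSolution.isBranchingProcess h
  justifiedRefusal := by
    intro C hC t ht hCt
    by_cases hex : ∃ t' ∈ (strategyNet L s e).transitions,
        transitionLabel T.size w t' = t ∧ (strategyNet L s e).pre t' = C.val
    · exact Or.inl hex
    right
    obtain ⟨p, q, hpre, hpost, hr⟩ := T.pre_post_eq s e ht
    rw [hpre, Multiset.map_eq_singleton] at hCt
    obtain ⟨x, hx, hxp⟩ := hCt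
    have hxC : x ∈ C := by
      rw [← Finset.mem_val, hx]
      exact Multiset.mem_singleton_self x
    refine ⟨x, hxC, ?_, fun t' ht' hxt' hlab => hex ⟨t', ht', hlab, ?_⟩⟩
    · rw [mem_sysPlaces, hxp]
      by_contra hns
      push Not at hns
      rcases hr with hr | ⟨a, b, ha, hb, hr⟩ | ⟨rfl, m, h1, h2, rfl⟩
      · omega
      · omega
      obtain ⟨c, i⟩ := x
      have hplace := hC.1 _ hxC
      have := h.lt_size i
      have hci : c = 2 ∧ i = 0 := by
        simp only [placeLabel] at hxp
        rcases hplace with ⟨h3, h4⟩ | ⟨h3, h4⟩ | ⟨h3, h4⟩ | ⟨h3, h4⟩ <;> dsimp only at h3 h4 <;>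
          split_ifs at hxp <;> omega
      obtain ⟨rfl, rfl⟩ := hci
      have ht' : ((2, m) : ℕ × ℕ) ∈ (strategyNet L s e).transitions := Or.inr ⟨rfl, h1, h2⟩
      have hspec := arcIndex_spec s e (h.arcRel ht')
      have h3 := T.env_transition_unique s e ht hpre hpost
      have h4 := T.env_transition_unique s e hspec.1 hspec.2.1 hspec.2.2
      exact hex ⟨(2, m), ht', Nat.succ_injective (h4.trans h3.symm), hx.symm⟩
    · rw [hx]
      exact congrArg (fun y => ({y} : Multiset (ℕ × ℕ))) (Multiset.mem_singleton.1 hxt').symm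
  deterministic := by
    intro M hM p hp hsys t₁ t₂ h₁ h₂ he₁ he₂
    have h₁ : p = src t₁ := Multiset.mem_singleton.1 h₁
    have h₂ : p = src t₂ := Multiset.mem_singleton.1 h₂
    rw [mem_sysPlaces] at hsys
    rcases mem_transitions_cases he₁.1 with
      ⟨c, i, rfl, h3, h4, hs, hg⟩ | ⟨m, rfl, h3, h4, hs, hg⟩ <;>
    rcases mem_transitions_cases he₂.1 with
        ⟨c', i', rfl, h3', h4', hs', hg'⟩ | ⟨m', rfl, h3', h4', hs', hg'⟩
    · rw [← hs, ← hs', ← h₁, ← h₂]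
    · rw [h₁, hs, hs', Prod.mk.injEq] at h₂
      omega
    · rw [h₁, hs, hs', Prod.mk.injEq] at h₂
      omega
    · rw [h₁, hs] at hsys
      simp [placeLabel] at hsys

/-- The state after the transition `u` has been fired in state `S`. -/
def nextState (S : ℕ × ℕ × ℕ) : Option (ℕ × ℕ) → ℕ × ℕ × ℕ
  | none => S
  | some u => if u.1 = 0 then (u.2 + 1, S.2.1, S.2.2) else if u.1 = 1 then (S.1, u.2 + 1, S.2.2)
      else (S.1, S.2.1, u.2)

def states (t : ℕ → Option (ℕ × ℕ)) : ℕ → ℕ × ℕ × ℕ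
  | 0 => (0, 0, 0)
  | k + 1 => nextState (states t k) (t k)

theorem fires_strategyMarking {A : PetriNet (ℕ × ℕ) (ℕ × ℕ)} {S : ℕ × ℕ × ℕ} {u : ℕ × ℕ}
    {M' : Multiset (ℕ × ℕ)} (hu : u ∈ (strategyNet L s e).transitions) (hpre : A.pre u = {src u})
    (hpost : A.post u = {tgt u}) (hf : A.Fires (strategyMarking s e S) u M') :
    M' = strategyMarking s e (nextState S (some u)) ∧ Move L S (nextState S (some u)) := by
  have hmem : src u ∈ strategyMarking s e S := by
    have := hf.1.2
    rw [hpre] at this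
    exact Multiset.singleton_le.1 this
  obtain ⟨a, b, m'⟩ := S
  rcases mem_transitions_cases hu with ⟨c, i, rfl, h3, h4, hs, hg⟩ | ⟨m, rfl, h3, h4, hs, hg⟩
  · rw [hs] at hmem
    have hcases := mem_strategyMarking hmem
    dsimp only at hcases
    have : c = 0 ∨ c = 1 := by omega
    rcases this with rfl | rfl
    · obtain rfl : i = a := by omega
      rw [hs] at hpre
      rw [hg] at hpost
      exact ⟨hf.eq_cons hpre hpost rfl, Or.inr (Or.inl ⟨h4, rfl⟩)⟩
    · obtain rfl : i = b := by omega
      rw [hs] at hpre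
      rw [hg] at hpost
      refine ⟨?_, Or.inr (Or.inr (Or.inl ⟨h4, rfl⟩))⟩
      rw [hf.eq_cons hpre hpost (Multiset.cons_swap _ _ _), Multiset.cons_swap]
      rfl
  · rw [hs] at hmem
    have hcases := mem_strategyMarking hmem
    dsimp only at hcases
    obtain rfl : m' = 0 := by omega
    rw [hs] at hpre
    rw [hg] at hpost
    refine ⟨?_, Or.inr (Or.inr (Or.inr ⟨rfl, m, h3, h4, rfl⟩))⟩
    have hrot : ∀ x : ℕ, strategyMarking s e (a, b, x) = (2, x) ::ₘ (0, a) ::ₘ (1, b) ::ₘ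
        ((Multiset.range (e - 1)).map (Prod.mk 3) +
          (Multiset.range (s - 2)).map (Prod.mk 4)) := by
      intro x
      rw [strategyMarking, Multiset.cons_swap (1, b), Multiset.cons_swap (0, a)]
    exact (hf.eq_cons hpre hpost (hrot 0)).trans (hrot m).symm

/-- In a play, transitions keep their preconditions and postconditions. -/
theorem play_pre_post {A : PetriNet (ℕ × ℕ) (ℕ × ℕ)}
    {f : ℕ × ℕ → ℕ} {g : ℕ × ℕ → ℕ}
    (hA : (T.game s e).IsPlay (strategyNet L s e) f g A) {u : ℕ × ℕ} (hu : u ∈ A.transitions) :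
    A.pre u = {src u} ∧ A.post u = {tgt u} := by
  classical
  obtain ⟨p, q, hp, hq, -⟩ :=
    T.pre_post_eq s e (hA.branchingProcess.hom.map_transition u hu)
  have h1 := hA.branchingProcess.hom.map_pre u hu
  have h2 := hA.branchingProcess.hom.map_post u hu
  rw [hp, hA.subnet.pre_eq u hu] at h1
  rw [hq, hA.subnet.post_eq u hu] at h2
  rw [hA.subnet.pre_eq u hu, hA.subnet.post_eq u hu]
  -- A subnet could lose arcs by losing places, but a homomorphism preserves sizes, so a singleton
  -- cannot be filtered to nothing.
  have key : ∀ (P : ℕ × ℕ → Prop) (x : ℕ × ℕ) (y : ℕ),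
      (Multiset.filter P {x}).map f = {y} → Multiset.filter P {x} = {x} := by
    intro P x y h
    rw [Multiset.filter_singleton] at h ⊢
    split_ifs at h ⊢ with hP
    · rfl
    · simp at h
  exact ⟨key _ _ _ h1, key _ _ _ h2⟩

/-- Maximality makes a play contain all moves of both system players and one choice of the
environment. A complete firing sequence is then an interleaving of these moves, to which
`IsSolution.exists_good` applies. -/
theorem IsSolution.isWinning (h : T.IsSolution L K w) :
    (T.game s e).IsWinning (strategyNet L s e) (placeLabel T.size w)
      (transitionLabel T.size w) := by
  intro A hA hmax t M ⟨hfs, hall⟩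
  have hinit : ∀ p ∈ (strategyNet L s e).init, p ∈ A.places := fun p hp =>
    hA.branchingProcess.occurrenceNet.wellFormed.init_mem p (hA.subnet.init_eq ▸ hp)
  have hstep : ∀ u ∈ (strategyNet L s e).transitions, src u ∈ A.places →
      ∃ u' ∈ A.transitions, src u' = src u ∧ tgt u' ∈ A.places := by
    intro u hu hsu
    obtain ⟨p, hp, u', hu', hpu'⟩ := hmax {src u} ⟨fun p hp => by
        rw [Finset.mem_singleton.1 hp]; exact hsu, fun p hp q hq hne => by
        rw [Finset.mem_singleton.1 hp, Finset.mem_singleton.1 hq] at hne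
        exact absurd rfl hne⟩ u hu rfl
    obtain ⟨h1, h2⟩ := play_pre_post hA hu'
    rw [Finset.mem_singleton.1 hp, h1, Multiset.mem_singleton] at hpu'
    refine ⟨u', hu', hpu'.symm, ?_⟩
    exact hA.branchingProcess.occurrenceNet.wellFormed.post_mem u' hu' _
      (h2 ▸ Multiset.mem_singleton_self _)
  have hchain : ∀ c ≤ 1, ∀ i, (i ≤ L → (c, i) ∈ A.places) ∧ (i < L → (c, i) ∈ A.transitions) := by
    intro c hc i
    have hc2 : c ≠ 2 := by omega
    have hone : ∀ i, i < L → (c, i) ∈ A.places →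
        (c, i) ∈ A.transitions ∧ (c, i + 1) ∈ A.places := by
      intro i hi hp
      obtain ⟨u', hu', h1, h2⟩ := hstep (c, i) (Or.inl ⟨hc, hi⟩) (by
        rw [src_of_ne hc2]; exact hp)
      rw [src_of_ne (t := (c, i)) hc2] at h1
      rcases mem_transitions_cases (hA.subnet.transitions_subset hu') with
        ⟨c', i', rfl, h3, h4, hs, hg⟩ | ⟨m, rfl, h3, h4, hs, hg⟩
      · rw [← hs, h1] at hu'
        rw [hs, Prod.mk.injEq] at h1
        rw [hg, h1.1, h1.2] at h2
        exact ⟨hu', h2⟩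
      · rw [hs, Prod.mk.injEq] at h1
        omega
    have hp : ∀ i ≤ L, (c, i) ∈ A.places := by
      intro i
      induction i with
      | zero =>
        intro _
        apply hinit
        rw [mem_init_strategyNet]
        have : c = 0 ∨ c = 1 := by omega
        rcases this with rfl | rfl <;> simp
      | succ i ih => exact fun hi => (hone i hi (ih (by omega))).2
    exact ⟨hp i, fun hi => (hone i hi (hp i hi.le)).1⟩
  have henv : ∃ m, 1 ≤ m ∧ ((2, m) : ℕ × ℕ) ∈ A.transitions := by
    obtain ⟨u', hu', h1, -⟩ := hstep (2, 1) (Or.inr ⟨rfl, le_rfl, by omega⟩)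
      (hinit _ (mem_init_strategyNet.2 (Or.inr (Or.inr (Or.inl rfl)))))
    rcases mem_transitions_cases (hA.subnet.transitions_subset hu') with
        ⟨c', i', rfl, h3, h4, hs, hg⟩ | ⟨m, rfl, h3, h4, hs, hg⟩
    · rw [hs, src_env, Prod.mk.injEq] at h1
      omega
    · exact ⟨m, h3, hu'⟩
  set S := states t with hS
  have hM : ∀ k, M k = strategyMarking s e (S k) := by
    intro k
    induction k with
    | zero => rw [hfs.init, hA.subnet.init_eq]; rfl
    | succ k ih =>
      rw [hS, states, ← hS]
      cases hk : t k with
      | none => rw [(hfs.stutter k hk).2, ih]; rfl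
      | some u =>
        have hf := hfs.step k u hk
        obtain ⟨h1, h2⟩ := play_pre_post hA hf.1.1
        rw [ih] at hf
        exact (fires_strategyMarking (hA.subnet.transitions_subset hf.1.1) h1 h2 hf).1
  have hmove : ∀ k, Move L (S k) (S (k + 1)) := by
    intro k
    rw [hS, states, ← hS]
    cases hk : t k with
    | none => exact Or.inl rfl
    | some u =>
      have hf := hfs.step k u hk
      obtain ⟨h1, h2⟩ := play_pre_post hA hf.1.1
      rw [hM] at hf
      exact (fires_strategyMarking (hA.subnet.transitions_subset hf.1.1) h1 h2 hf).2
  have hbound : ∀ k, (S k).1 ≤ L ∧ (S k).2.1 ≤ L ∧ (S k).2.2 ≤ 3 := by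
    intro k
    induction k with
    | zero => exact ⟨Nat.zero_le _, Nat.zero_le _, Nat.zero_le _⟩
    | succ k ih =>
      rcases hmove k with h | ⟨hl, h⟩ | ⟨hl, h⟩ | ⟨hl, m, h1, h2, h⟩ <;> simp only [h] <;>
        omega
  have hmonoA : Monotone fun k => (S k).1 := monotone_nat_of_le_succ fun k => by
    rcases hmove k with h | ⟨hl, h⟩ | ⟨hl, h⟩ | ⟨hl, m, h1, h2, h⟩ <;> simp only [h] <;>
      omega
  have hmonoB : Monotone fun k => (S k).2.1 := monotone_nat_of_le_succ fun k => by
    rcases hmove k with h | ⟨hl, h⟩ | ⟨hl, h⟩ | ⟨hl, m, h1, h2, h⟩ <;> simp only [h] <;>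
      omega
  have hmonoE : Monotone fun k => (S k).2.2 := monotone_nat_of_le_succ fun k => by
    rcases hmove k with h | ⟨hl, h⟩ | ⟨hl, h⟩ | ⟨hl, m, h1, h2, h⟩ <;> simp only [h] <;>
      omega
  have hL : 0 < L := lt_of_lt_of_le h.pos h.le
  have hend : ∃ k, (S k).1 = L ∧ (S k).2.1 = L ∧ (S k).2.2 ≠ 0 := by
    obtain ⟨k₀, hk₀⟩ := hall _ ((hchain 0 (by omega) (L - 1)).2 (by omega))
    obtain ⟨k₁, hk₁⟩ := hall _ ((hchain 1 (by omega) (L - 1)).2 (by omega))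
    obtain ⟨m, hm, hmA⟩ := henv
    obtain ⟨k₂, hk₂⟩ := hall _ hmA
    have e₀ : (S (k₀ + 1)).1 = L := by
      rw [hS, states, hk₀]
      exact Nat.sub_add_cancel hL
    have e₁ : (S (k₁ + 1)).2.1 = L := by
      rw [hS, states, hk₁]
      exact Nat.sub_add_cancel hL
    have e₂ : (S (k₂ + 1)).2.2 = m := by
      rw [hS, states, hk₂]
      rfl
    -- An index after both last moves and after the choice of the environment; all three components
    -- of the state are monotone.
    refine ⟨k₀ + k₁ + k₂ + 1, ?_, ?_, ?_⟩
    · exact le_antisymm (hbound _).1 (e₀ ▸ hmonoA (by omega))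
    · exact le_antisymm (hbound _).2.1 (e₁ ▸ hmonoB (by omega))
    · have : m ≤ (S (k₀ + k₁ + k₂ + 1)).2.2 := e₂ ▸ hmonoE (by omega)
      omega
  obtain ⟨k, hgood, hbad⟩ := h.exists_good rfl hmove hend
  have hw : ∀ k, w (S k).1 < T.size ∧ w (S k).2.1 < T.size ∧ (S k).2.2 < 4 := fun k =>
    ⟨h.lt_size _ (hbound k).1, h.lt_size _ (hbound k).2.1, by have := (hbound k).2.2; omega⟩
  refine ⟨k, ?_, fun k' hk' => ?_⟩
  · rw [hM, map_strategyMarking]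
    exact (T.mem_good s e (hw k).1 (hw k).2.1 (hw k).2.2).2 hgood
  · rw [hM, map_strategyMarking, T.mem_bad s e (hw k').1 (hw k').2.1 (hw k').2.2]
    rw [hbad k' hk']
    simp

theorem Solvable.hasWinningStrategy (h : T.Solvable) :
    (T.game s e).HasWinningStrategy := by
  obtain ⟨L, K, w, h⟩ := h
  exact ⟨_, _, _, _, _, h.isStrategy, h.isWinning⟩

end Strategy

end TileSystem

/-! ### Subprocesses given by causally closed sets of transitions. -/

namespace PetriNet

variable {α β α' β' : Type}

/-- The subnet with the transitions from `S`. -/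
def restrict (B : PetriNet α β) (S : Set β) : PetriNet α β where
  places := {p | p ∈ B.init ∨ ∃ t ∈ S, p ∈ B.post t}
  transitions := S
  pre := B.pre
  post := B.post
  init := B.init

/-- `S` is a causally closed set of transitions. -/
def CausallyClosed (B : PetriNet α β) (S : Set β) : Prop :=
  S ⊆ B.transitions ∧ ∀ t ∈ S, ∀ p ∈ B.pre t, p ∈ (B.restrict S).places

variable {B : PetriNet α β} {S : Set β}

theorem WellFormed.restrict_places_subset (hB : B.WellFormed) (hS : B.CausallyClosed S) :
    (B.restrict S).places ⊆ B.places := by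
  rintro p (hp | ⟨t, ht, hp⟩)
  · exact hB.init_mem p hp
  · exact hB.post_mem t (hS.1 ht) p hp

theorem CausallyClosed.isSubnet (hB : B.WellFormed) (hS : B.CausallyClosed S) :
    IsSubnet (B.restrict S) B where
  places_subset := hB.restrict_places_subset hS
  transitions_subset := hS.1
  init_eq := rfl
  pre_eq t ht := by
    classical
    exact (Multiset.filter_eq_self.2 fun p hp => hS.2 t ht p hp).symm
  post_eq t ht := by
    classical
    exact (Multiset.filter_eq_self.2 fun p hp =>
      (show p ∈ (B.restrict S).places from Or.inr ⟨t, ht, hp⟩)).symm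

theorem CausallyClosed.arc_mono (hS : B.CausallyClosed S) {x y : α ⊕ β}
    (h : (B.restrict S).Arc x y) : B.Arc x y := by
  rcases x with p | t <;> rcases y with q | u
  · exact h
  · exact ⟨hS.1 h.1, h.2⟩
  · exact ⟨hS.1 h.1, h.2⟩
  · exact h

theorem CausallyClosed.causal_mono (hS : B.CausallyClosed S) {x y : α ⊕ β}
    (h : (B.restrict S).Causal x y) : B.Causal x y :=
  Relation.ReflTransGen.mono (fun _ _ => hS.arc_mono) _ _ h

/-- Fewer transitions mean fewer arcs, hence less causality and less conflict. Causal closure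
ensures that every place used by the subnet is initial or still produced in it. -/
theorem CausallyClosed.isOccurrenceNet (hB : B.IsOccurrenceNet) (hS : B.CausallyClosed S) :
    (B.restrict S).IsOccurrenceNet where
  wellFormed := ⟨hS.2, fun t ht _ hp => Or.inr ⟨t, ht, hp⟩, fun _ hp => Or.inl hp⟩
  pre_nodup t ht := hB.pre_nodup t (hS.1 ht)
  post_nodup t ht := hB.post_nodup t (hS.1 ht)
  init_nodup := hB.init_nodup
  mem_init_iff p hp := by
    constructor
    · intro h t ht
      exact (hB.mem_init_iff p (hB.wellFormed.init_mem p h)).1 h t (hS.1 ht)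
    · intro h
      rcases hp with hp | ⟨t, ht, hp⟩
      · exact hp
      · exact absurd hp (h t ht)
  existsUnique_pre p hp hi := by
    rcases hp with hp | ⟨t, ht, hp⟩
    · exact absurd hp hi
    · refine ⟨t, ⟨ht, hp⟩, fun t' ⟨ht', hp'⟩ => ?_⟩
      exact (hB.existsUnique_pre p (hB.wellFormed.post_mem t (hS.1 ht) p hp) hi).unique
        ⟨hS.1 ht', hp'⟩ ⟨hS.1 ht, hp⟩
  wellFounded := Subrelation.wf hS.arc_mono hB.wellFounded
  not_selfConflict t ht := by
    rintro ⟨p, hp, t₁, ht₁, t₂, ht₂, hne, h₁, h₂, hc₁, hc₂⟩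
    exact hB.not_selfConflict t (hS.1 ht) ⟨p, hB.wellFormed.restrict_places_subset hS hp, t₁,
      hS.1 ht₁, t₂, hS.1 ht₂, hne, h₁, h₂, hS.causal_mono hc₁, hS.causal_mono hc₂⟩

theorem CausallyClosed.isBranchingProcess {N : PetriNet α' β'} {f : α → α'} {g : β → β'}
    (hB : IsBranchingProcess N B f g) (hS : B.CausallyClosed S) :
    IsBranchingProcess N (B.restrict S) f g where
  occurrenceNet := hS.isOccurrenceNet hB.occurrenceNet
  hom :=
    { map_place := fun p hp =>
        hB.hom.map_place p (hB.occurrenceNet.wellFormed.restrict_places_subset hS hp)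
      map_transition := fun t ht => hB.hom.map_transition t (hS.1 ht)
      map_pre := fun t ht => hB.hom.map_pre t (hS.1 ht)
      map_post := fun t ht => hB.hom.map_post t (hS.1 ht)
      map_init := hB.hom.map_init }
  injective t ht t' ht' := hB.injective t (hS.1 ht) t' (hS.1 ht')

end PetriNet

/-! ### A winning strategy yields a solution. -/

namespace TileSystem

open PetriNet

variable {T : TileSystem} {s e : ℕ} {α' β' : Type} {B : PetriNet α' β'} {f : α' → ℕ} {g : β' → ℕ}

theorem exists_pre_post (hB : IsBranchingProcess (T.game s e).net B f g) {t : β'}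
    (ht : t ∈ B.transitions) :
    ∃ x y, B.pre t = {x} ∧ B.post t = {y} ∧ ArcRel T.size (f x) (f y) := by
  obtain ⟨p, q, h1, h2, hr⟩ := T.pre_post_eq s e (hB.hom.map_transition t ht)
  have h3 := hB.hom.map_pre t ht
  have h4 := hB.hom.map_post t ht
  rw [h1, Multiset.map_eq_singleton] at h3
  rw [h2, Multiset.map_eq_singleton] at h4
  obtain ⟨x, hx, rfl⟩ := h3
  obtain ⟨y, hy, rfl⟩ := h4
  exact ⟨x, y, hx, hy, hr⟩

theorem exists_init (hB : IsBranchingProcess (T.game s e).net B f g) :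
    ∃ a b c R, B.init = a ::ₘ b ::ₘ c ::ₘ R ∧ f a = T.start ∧ f b = T.size + T.start ∧
      f c = 2 * T.size ∧ R.map f = idle T.size s e := by
  classical
  have h : B.init.map f = T.start ::ₘ (T.size + T.start) ::ₘ (2 * T.size) ::ₘ idle T.size s e :=
    hB.hom.map_init
  obtain ⟨a, ha, hfa, h⟩ := (Multiset.map_eq_cons _ _ _ _).2 h
  obtain ⟨b, hb, hfb, h⟩ := (Multiset.map_eq_cons _ _ _ _).2 h
  obtain ⟨c, hc, hfc, h⟩ := (Multiset.map_eq_cons _ _ _ _).2 h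
  exact ⟨a, b, c, _, by
    rw [Multiset.cons_erase hc, Multiset.cons_erase hb, Multiset.cons_erase ha], hfa, hfb, hfc, h⟩

theorem ArcRel.of_lt {N p q : ℕ} (h : ArcRel N p q) (hp : p < N) :
    q < N ∧ q % 3 = (p + 1) % 3 := by
  rcases h with ⟨h1, h2, h3⟩ | ⟨a, b, rfl, rfl, h1, h2, h3⟩ | ⟨rfl, m, h1, h2, rfl⟩
  · exact ⟨h2, h3⟩
  · omega
  · omega

theorem ArcRel.of_add {N a q : ℕ} (h : ArcRel N (N + a) q) (ha : a < N) :
    ∃ b, q = N + b ∧ b < N ∧ b % 3 = (a + 1) % 3 := by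
  rcases h with ⟨h1, h2, h3⟩ | ⟨a', b, h, rfl, h1, h2, h3⟩ | ⟨h, m, h1, h2, rfl⟩
  · omega
  · obtain rfl : a = a' := by omega
    exact ⟨b, rfl, h2, h3⟩
  · omega

theorem ArcRel.le {N p q : ℕ} (h : ArcRel N p q) : p ≤ 2 * N := by
  rcases h with ⟨h1, h2, h3⟩ | ⟨a, b, rfl, rfl, h1, h2, h3⟩ | ⟨rfl, m, h1, h2, rfl⟩ <;> omega

/-- Only a system place can justify a refusal, and the sole participant here is an environment
place. So every strategy admits each of the three checks. -/
theorem exists_env_transition (hstrat : (T.game s e).IsStrategy B f g) {c : α'} (hc : c ∈ B.init)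
    (hfc : f c = 2 * T.size) {m : ℕ} (h1 : 1 ≤ m) (h3 : m ≤ 3) :
    ∃ t ∈ B.transitions, ∃ y, B.pre t = {c} ∧ B.post t = {y} ∧ f y = 2 * T.size + m := by
  have hs := arcIndex_spec (T := T) s e (Or.inr (Or.inr ⟨rfl, m, h1, h3, rfl⟩))
  rcases hstrat.justifiedRefusal {c} ⟨fun p hp => by
      rw [Finset.mem_singleton.1 hp]
      exact hstrat.branchingProcess.occurrenceNet.wellFormed.init_mem c hc, fun p hp q hq hne => by
      rw [Finset.mem_singleton.1 hp, Finset.mem_singleton.1 hq] at hne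
      exact absurd rfl hne⟩ _ hs.1 (by
        rw [hs.2.1, ← hfc]; exact Multiset.map_singleton _ _) with ⟨t, ht, hg, hpre⟩ | ⟨p, hp, hsys, -⟩
  · have h4 := hstrat.branchingProcess.hom.map_post t ht
    rw [hg, hs.2.2, Multiset.map_eq_singleton] at h4
    obtain ⟨y, hy, hfy⟩ := h4
    exact ⟨t, ht, y, hpre, hy, hfy⟩
  · rw [Finset.mem_singleton.1 hp, hfc, mem_sysPlaces] at hsys
    omega

/-- A branching process in which a successor `nx x` is selected for each place `x` with an outgoing
transition, by means of the transition `τ x`. -/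
structure Selection (B : PetriNet α' β') (τ : α' → Option β') (nx : α' → α') : Prop where
  some : ∀ x t, τ x = some t → t ∈ B.transitions ∧ B.pre t = {x} ∧ B.post t = {nx x}
  none : ∀ x, τ x = none → nx x = x ∧ ∀ t ∈ B.transitions, B.pre t ≠ {x}

theorem exists_selection (hB : IsBranchingProcess (T.game s e).net B f g) :
    ∃ τ nx, Selection B τ nx := by
  classical
  have key : ∀ x, ∃ (o : Option β') (y : α'),
      (∀ t, o = some t → t ∈ B.transitions ∧ B.pre t = {x} ∧ B.post t = {y}) ∧
      (o = none → y = x ∧ ∀ t ∈ B.transitions, B.pre t ≠ {x}) := by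
    intro x
    by_cases h : ∃ t ∈ B.transitions, B.pre t = {x}
    · obtain ⟨t, ht, hx⟩ := h
      obtain ⟨x', y, hx', hy, -⟩ := exists_pre_post hB ht
      refine ⟨some t, y, fun t' ht' => ?_, fun h => by cases h⟩
      cases ht'
      exact ⟨ht, hx, hy⟩
    · exact ⟨none, x, fun t h => (by cases h), fun _ => ⟨rfl, fun t ht hx => h ⟨t, ht, hx⟩⟩⟩
  choose τ nx h1 h2 using key
  exact ⟨τ, nx, h1, h2⟩

/-- A place without a selected transition is a fixed point of `nx`, so a path that has stopped never
resumes. -/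
theorem Selection.isSome_of_le {τ : α' → Option β'} {nx : α' → α'} (hsel : Selection B τ nx) {x : α'}
    {i : ℕ} (hi : (τ (nx^[i] x)).isSome) : ∀ i' ≤ i, (τ (nx^[i'] x)).isSome := by
  intro i' hi'
  by_contra h
  rw [Option.not_isSome_iff_eq_none] at h
  have hfix := (hsel.none _ h).1
  obtain ⟨d, rfl⟩ := Nat.exists_eq_add_of_le hi'
  have : nx^[i' + d] x = nx^[i'] x := by
    rw [Nat.add_comm, Function.iterate_add_apply]
    exact Function.iterate_fixed hfix d
  rw [this, h] at hi
  cases hi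

/-- The transitions on the paths from `a` and `b`, and the transition `u`. -/
def chainTransitions (τ : α' → Option β') (nx : α' → α') (a b : α') (u : β') : Set β' :=
  {t | (∃ i, τ (nx^[i] a) = some t) ∨ (∃ j, τ (nx^[j] b) = some t) ∨ t = u}

section Chains

variable {τ : α' → Option β'} {nx : α' → α'} {a b c y : α'} {u : β'} {R : Multiset α'} {m : ℕ}

theorem causallyClosed_chain (hsel : Selection B τ nx) (hinit : B.init = a ::ₘ b ::ₘ c ::ₘ R)
    (hu : u ∈ B.transitions) (hpre : B.pre u = {c}) :
    B.CausallyClosed (chainTransitions τ nx a b u) := by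
  have hchain : ∀ x ∈ B.init, (∀ i t, τ (nx^[i] x) = some t → t ∈ chainTransitions τ nx a b u) →
      ∀ i, nx^[i] x ∈ (B.restrict (chainTransitions τ nx a b u)).places := by
    intro x hx hmem i
    induction i with
    | zero => exact Or.inl hx
    | succ i ih =>
      rw [Function.iterate_succ_apply']
      cases h : τ (nx^[i] x) with
      | none => rw [(hsel.none _ h).1]; exact ih
      | some t =>
        refine Or.inr ⟨t, hmem i t h, ?_⟩
        rw [(hsel.some _ t h).2.2]
        exact Multiset.mem_singleton_self _
  constructor
  · rintro t (⟨i, h⟩ | ⟨j, h⟩ | rfl)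
    · exact (hsel.some _ t h).1
    · exact (hsel.some _ t h).1
    · exact hu
  · rintro t (⟨i, h⟩ | ⟨j, h⟩ | rfl) p hp
    · rw [(hsel.some _ t h).2.1, Multiset.mem_singleton] at hp
      exact hp ▸ hchain a (by simp [hinit]) (fun i t h => Or.inl ⟨i, h⟩) i
    · rw [(hsel.some _ t h).2.1, Multiset.mem_singleton] at hp
      exact hp ▸ hchain b (by simp [hinit]) (fun i t h => Or.inr (Or.inl ⟨i, h⟩)) j
    · rw [hpre, Multiset.mem_singleton] at hp
      exact Or.inl (by simp [hinit, hp])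

theorem label_fst (hB : IsBranchingProcess (T.game s e).net B f g) (hT : T.IsProper)
    (hsel : Selection B τ nx) (ha : f a = T.start) (i : ℕ) :
    f (nx^[i] a) < T.size ∧ ((τ (nx^[i] a)).isSome →
      f (nx^[i + 1] a) < T.size ∧ f (nx^[i + 1] a) % 3 = (f (nx^[i] a) + 1) % 3) := by
  have hstep : ∀ x, f x < T.size → (τ x).isSome →
      f (nx x) < T.size ∧ f (nx x) % 3 = (f x + 1) % 3 := by
    intro x hx h
    obtain ⟨t, ht⟩ := Option.isSome_iff_exists.1 h
    obtain ⟨h1, h2, h3⟩ := hsel.some _ _ ht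
    obtain ⟨x', y', h2', h3', hr⟩ := exists_pre_post hB h1
    rw [h2, Multiset.singleton_inj] at h2'
    rw [h3, Multiset.singleton_inj] at h3'
    rw [← h2', ← h3'] at hr
    exact hr.of_lt hx
  have hlt : f (nx^[i] a) < T.size := by
    induction i with
    | zero => exact ha ▸ hT.start_lt
    | succ i ih =>
      rw [Function.iterate_succ_apply']
      cases h : τ (nx^[i] a) with
      | none => rw [(hsel.none _ h).1]; exact ih
      | some t => exact (hstep _ ih (by rw [h]; rfl)).1
  refine ⟨hlt, fun h => ?_⟩
  rw [Function.iterate_succ_apply']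
  exact hstep _ hlt h

theorem label_snd (hB : IsBranchingProcess (T.game s e).net B f g) (hT : T.IsProper)
    (hsel : Selection B τ nx) (hb : f b = T.size + T.start) (i : ℕ) :
    (f (nx^[i] b) = T.size + (f (nx^[i] b) - T.size) ∧ f (nx^[i] b) - T.size < T.size) ∧
      ((τ (nx^[i] b)).isSome → f (nx^[i + 1] b) - T.size < T.size ∧
        (f (nx^[i + 1] b) - T.size) % 3 = (f (nx^[i] b) - T.size + 1) % 3) := by
  have hstep : ∀ x, f x = T.size + (f x - T.size) → f x - T.size < T.size → (τ x).isSome →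
      ∃ z, f (nx x) = T.size + z ∧ z < T.size ∧ z % 3 = (f x - T.size + 1) % 3 := by
    intro x hx hx' h
    obtain ⟨t, ht⟩ := Option.isSome_iff_exists.1 h
    obtain ⟨h1, h2, h3⟩ := hsel.some _ _ ht
    obtain ⟨x', y', h2', h3', hr⟩ := exists_pre_post hB h1
    rw [h2, Multiset.singleton_inj] at h2'
    rw [h3, Multiset.singleton_inj] at h3'
    rw [← h2', ← h3', hx] at hr
    exact hr.of_add hx'
  have hlt : f (nx^[i] b) = T.size + (f (nx^[i] b) - T.size) ∧
      f (nx^[i] b) - T.size < T.size := by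
    induction i with
    | zero =>
      have := hT.start_lt
      rw [Function.iterate_zero_apply, hb]
      omega
    | succ i ih =>
      rw [Function.iterate_succ_apply']
      cases h : τ (nx^[i] b) with
      | none => rw [(hsel.none _ h).1]; exact ih
      | some t =>
        obtain ⟨z, h1, h2, -⟩ := hstep _ ih.1 ih.2 (by rw [h]; rfl)
        omega
  refine ⟨hlt, fun h => ?_⟩
  rw [Function.iterate_succ_apply']
  obtain ⟨z, h1, h2, h3⟩ := hstep _ hlt.1 hlt.2 h
  rw [h1, Nat.add_sub_cancel_left]
  exact ⟨h2, h3⟩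

/-- Each place on the two paths has only its selected outgoing transition. The labels on the paths
stay below `2 * T.size`, so the environment place `c` is on neither path. -/
theorem isPlay_chain (hB : IsBranchingProcess (T.game s e).net B f g) (hT : T.IsProper)
    (hsel : Selection B τ nx) (hinit : B.init = a ::ₘ b ::ₘ c ::ₘ R)
    (ha : f a = T.start) (hb : f b = T.size + T.start) (hc : f c = 2 * T.size)
    (hu : u ∈ B.transitions) (hpre : B.pre u = {c}) :
    (T.game s e).IsPlay B f g (B.restrict (chainTransitions τ nx a b u)) where
  subnet := (causallyClosed_chain hsel hinit hu hpre).isSubnet hB.occurrenceNet.wellFormed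
  branchingProcess := CausallyClosed.isBranchingProcess hB (causallyClosed_chain hsel hinit hu hpre)
  post_le_one := by
    have key : ∀ t ∈ chainTransitions τ nx a b u, ∀ p ∈ B.pre t,
        (τ p = some t ∧ f p < 2 * T.size) ∨ (p = c ∧ t = u) := by
      rintro t (⟨i, h⟩ | ⟨j, h⟩ | rfl) p hp
      · rw [(hsel.some _ t h).2.1, Multiset.mem_singleton] at hp
        have := (label_fst hB hT hsel ha i).1
        subst hp
        exact Or.inl ⟨h, by omega⟩
      · rw [(hsel.some _ t h).2.1, Multiset.mem_singleton] at hp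
        have := (label_snd hB hT hsel hb j).1
        subst hp
        exact Or.inl ⟨h, by omega⟩
      · rw [hpre, Multiset.mem_singleton] at hp
        exact Or.inr ⟨hp, rfl⟩
    intro p _ t₁ ht₁ t₂ ht₂ hp₁ hp₂
    rcases key t₁ ht₁ p hp₁ with ⟨h1, h2⟩ | ⟨h1, h2⟩ <;>
    rcases key t₂ ht₂ p hp₂ with ⟨h3, h4⟩ | ⟨h3, h4⟩
    · exact Option.some_injective _ (h1.symm.trans h3)
    · rw [h3, hc] at h2
      omega
    · rw [h1, hc] at h4
      omega
    · rw [h2, h4]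

/-- A path is followed as long as the strategy offers a continuation. Idle players, and the
environment after its choice, have labels above `2 * T.size`, from which no arc leaves. -/
theorem isMaximal_chain (hB : IsBranchingProcess (T.game s e).net B f g)
    (hsel : Selection B τ nx) (hinit : B.init = a ::ₘ b ::ₘ c ::ₘ R)
    (hR : R.map f = idle T.size s e) (hpre : B.pre u = {c}) (hpost : B.post u = {y})
    (hm : 1 ≤ m) (hy : f y = 2 * T.size + m) :
    PetriGame.IsMaximal B (B.restrict (chainTransitions τ nx a b u)) := by
  intro C hC t ht hCt
  obtain ⟨x, z, hx, -, hr⟩ := exists_pre_post hB ht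
  have hxC : x ∈ C := by
    rw [← Finset.mem_val, hCt, hx]
    exact Multiset.mem_singleton_self x
  refine ⟨x, hxC, ?_⟩
  have hout : ∃ t', τ x = some t' := by
    cases h : τ x with
    | none => exact absurd hx ((hsel.none x h).2 t ht)
    | some t' => exact ⟨t', rfl⟩
  obtain ⟨t', ht'⟩ := hout
  have hpre' : x ∈ B.pre t' := by
    rw [(hsel.some x t' ht').2.1]
    exact Multiset.mem_singleton_self x
  have hle := hr.le
  rcases hC.1 x hxC with hp | ⟨v, ⟨i, hv⟩ | ⟨j, hv⟩ | rfl, hp⟩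
  · rw [hinit] at hp
    simp only [Multiset.mem_cons] at hp
    rcases hp with rfl | rfl | rfl | hp
    · exact ⟨t', Or.inl ⟨0, ht'⟩, hpre'⟩
    · exact ⟨t', Or.inr (Or.inl ⟨0, ht'⟩), hpre'⟩
    · refine ⟨u, Or.inr (Or.inr rfl), ?_⟩
      change x ∈ B.pre u
      rw [hpre]
      exact Multiset.mem_singleton_self _
    · have := mem_idle (hR ▸ Multiset.mem_map_of_mem f hp)
      omega
  · change x ∈ B.post v at hp
    rw [(hsel.some _ v hv).2.2, Multiset.mem_singleton] at hp
    refine ⟨t', Or.inl ⟨i + 1, ?_⟩, hpre'⟩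
    rw [Function.iterate_succ_apply', ← hp, ht']
  · change x ∈ B.post v at hp
    rw [(hsel.some _ v hv).2.2, Multiset.mem_singleton] at hp
    refine ⟨t', Or.inr (Or.inl ⟨j + 1, ?_⟩), hpre'⟩
    rw [Function.iterate_succ_apply', ← hp, ht']
  · change x ∈ B.post v at hp
    rw [hpost, Multiset.mem_singleton] at hp
    rw [hp, hy] at hle
    omega

/-- The markings that are visited if the environment moves first and then the system players
follow the schedule `k`. -/
def chainMarking (B : PetriNet α' β') (nx : α' → α') (a b y : α') (R : Multiset α')
    (r : ℕ → ℕ × ℕ) : ℕ → Multiset α'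
  | 0 => B.init
  | k + 1 => (nx^[(r k).1] a) ::ₘ (nx^[(r k).2] b) ::ₘ y ::ₘ R

/-- The environment chooses at step 0, so the step `k` of the schedule is the step `k + 1` of the
firing sequence. The schedule prefers each player infinitely often, which makes the sequence
complete even if a path is infinite. -/
theorem exists_complete_run (hsel : Selection B τ nx) (hinit : B.init = a ::ₘ b ::ₘ c ::ₘ R)
    (hpre : B.pre u = {c}) (hpost : B.post u = {y}) (K : ℕ) :
    ∃ t, (B.restrict (chainTransitions τ nx a b u)).IsCompleteFiringSequence t
      (chainMarking B nx a b y R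
        (run (fun i => (τ (nx^[i] a)).isSome) (fun j => (τ (nx^[j] b)).isSome)
          (alternating K))) := by
  set OA : ℕ → Prop := fun i => (τ (nx^[i] a)).isSome with hOA
  set OB : ℕ → Prop := fun j => (τ (nx^[j] b)).isSome with hOB
  set r := run OA OB (alternating K) with hr
  have key : ∀ k, ∃ o : Option β',
      (∃ v, o = some v ∧ τ (nx^[(r k).1] a) = some v ∧ r (k + 1) = ((r k).1 + 1, (r k).2)) ∨
      (∃ v, o = some v ∧ τ (nx^[(r k).2] b) = some v ∧ r (k + 1) = ((r k).1, (r k).2 + 1)) ∨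
      (o = none ∧ ¬ OA (r k).1 ∧ ¬ OB (r k).2 ∧ r (k + 1) = r k) := by
    intro k
    rcases run_succ (OA := OA) (OB := OB) (c := alternating K) k with ⟨h1, h2⟩ | ⟨h1, h2⟩ | h
    · obtain ⟨v, hv⟩ := Option.isSome_iff_exists.1 h1
      exact ⟨some v, Or.inl ⟨v, rfl, hv, h2⟩⟩
    · obtain ⟨v, hv⟩ := Option.isSome_iff_exists.1 h1
      exact ⟨some v, Or.inr (Or.inl ⟨v, rfl, hv, h2⟩)⟩
    · exact ⟨none, Or.inr (Or.inr ⟨rfl, h⟩)⟩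
  choose o ho using key
  refine ⟨fun k => Nat.casesOn k (some u) o, ⟨rfl, ?_, ?_⟩, ?_⟩
  · rintro (_ | k) v hv
    · obtain rfl : u = v := Option.some_injective _ hv
      have := fires_cons (N := B.restrict (chainTransitions τ nx a b u)) (X := a ::ₘ b ::ₘ R)
        (t := u) (Or.inr (Or.inr rfl)) hpre hpost
      have hrot : ∀ x, x ::ₘ a ::ₘ b ::ₘ R = a ::ₘ b ::ₘ x ::ₘ R := by
        intro x
        rw [Multiset.cons_swap x a, Multiset.cons_swap x b]
      rw [hrot, hrot, ← hinit] at this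
      exact this
    · change o k = some v at hv
      rcases ho k with ⟨v', h1, h2, h3⟩ | ⟨v', h1, h2, h3⟩ | ⟨h1, -⟩
      · obtain rfl : v' = v := Option.some_injective _ (h1.symm.trans hv)
        obtain ⟨-, h4, h5⟩ := hsel.some _ _ h2
        simp only [chainMarking, h3, Function.iterate_succ_apply']
        exact fires_cons (N := B.restrict (chainTransitions τ nx a b u)) (Or.inl ⟨_, h2⟩) h4 h5
      · obtain rfl : v' = v := Option.some_injective _ (h1.symm.trans hv)
        obtain ⟨-, h4, h5⟩ := hsel.some _ _ h2
        simp only [chainMarking, h3, Function.iterate_succ_apply']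
        rw [Multiset.cons_swap, Multiset.cons_swap _ (nx _)]
        exact fires_cons (N := B.restrict (chainTransitions τ nx a b u))
          (Or.inr (Or.inl ⟨_, h2⟩)) h4 h5
      · rw [h1] at hv
        cases hv
  · rintro (_ | k) hv
    · cases hv
    · change o k = none at hv
      change o (k + 1) = none ∧ _
      rcases ho k with ⟨v', h1, -⟩ | ⟨v', h1, -⟩ | ⟨-, h1, h2, h3⟩
      · rw [h1] at hv
        cases hv
      · rw [h1] at hv
        cases hv
      · refine ⟨?_, by simp only [chainMarking, h3]⟩
        -- Once neither player can move, the positions are frozen, so the sequence has really ended.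
        rcases ho (k + 1) with ⟨v, -, h4, -⟩ | ⟨v, -, h4, -⟩ | ⟨h4, -⟩
        · rw [h3] at h4
          exact absurd (by simp only [hOA, h4]; rfl) h1
        · rw [h3] at h4
          exact absurd (by simp only [hOB, h4]; rfl) h2
        · exact h4
  · rintro v (⟨i, hv⟩ | ⟨j, hv⟩ | rfl)
    · obtain ⟨k, h1, h2⟩ := exists_run_fst (OA := OA) (OB := OB)
        (fun k₀ => exists_alternating K k₀ true)
        (hsel.isSome_of_le (x := a) (i := i) (by rw [hv]; rfl))
      refine ⟨k + 1, ?_⟩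
      change o k = some v
      rw [← hr] at h1 h2
      rcases ho k with ⟨v', h3, h4, -⟩ | ⟨v', -, -, h5⟩ | ⟨-, -, -, h5⟩
      · rw [h1, hv] at h4
        rw [h3, h4]
      · rw [h5] at h2
        dsimp only at h2
        omega
      · rw [h5] at h2
        omega
    · obtain ⟨k, h1, h2⟩ := exists_run_snd (OA := OA) (OB := OB)
        (fun k₀ => exists_alternating K k₀ false)
        (hsel.isSome_of_le (x := b) (i := j) (by rw [hv]; rfl))
      refine ⟨k + 1, ?_⟩
      change o k = some v
      rw [← hr] at h1 h2
      rcases ho k with ⟨v', -, -, h5⟩ | ⟨v', h3, h4, -⟩ | ⟨-, -, -, h5⟩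
      · rw [h5] at h2
        dsimp only at h2
        omega
      · rw [h1, hv] at h4
        rw [h3, h4]
      · rw [h5] at h2
        omega
    · exact ⟨0, rfl⟩

end Chains

/-- The two paths do not depend on the check chosen by the environment. Hence the three checks,
under all alternating schedules, test the same two words. -/
theorem solvable_of_hasWinningStrategy (hT : T.IsProper)
    (h : (T.game s e).HasWinningStrategy) : T.Solvable := by
  classical
  obtain ⟨α', β', B, f, g, hstrat, hwin⟩ := h
  have hB := hstrat.branchingProcess
  obtain ⟨a, b, c, R, hinit, ha, hb, hc, hR⟩ := exists_init hB
  obtain ⟨τ, nx, hsel⟩ := exists_selection hB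
  refine solvable_of_runs (OA := fun i => (τ (nx^[i] a)).isSome)
    (OB := fun j => (τ (nx^[j] b)).isSome) hT (wA := fun i => f (nx^[i] a))
    (wB := fun j => f (nx^[j] b) - T.size) ha (by simp [hb])
    (fun i hi => (label_fst hB hT hsel ha i).2 hi) (fun j hj => (label_snd hB hT hsel hb j).2 hj) ?_
  intro m h1 h3 K
  obtain ⟨u, hu, y, hpre, hpost, hy⟩ :=
    exists_env_transition hstrat (c := c) (by simp [hinit]) hc h1 h3
  obtain ⟨t, ht⟩ := exists_complete_run hsel hinit hpre hpost K
  obtain ⟨i, hgood, hbad⟩ := hwin _ (isPlay_chain hB hT hsel hinit ha hb hc hu hpre)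
    (isMaximal_chain hB hsel hinit hR hpre hpost h1 hy) t _ ht
  set r := run (fun i => ((τ (nx^[i] a)).isSome : Prop)) (fun j => ((τ (nx^[j] b)).isSome : Prop))
    (alternating K)
  have hmap : ∀ k, (chainMarking B nx a b y R r (k + 1)).map f =
      marking T.size s e (f (nx^[(r k).1] a)) (f (nx^[(r k).2] b) - T.size) m := by
    intro k
    rw [chainMarking, Multiset.map_cons, Multiset.map_cons, Multiset.map_cons, hR, hy, marking,
      ← (label_snd hB hT hsel hb _).1.1]
  have hg : ∀ k, (chainMarking B nx a b y R r (k + 1)).map f ∈ (T.game s e).good ↔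
      T.good (f (nx^[(r k).1] a)) (f (nx^[(r k).2] b) - T.size) m = true := fun k => by
    rw [hmap]
    exact T.mem_good s e (label_fst hB hT hsel ha _).1 (label_snd hB hT hsel hb _).1.2 (by omega)
  have hb' : ∀ k, (chainMarking B nx a b y R r (k + 1)).map f ∈ (T.game s e).bad ↔
      T.bad (f (nx^[(r k).1] a)) (f (nx^[(r k).2] b) - T.size) m = true ∧
      T.good (f (nx^[(r k).1] a)) (f (nx^[(r k).2] b) - T.size) m = false := fun k => by
    rw [hmap]
    exact T.mem_bad s e (label_fst hB hT hsel ha _).1 (label_snd hB hT hsel hb _).1.2 (by omega)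
  -- In the initial marking both players are on the start tile and no check is chosen, so it is not
  -- good.
  obtain ⟨k, rfl⟩ : ∃ k, i = k + 1 := by
    rcases i with _ | k
    · exfalso
      have h0 : (chainMarking B nx a b y R r 0).map f = marking T.size s e T.start T.start 0 :=
        hB.hom.map_init
      rw [h0, T.mem_good s e hT.start_lt hT.start_lt (by omega)] at hgood
      simp [good] at hgood
    · exact ⟨k, rfl⟩
  -- Passing to the earliest good state matters: a marking in the bad list is bad and not good, so
  -- avoiding the list excludes `T.bad` only where the state is known not to be good.
  have hex : ∃ k, T.good (f (nx^[(r k).1] a)) (f (nx^[(r k).2] b) - T.size) m = true :=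
    ⟨k, (hg k).1 hgood⟩
  refine ⟨Nat.find hex, Nat.find_spec hex, fun k' hk' => ?_⟩
  have hng := Nat.find_min hex hk'
  have hle : Nat.find hex ≤ k := Nat.find_min' hex ((hg k).1 hgood)
  have hnb := hbad (k' + 1) (by omega)
  rw [hb'] at hnb
  simp only [Bool.not_eq_true] at hng
  refine ⟨hng, ?_⟩
  by_contra hbt
  exact hnb ⟨by simpa using hbt, hng⟩

end TileSystem

/-! ### Space-time diagrams and the local rule of a machine. -/

namespace Turing.TM0

/-- A cell of a space-time diagram: `none` is a boundary cell, and other cells hold a symbol and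
possibly the head. -/
abbrev Cell (Γ Λ : Type) := Option (Γ × Option Λ)

section Cell

variable {Γ Λ : Type} [Inhabited Γ]

def NoHead (c : Cell Γ Λ) : Prop := ∀ γ q, c ≠ some (γ, some q)

/-- The cell at `x` of the row of width `K` with the head at `h`. -/
def cell (K : ℕ) (h : ℤ) (c : Cfg Γ Λ) (x : ℕ) : Cell Γ Λ :=
  if x = 0 ∨ x = K then none
  else some (c.Tape.nth (x - h), if (x : ℤ) = h then some c.q else none)

theorem cell_zero (K : ℕ) (h : ℤ) (c : Cfg Γ Λ) : cell K h c 0 = none := if_pos (Or.inl rfl)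

theorem cell_self (K : ℕ) (h : ℤ) (c : Cfg Γ Λ) : cell K h c K = none := if_pos (Or.inr rfl)

theorem noHead_cell {K : ℕ} {h : ℤ} {c : Cfg Γ Λ} {x : ℕ} (hx : x ≤ K) (hh : ¬ (0 < h ∧ h < K)) :
    NoHead (cell K h c x) := by
  intro γ q e
  unfold cell at e
  split_ifs at e with h1 h2
  · omega
  · simp at e

end Cell

variable {Γ Λ : Type} [Inhabited Λ]

/-- The state in which the head leaves the cell in direction `d`. -/
def depart (M : Machine Γ Λ) (d : Dir) : Cell Γ Λ → Option Λ
  | some (γ, some q) =>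
    match M q γ with
    | some (q', Stmt.move d') => if d = d' then some q' else none
    | _ => none
  | _ => none

/-- The next state of a cell, given the cells to its left and its right. -/
def cellNext (M : Machine Γ Λ) (l : Cell Γ Λ) : Cell Γ Λ → Cell Γ Λ → Cell Γ Λ
  | none, _ => none
  | some (γ, some q), _ =>
    match M q γ with
    | none => some (γ, some q)
    | some (q', Stmt.write a) => some (a, some q')
    | some (_, Stmt.move _) => some (γ, none)
  | some (γ, none), r => some (γ, (depart M Dir.right l).or (depart M Dir.left r))

theorem NoHead.depart {M : Machine Γ Λ} {c : Cell Γ Λ} (hc : NoHead c) (d : Dir) :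
    depart M d c = none := by
  rcases c with _ | ⟨γ, _ | q⟩
  · rfl
  · rfl
  · exact absurd rfl (hc γ q)

/-- A head that is lost at the boundary never reappears. So a row that is too narrow cannot produce
a false halting cell. -/
theorem NoHead.cellNext {M : Machine Γ Λ} {l c r : Cell Γ Λ} (hl : NoHead l) (hc : NoHead c)
    (hr : NoHead r) : NoHead (cellNext M l c r) := by
  rcases c with _ | ⟨γ, _ | q⟩
  · intro γ q h
    cases h
  · intro γ' q' h
    simp [TM0.cellNext, hl.depart, hr.depart] at h
  · exact absurd rfl (hc γ q)

variable [Inhabited Γ]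

/-- The next configuration, which is the same one for halting configurations. -/
def next (M : Machine Γ Λ) (c : Cfg Γ Λ) : Cfg Γ Λ := (step M c).getD c

/-- The move of the head in the next step. -/
def headShift (M : Machine Γ Λ) (c : Cfg Γ Λ) : ℤ :=
  match M c.q c.Tape.head with
  | some (_, Stmt.move Dir.left) => -1
  | some (_, Stmt.move Dir.right) => 1
  | _ => 0

theorem eval_dom_iff (M : Machine Γ Λ) (c : Cfg Γ Λ) :
    (StateTransition.eval (step M) c).Dom ↔ ∃ t, step M ((next M)^[t] c) = none := by
  rw [Part.dom_iff_mem]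
  simp only [StateTransition.mem_eval]
  constructor
  · rintro ⟨b, hb, hn⟩
    suffices ∃ t, (next M)^[t] c = b by
      obtain ⟨t, rfl⟩ := this
      exact ⟨t, hn⟩
    clear hn
    induction hb with
    | refl => exact ⟨0, rfl⟩
    | @tail b b' _ h ih =>
      obtain ⟨t, rfl⟩ := ih
      refine ⟨t + 1, ?_⟩
      rw [Function.iterate_succ_apply', next, Option.mem_def.1 h]
      rfl
  · rintro ⟨t, ht⟩
    refine ⟨_, ?_, ht⟩
    clear ht
    induction t with
    | zero => exact Relation.ReflTransGen.refl
    | succ t ih =>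
      rw [Function.iterate_succ_apply']
      cases h : step M ((next M)^[t] c) with
      | none => rw [next, h]; exact ih
      | some b =>
        refine ih.tail ?_
        rw [next, h]
        rfl

theorem init_nth (x y : Γ) (n : ℕ) (z : ℤ) :
    (init (Λ := Λ) (x :: List.replicate n y)).Tape.nth z =
      if z = 0 then x else if 0 < z ∧ z ≤ n then y else default := by
  change (Tape.mk₁ (x :: List.replicate n y)).nth z = _
  rcases z with (_ | k) | k
  · rfl
  · change (ListBlank.mk (List.replicate n y)).nth k = _
    rw [ListBlank.nth_mk, List.getI_eq_getElem?_getD, List.getElem?_replicate]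
    have h1 : ¬ (Int.ofNat (k + 1) = 0) := by
      change ¬ ((k + 1 : ℕ) : ℤ) = 0
      omega
    rw [if_neg h1]
    by_cases h : k < n
    · rw [if_pos h, if_pos ⟨by simp, by simp; omega⟩]
      rfl
    · rw [if_neg h, if_neg (by simp; omega)]
      rfl
  · change (ListBlank.mk ([] : List Γ)).nth k = _
    rw [ListBlank.nth_mk, if_neg (by simp), if_neg (by simp)]
    rfl

theorem depart_cell (M : Machine Γ Λ) (d : Dir) {K : ℕ} {h : ℤ} (c : Cfg Γ Λ) {x : ℕ} (h0 : 0 < h)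
    (hK : h < K) : depart M d (cell K h c x) =
      if (x : ℤ) = h then
        (match M c.q c.Tape.head with
          | some (q', Stmt.move d') => if d = d' then some q' else none
          | _ => none)
      else none := by
  split_ifs with hx
  · rw [cell, if_neg (by omega), if_pos hx, hx, sub_self, Tape.nth_zero]
    rfl
  · rw [cell]
    split_ifs <;> rfl

/-- The tape moves under the head in `Cfg`, while a diagram has fixed columns and a moving head. The
term `headShift` compensates, so a step changes only the cell of the head and the cell that the head
enters. -/
theorem cellNext_cell (M : Machine Γ Λ) {K : ℕ} {h : ℤ} (c : Cfg Γ Λ) {x : ℕ} (h0 : 0 < h)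
    (hK : h < K) (hx0 : 0 < x) (hxK : x < K) :
    cellNext M (cell K h c (x - 1)) (cell K h c x) (cell K h c (x + 1)) =
      cell K (h + headShift M c) (next M c) x := by
  have hne : ¬ (x = 0 ∨ x = K) := by omega
  have hl := depart_cell M Dir.right c (x := x - 1) h0 hK
  have hr := depart_cell M Dir.left c (x := x + 1) h0 hK
  obtain ⟨q, T⟩ := c
  generalize cell K h ⟨q, T⟩ (x - 1) = l at hl ⊢
  generalize cell K h ⟨q, T⟩ (x + 1) = r at hr ⊢
  rw [cell, cell, if_neg hne, if_neg hne]
  dsimp only at hl hr ⊢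
  by_cases hx : (x : ℤ) = h
  · rw [if_pos hx, hx, sub_self, Tape.nth_zero]
    rcases hM : M q T.head with _ | ⟨q', (d | a)⟩
    · simp [cellNext, next, headShift, step, hM]
    · cases d <;> simp [cellNext, next, headShift, step, hM]
    · simp [cellNext, next, headShift, step, hM]
      rfl
  · rw [if_neg hx]
    rcases hM : M q T.head with _ | ⟨q', (d | a)⟩
    · simp only [hM] at hl hr
      simp [cellNext, next, headShift, step, hl, hr, hM, hx]
    · simp only [hM] at hl hr
      cases d
      · have e : (x : ℤ) - (h + -1) - 1 = x - h := by ring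
        have h1 : ((x + 1 : ℕ) : ℤ) = h ↔ (x : ℤ) = h + -1 := by omega
        simp only [cellNext, next, headShift, step, hl, hr, hM, Option.map_some, Option.getD_some,
          Tape.move_left_nth, e, h1]
        simp
      · have e : (x : ℤ) - (h + 1) + 1 = x - h := by ring
        have h1 : ((x - 1 : ℕ) : ℤ) = h ↔ (x : ℤ) = h + 1 := by omega
        simp only [cellNext, next, headShift, step, hl, hr, hM, Option.map_some, Option.getD_some,
          Tape.move_right_nth, e, h1]
        simp
    · simp only [hM] at hl hr
      have : (x : ℤ) - h ≠ 0 := by omega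
      simp [cellNext, next, headShift, step, hl, hr, hM, hx, this]

end Turing.TM0

/-! ### The code of the game is computed primitive recursively from the tile system. -/

namespace TileSystem

section Computability

variable {α : Type} [Primcodable α]

theorem primrec_replicate {β : Type} [Primcodable β] (b : β) {f : α → ℕ} (hf : Primrec f) :
    Primrec fun x => List.replicate (f x) b := by
  have : (fun x => List.replicate (f x) b) = fun x => (List.range (f x)).map fun _ => b := by
    funext x
    simp
  rw [this]
  exact Primrec.list_map (Primrec.list_range.comp hf) (Primrec.const b).to₂

theorem primrec_singleton {β : Type} [Primcodable β] {f : α → β} (hf : Primrec f) :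
    Primrec fun x => [f x] := Primrec.list_cons.comp hf (Primrec.const [])

theorem primrec_tokens (s e : ℕ) {N a b m : α → ℕ} (hN : Primrec N) (ha : Primrec a)
    (hb : Primrec b) (hm : Primrec m) :
    Primrec fun x => tokens (N x) s e (a x) (b x) (m x) := by
  have h2 : Primrec fun x => 2 * N x := Primrec.nat_mul.comp (Primrec.const 2) hN
  refine Primrec.list_cons.comp ha (Primrec.list_cons.comp (Primrec.nat_add.comp hN hb)
    (Primrec.list_cons.comp (Primrec.nat_add.comp h2 hm) (Primrec.list_append.comp ?_ ?_)))
  · have := Primrec.list_map (f := fun _ : α => List.range (e - 1)) (g := fun x _ => 2 * N x + 4)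
      (Primrec.const _) ((Primrec.nat_add.comp h2 (Primrec.const 4)).comp Primrec.fst).to₂
    exact this.of_eq fun x => by simp
  · have := Primrec.list_map (f := fun _ : α => List.range (s - 2)) (g := fun x _ => 2 * N x + 5)
      (Primrec.const _) ((Primrec.nat_add.comp h2 (Primrec.const 5)).comp Primrec.fst).to₂
    exact this.of_eq fun x => by simp

theorem primrec_arcs : Primrec arcs := by
  have h2 {k : ℕ} : Primrec fun x => 2 * x + k :=
    Primrec.nat_add.comp (Primrec.nat_mul.comp (Primrec.const 2) Primrec.id) (Primrec.const k)
  have h0 : Primrec fun x => 2 * x := h2 (k := 0)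
  refine Primrec.list_append.comp ?_ (Primrec.list_flatMap Primrec.list_range
    (Primrec.list_flatMap (Primrec.list_range.comp Primrec.fst) ?_))
  · have h {k : ℕ} : Primrec fun x => ([2 * x], [2 * x + k]) :=
      (primrec_singleton h0).pair (primrec_singleton h2)
    exact Primrec.list_cons.comp h (Primrec.list_cons.comp h (primrec_singleton h))
  · have hN : Primrec fun x : (ℕ × ℕ) × ℕ => x.1.1 := Primrec.fst.comp Primrec.fst
    have ha : Primrec fun x : (ℕ × ℕ) × ℕ => x.1.2 := Primrec.snd.comp Primrec.fst
    have hb : Primrec fun x : (ℕ × ℕ) × ℕ => x.2 := Primrec.snd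
    refine Primrec.ite (Primrec.eq.comp (Primrec.nat_mod.comp hb (Primrec.const 3))
      (Primrec.nat_mod.comp (Primrec.succ.comp ha) (Primrec.const 3))) ?_ (Primrec.const [])
    exact Primrec.list_cons.comp ((primrec_singleton ha).pair (primrec_singleton hb))
      (primrec_singleton ((primrec_singleton (Primrec.nat_add.comp hN ha)).pair
        (primrec_singleton (Primrec.nat_add.comp hN hb))))

theorem primrec_tokensList (s e : ℕ) {N : α → ℕ} {P : α → ℕ → ℕ → ℕ → Bool} (hN : Primrec N)
    (hP : Primrec fun x : α × ℕ × ℕ × ℕ => P x.1 x.2.1 x.2.2.1 x.2.2.2) :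
    Primrec fun x => tokensList (N x) s e (P x) := by
  refine Primrec.list_flatMap (Primrec.list_range.comp hN) (Primrec.list_flatMap
    (Primrec.list_range.comp (hN.comp Primrec.fst)) (Primrec.list_flatMap (Primrec.const _) ?_))
  have hx : Primrec fun x : ((α × ℕ) × ℕ) × ℕ => x.1.1.1 :=
    Primrec.fst.comp (Primrec.fst.comp Primrec.fst)
  have ha : Primrec fun x : ((α × ℕ) × ℕ) × ℕ => x.1.1.2 :=
    Primrec.snd.comp (Primrec.fst.comp Primrec.fst)
  have hb : Primrec fun x : ((α × ℕ) × ℕ) × ℕ => x.1.2 := Primrec.snd.comp Primrec.fst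
  have hm : Primrec fun x : ((α × ℕ) × ℕ) × ℕ => x.2 := Primrec.snd
  exact Primrec.ite (Primrec.eq.comp (hP.comp (hx.pair (ha.pair (hb.pair hm))))
    (Primrec.const true))
    (primrec_singleton (primrec_tokens s e (hN.comp hx) ha hb hm)) (Primrec.const [])

variable {T : α → TileSystem}

theorem primrec_decide {p : α → Prop} {_ : DecidablePred p} (hp : PrimrecPred p) :
    Primrec fun x => decide (p x) := by
  obtain ⟨_, h⟩ := hp
  exact h.of_eq fun x => by congr

theorem primrec_code (s e : ℕ) (size : Primrec fun x => (T x).size)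
    (start : Primrec fun x => (T x).start)
    (hor : Primrec fun x : α × ℕ × ℕ => (T x.1).hor x.2.1 x.2.2)
    (ver : Primrec fun x : α × ℕ × ℕ => (T x.1).ver x.2.1 x.2.2)
    (first : Primrec fun x : α × ℕ => (T x.1).first x.2)
    (final : Primrec fun x : α × ℕ => (T x.1).final x.2) :
    Primrec fun x => (T x).code s e := by
  have hx : Primrec fun x : α × ℕ × ℕ × ℕ => x.1 := Primrec.fst
  have ha : Primrec fun x : α × ℕ × ℕ × ℕ => x.2.1 := Primrec.fst.comp Primrec.snd
  have hb : Primrec fun x : α × ℕ × ℕ × ℕ => x.2.2.1 :=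
    Primrec.fst.comp (Primrec.snd.comp Primrec.snd)
  have hm : Primrec fun x : α × ℕ × ℕ × ℕ => x.2.2.2 :=
    Primrec.snd.comp (Primrec.snd.comp Primrec.snd)
  have hfa := first.comp (hx.pair ha)
  have hla := final.comp (hx.pair ha)
  have hlb := final.comp (hx.pair hb)
  have hhor := hor.comp (hx.pair (hb.pair ha))
  have hver := ver.comp (hx.pair (hb.pair ha))
  have hst := start.comp hx
  have mod {f : α × ℕ × ℕ × ℕ → ℕ} (hf : Primrec f) : Primrec fun x => f x % 3 :=
    Primrec.nat_mod.comp hf (Primrec.const 3)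
  have eqd {f g : α × ℕ × ℕ × ℕ → ℕ} (hf : Primrec f) (hg : Primrec g) :
      Primrec fun x => decide (f x = g x) := primrec_decide (Primrec.eq.comp hf hg)
  have am := mod ha
  have h0 := eqd am (mod hb)
  have h1 := eqd am (mod (Primrec.nat_add.comp hb (Primrec.const 1)))
  have h2 := eqd am (mod (Primrec.nat_add.comp hb (Primrec.const 2)))
  have modeq (k : ℕ) : PrimrecPred fun x : α × ℕ × ℕ × ℕ => x.2.2.2 = k :=
    Primrec.eq.comp hm (Primrec.const k)
  have hgood : Primrec fun x : α × ℕ × ℕ × ℕ => (T x.1).good x.2.1 x.2.2.1 x.2.2.2 := by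
    refine Primrec.ite (modeq 0) (Primrec.or.comp (Primrec.not.comp (eqd ha hst))
      (Primrec.not.comp (eqd hb hst))) (Primrec.ite (modeq 1) (Primrec.and.comp hla hlb)
      (Primrec.ite (modeq 2) (Primrec.or.comp h2 (Primrec.and.comp (eqd ha hb) hla)) ?_))
    exact Primrec.ite (Primrec.eq.comp hfa (Primrec.const true))
      (Primrec.not.comp (eqd hb hst)) h2
  have hbad : Primrec fun x : α × ℕ × ℕ × ℕ => (T x.1).bad x.2.1 x.2.2.1 x.2.2.2 := by
    refine Primrec.ite (modeq 2) (Primrec.or.comp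
      (Primrec.and.comp h0 (Primrec.not.comp (eqd ha hb)))
      (Primrec.and.comp h1 (Primrec.not.comp hhor))) (Primrec.ite (modeq 3) ?_ (Primrec.const _))
    exact Primrec.and.comp (Primrec.not.comp hfa) (Primrec.and.comp h0 (Primrec.not.comp hver))
  refine Primrec.pair ?_ ((primrec_arcs.comp size).pair
    ((primrec_tokens s e size start start (Primrec.const 0)).pair
    ((primrec_tokensList s e size hgood).pair
    (primrec_tokensList s e size (Primrec.and.comp hbad (Primrec.not.comp hgood))))))
  exact Primrec.list_append.comp
    (primrec_replicate true (Primrec.nat_mul.comp (Primrec.const 2) size)) (Primrec.const _)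

end Computability

end TileSystem

/-! ### Numbering tiles by a label, a counter and a phase. -/

section Labels

variable (τ : Type)

/-- The counter of the tile number `p`. -/
noncomputable def counterOf (p : ℕ) : ℕ := p / 3 / Nat.card τ

variable {τ}

theorem primrec_counterOf : Primrec (counterOf τ) :=
  Primrec.nat_div.comp (Primrec.nat_div.comp Primrec.id (Primrec.const 3)) (Primrec.const _)

variable [Finite τ]

/-- The number of the tile with the given label, counter and phase. -/
noncomputable def tileNumber (t : τ) (k ph : ℕ) : ℕ :=
  ph + 3 * (Finite.equivFin τ t + Nat.card τ * k)

theorem tileNumber_mod (t : τ) (k : ℕ) {ph : ℕ} (h : ph < 3) : tileNumber t k ph % 3 = ph := by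
  rw [tileNumber, Nat.add_mul_mod_self_left, Nat.mod_eq_of_lt h]

theorem tileNumber_div (t : τ) (k : ℕ) {ph : ℕ} (h : ph < 3) :
    tileNumber t k ph / 3 = Finite.equivFin τ t + Nat.card τ * k := by
  rw [tileNumber, Nat.add_mul_div_left _ _ (by norm_num), Nat.div_eq_of_lt h, zero_add]

theorem tileNumber_lt (t : τ) {k n : ℕ} (hk : k ≤ n) {ph : ℕ} (h : ph < 3) :
    tileNumber t k ph < 3 * (Nat.card τ * (n + 1)) := by
  have h1 : Finite.equivFin τ t + Nat.card τ * k < Nat.card τ * (n + 1) := by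
    have := (Finite.equivFin τ t).is_lt
    have := Nat.mul_le_mul_left (Nat.card τ) hk
    rw [Nat.mul_succ]
    omega
  rw [tileNumber]
  omega

variable [Nonempty τ]

variable (τ) in
/-- The label in `τ` of the tile number `p`. -/
noncomputable def labelOf (p : ℕ) : τ :=
  (Finite.equivFin τ).symm ⟨p / 3 % Nat.card τ, Nat.mod_lt _ Nat.card_pos⟩

theorem labelOf_tileNumber (t : τ) (k : ℕ) {ph : ℕ} (h : ph < 3) :
    labelOf τ (tileNumber t k ph) = t := by
  rw [labelOf, Equiv.symm_apply_eq]
  refine Fin.ext ?_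
  change _ / 3 % _ = _
  rw [tileNumber_div t k h, Nat.add_mul_mod_self_left, Nat.mod_eq_of_lt (Fin.is_lt _)]

theorem counterOf_tileNumber (t : τ) (k : ℕ) {ph : ℕ} (h : ph < 3) :
    counterOf τ (tileNumber t k ph) = k := by
  rw [counterOf, tileNumber_div t k h, Nat.add_mul_div_left _ _ Nat.card_pos,
    Nat.div_eq_of_lt (Fin.is_lt _), zero_add]

theorem counterOf_le {p n : ℕ} (h : p < 3 * (Nat.card τ * (n + 1))) : counterOf τ p ≤ n := by
  have h1 : p / 3 < (n + 1) * Nat.card τ := by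
    rw [Nat.mul_comm (n + 1)]
    omega
  exact Nat.lt_succ_iff.1 ((Nat.div_lt_iff_lt_mul Nat.card_pos).2 h1)

/-- There are finitely many labels, so an arbitrary relation on them, even one defined by classical
choice, is a finite table. -/
theorem primrecPred_labelOf (R : τ → τ → Prop) {α : Type} [Primcodable α] {f g : α → ℕ}
    (hf : Primrec f) (hg : Primrec g) :
    PrimrecPred fun x => R (labelOf τ (f x)) (labelOf τ (g x)) := by
  classical
  have idx {f : α → ℕ} (hf : Primrec f) : Primrec fun x =>
      (⟨f x / 3 % Nat.card τ, Nat.mod_lt _ Nat.card_pos⟩ : Fin (Nat.card τ)) :=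
    Primrec.fin_val_iff.1 (Primrec.nat_mod.comp
      (Primrec.nat_div.comp hf (Primrec.const 3)) (Primrec.const _))
  refine ⟨fun _ => Classical.dec _, ?_⟩
  exact ((Primrec.dom_finite fun i : Fin (Nat.card τ) × Fin (Nat.card τ) =>
    decide (R ((Finite.equivFin τ).symm i.1) ((Finite.equivFin τ).symm i.2))).comp
    ((idx hf).pair (idx hg))).of_eq fun x => by congr

end Labels

/-! ### The tile system of a machine and an input length. -/

namespace Turing.TM0

/-- The label of a tile: a cell with its left and right neighbours, and a tag. The tags `0`, …, `4`
mark the left end, the blanks on the left, the head, the input, and the blanks on the right in the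
first row. The tag `5` marks the later rows. -/
@[ext]
structure Label (Γ Λ : Type) where
  left : Cell Γ Λ
  center : Cell Γ Λ
  right : Cell Γ Λ
  tag : Fin 6

instance (Γ Λ : Type) [Finite Γ] [Finite Λ] : Finite (Label Γ Λ) :=
  Finite.of_injective (fun t => (t.left, t.center, t.right, t.tag)) fun s t h => by
    simp only [Prod.mk.injEq] at h
    exact Label.ext h.1 h.2.1 h.2.2.1 h.2.2.2

instance (Γ Λ : Type) : Nonempty (Label Γ Λ) := ⟨⟨none, none, none, 0⟩⟩

variable {Γ Λ : Type} [Inhabited Γ] [Inhabited Λ]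

/-- Copies of the neighbouring cells in a label turn the three-cell rule of the machine into a
relation between two tiles. Tags rise by at most one and the tags 0 and 2 are not repeated, so the
first row consists of the left end, blanks, one head, the input, and blanks. -/
structure Label.Adjacent (x y : Γ) (s t : Label Γ Λ) : Prop where
  left : t.left = s.center
  right : s.right = t.center
  tag : (t.tag = s.tag ∧ s.tag ≠ 0 ∧ s.tag ≠ 2) ∨ t.tag.val = s.tag.val + 1
  one : t.tag = 1 → t.center = some (default, none)
  two : t.tag = 2 → t.center = some (x, some default)
  three : t.tag = 3 → t.center = some (y, none)
  four : t.tag = 4 → t.center = some (default, none)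

def Label.Halting (M : Machine Γ Λ) (t : Label Γ Λ) : Prop :=
  t.tag = 5 ∧ ∃ γ q, t.center = some (γ, some q) ∧ M q γ = none

variable [Finite Γ] [Finite Λ] (M : Machine Γ Λ) (x y : Γ) (n : ℕ)

open Classical in
/-- The tile system whose solutions are the halting space-time diagrams of `M` on the input `x`
followed by `n + 1` times `y`. The counter measures the length of the input. -/
noncomputable def tiles : TileSystem where
  size := 3 * (Nat.card (Label Γ Λ) * (n + 1))
  start := tileNumber (⟨none, none, some (default, none), 0⟩ : Label Γ Λ) 0 0
  hor p q := decide (Label.Adjacent x y (labelOf (Label Γ Λ) p) (labelOf (Label Γ Λ) q) ∧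
    -- The counter starts at 0 on the first letter after the head, rises by one per letter, and must
    -- be `n` on the last one. So there are exactly `n + 1` letters `y`.
    (¬ ((labelOf (Label Γ Λ) p).tag = 2 ∧ (labelOf (Label Γ Λ) q).tag = 3) ∨
      counterOf (Label Γ Λ) q = 0) ∧
    (¬ ((labelOf (Label Γ Λ) p).tag = 3 ∧ (labelOf (Label Γ Λ) q).tag = 3) ∨
      counterOf (Label Γ Λ) q = counterOf (Label Γ Λ) p + 1) ∧
    (¬ ((labelOf (Label Γ Λ) p).tag = 3 ∧ (labelOf (Label Γ Λ) q).tag = 4) ∨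
      counterOf (Label Γ Λ) p = n) ∧
    -- The start tile has phase 0, so this makes the row length a multiple of 3.
    (¬ ((labelOf (Label Γ Λ) p).tag = 4 ∧ (labelOf (Label Γ Λ) q).tag = 5) ∨ q % 3 = 0))
  ver p q := decide ((labelOf (Label Γ Λ) q).center = cellNext M (labelOf (Label Γ Λ) p).left
    (labelOf (Label Γ Λ) p).center (labelOf (Label Γ Λ) p).right)
  first p := decide ((labelOf (Label Γ Λ) p).tag ≠ 5)
  final p := decide ((labelOf (Label Γ Λ) p).Halting M)

theorem tiles_isProper : (tiles M x y n).IsProper where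
  three_le := by
    have : 0 < Nat.card (Label Γ Λ) * (n + 1) := Nat.mul_pos Nat.card_pos n.succ_pos
    change 3 ≤ 3 * _
    omega
  start_lt := tileNumber_lt _ (Nat.zero_le _) (by norm_num)
  first_start := by
    simp only [tiles, decide_eq_true_eq]
    rw [labelOf_tileNumber _ _ (by norm_num)]
    exact (by decide : (0 : Fin 6) ≠ 5)
  first_of_hor p q h h1 := by
    simp only [tiles, decide_eq_true_eq] at h h1 ⊢
    rcases h.1.tag with h2 | h2
    · rwa [← h2.1]
    · intro h3
      have := (labelOf (Label Γ Λ) q).tag.is_lt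
      rw [h3] at h2
      simp at h2
      omega
  phase_of_hor p q h h1 h2 := by
    simp only [tiles, decide_eq_true_eq, decide_eq_false_iff_not, not_not] at h h1 h2 ⊢
    rw [tileNumber_mod _ _ (by norm_num)]
    refine h.2.2.2.2.resolve_left (not_not.2 ⟨?_, h2⟩)
    rcases h.1.tag with h3 | h3
    · exact absurd (h3.1.symm.trans h2) h1
    · rw [h2] at h3
      simp at h3
      refine Fin.ext ?_
      change _ = 4
      omega
  first_of_final p h := by
    simp only [tiles, decide_eq_true_eq, decide_eq_false_iff_not, not_not] at h ⊢
    exact h.1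

theorem primrec_code_tiles (s e : ℕ) : Primrec fun n => (tiles M x y n).code s e := by
  have hn : Primrec fun z : ℕ × ℕ × ℕ => z.1 := Primrec.fst
  have hp : Primrec fun z : ℕ × ℕ × ℕ => z.2.1 := Primrec.fst.comp Primrec.snd
  have hq : Primrec fun z : ℕ × ℕ × ℕ => z.2.2 := Primrec.snd.comp Primrec.snd
  have hcp := (primrec_counterOf (τ := Label Γ Λ)).comp hp
  have hcq := (primrec_counterOf (τ := Label Γ Λ)).comp hq
  have hR (R : Label Γ Λ → Label Γ Λ → Prop) := primrecPred_labelOf R hp hq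
  refine TileSystem.primrec_code s e ?_ (Primrec.const _) ?_ ?_ ?_ ?_
  · exact Primrec.nat_mul.comp (Primrec.const 3)
      (Primrec.nat_mul.comp (Primrec.const _) Primrec.succ)
  · refine TileSystem.primrec_decide ?_
    refine PrimrecPred.and (hR fun s t => s.Adjacent x y t) (PrimrecPred.and ?_ (PrimrecPred.and ?_
      (PrimrecPred.and ?_ ?_)))
    · exact (hR fun s t => ¬ (s.tag = 2 ∧ t.tag = 3)).or (Primrec.eq.comp hcq (Primrec.const 0))
    · exact (hR fun s t => ¬ (s.tag = 3 ∧ t.tag = 3)).or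
        (Primrec.eq.comp hcq (Primrec.succ.comp hcp))
    · exact (hR fun s t => ¬ (s.tag = 3 ∧ t.tag = 4)).or (Primrec.eq.comp hcp hn)
    · exact (hR fun s t => ¬ (s.tag = 4 ∧ t.tag = 5)).or
        (Primrec.eq.comp (Primrec.nat_mod.comp hq (Primrec.const 3)) (Primrec.const 0))
  · exact TileSystem.primrec_decide
      (hR fun s t => t.center = cellNext M s.left s.center s.right)
  · exact TileSystem.primrec_decide
      (primrecPred_labelOf (fun s _ : Label Γ Λ => s.tag ≠ 5) Primrec.snd Primrec.snd)
  · exact TileSystem.primrec_decide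
      (primrecPred_labelOf (fun s _ : Label Γ Λ => s.Halting M) Primrec.snd Primrec.snd)

end Turing.TM0

/-! ### A solution describes a halting computation. -/

namespace Turing.TM0

variable {Γ Λ : Type} [Inhabited Γ] [Inhabited Λ] [Finite Γ] [Finite Λ] {M : Machine Γ Λ} {x y : Γ}
  {n : ℕ}

/-- By induction on the rows, each row shows the configuration at its time, or the head has been
lost at the boundary and the row has no head. The final tile contains a halting head, so the first
alternative holds in its row. -/
theorem exists_step_eq_none_of_solvable (h : (tiles M x y n).Solvable) :
    ∃ t, step M ((next M)^[t] (init (x :: List.replicate (n + 1) y))) = none := by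
  obtain ⟨L, K, w, hw⟩ := h
  set c₀ : Cfg Γ Λ := init (x :: List.replicate (n + 1) y) with hc₀
  set a : ℕ → Label Γ Λ := fun i => labelOf (Label Γ Λ) (w i) with ha
  set k : ℕ → ℕ := fun i => counterOf (Label Γ Λ) (w i) with hk
  have hpos := hw.pos
  have hle := hw.le
  have hzero : a 0 = ⟨none, none, some (default, none), 0⟩ := by
    have := hw.zero
    simp only [ha, this]
    exact labelOf_tileNumber _ _ (by norm_num)
  have hkn : ∀ i ≤ L, k i ≤ n := fun i hi => counterOf_le (hw.lt_size i hi)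
  have hhor := hw.hor
  simp only [tiles, decide_eq_true_eq] at hhor
  have hadj : ∀ i < L, (a i).Adjacent x y (a (i + 1)) := fun i hi => (hhor i hi).1
  have hfirst : ∀ i ≤ L, (a i).tag ≠ 5 ↔ i < K := by
    simpa only [tiles, decide_eq_true_eq] using hw.first
  have hver : ∀ i, i + K ≤ L →
      (a (i + K)).center = cellNext M (a i).left (a i).center (a i).right := by
    simpa only [tiles, decide_eq_true_eq] using hw.ver
  have hfin : (a L).Halting M := by
    simpa only [tiles, decide_eq_true_eq] using hw.final
  -- The boundary cell at the start of the word is copied downwards. It separates the rows: the end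
  -- of one row is adjacent to the beginning of the next.
  have hcol : ∀ t, t * K ≤ L → (a (t * K)).center = none := by
    intro t
    induction t with
    | zero => intro _; rw [zero_mul, hzero]
    | succ t ih =>
      intro h
      rw [add_mul, one_mul] at h ⊢
      rw [hver _ h, ih (by omega)]
      rfl
  -- The number of blanks before the head is free, so the position `h` of the head becomes known
  -- only when the tag 2 is met. From then on the cells are compared with the initial tape shifted
  -- by `h`.
  have hrow : ∀ i < K, ((a i).tag = 0 ∧ i = 0) ∨
      ((a i).tag = 1 ∧ ∀ j, 0 < j → j ≤ i → (a j).center = some (default, none)) ∨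
      ∃ h, 0 < h ∧ (∀ j, 0 < j → j ≤ i → (a j).center =
        some (c₀.Tape.nth (j - h), if (j : ℤ) = h then some c₀.q else none)) ∧
        (((a i).tag = 2 ∧ (i : ℤ) = h) ∨ ((a i).tag = 3 ∧ (i : ℤ) = h + 1 + k i) ∨
          ((a i).tag = 4 ∧ h + 1 + n < i)) := by
    intro i
    induction i with
    | zero => intro _; exact Or.inl ⟨by rw [hzero], rfl⟩
    | succ i ih =>
      intro hi
      have hA := hadj i (by omega)
      have hH := (hhor i (by omega)).2
      have hn5 := (hfirst (i + 1) (by omega)).2 hi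
      have hsym (z : ℤ) := init_nth (Λ := Λ) x y (n + 1) z
      rw [← hc₀] at hsym
      have hq : c₀.q = default := rfl
      rcases ih (by omega) with ⟨h0, rfl⟩ | ⟨h1, hb⟩ | ⟨h, hh, hb, htag⟩
      · right; left
        have ht : (a (0 + 1)).tag = 1 := by
          rcases hA.tag with ⟨_, h, _⟩ | h
          · exact absurd h0 h
          · rw [h0] at h
            exact Fin.ext h
        refine ⟨ht, fun j hj hj' => ?_⟩
        obtain rfl : j = 0 + 1 := by omega
        exact hA.one ht
      · right
        rcases hA.tag with ⟨ht, _⟩ | ht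
        · rw [h1] at ht
          refine Or.inl ⟨ht, fun j hj hj' => ?_⟩
          rcases Nat.lt_or_ge i j with h | h
          · obtain rfl : j = i + 1 := by omega
            exact hA.one ht
          · exact hb j hj h
        · have ht : (a (i + 1)).tag = 2 := by
            rw [h1] at ht
            exact Fin.ext ht
          refine Or.inr ⟨i + 1, by omega, fun j hj hj' => ?_, Or.inl ⟨ht, by push_cast; rfl⟩⟩
          rcases Nat.lt_or_ge i j with h | h
          · obtain rfl : j = i + 1 := by omega
            rw [hA.two ht, hsym, if_pos (by push_cast; ring), if_pos (by push_cast; rfl), hq]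
          · rw [hb j hj h, hsym, if_neg (by omega), if_neg (by omega), if_neg (by omega)]
      · right; right
        have key : ∀ γ, (a (i + 1)).center = some (γ, none) → c₀.Tape.nth ((i + 1 : ℕ) - h) = γ →
            ((i + 1 : ℕ) : ℤ) ≠ h → ∀ j, 0 < j → j ≤ i + 1 → (a j).center =
              some (c₀.Tape.nth (j - h), if (j : ℤ) = h then some c₀.q else none) := by
          intro γ h1 h2 h3 j hj hj'
          rcases Nat.lt_or_ge i j with h | h
          · obtain rfl : j = i + 1 := by omega
            rw [if_neg h3, h2, h1]
          · exact hb j hj h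
        rcases htag with ⟨h2, hi2⟩ | ⟨h3, hi3⟩ | ⟨h4, hi4⟩
        · have ht : (a (i + 1)).tag = 3 := by
            rcases hA.tag with ⟨_, _, h⟩ | h
            · exact absurd h2 h
            · rw [h2] at h
              exact Fin.ext h
          have hk0 : k (i + 1) = 0 := hH.1.resolve_left (not_not.2 ⟨h2, ht⟩)
          refine ⟨h, hh, key y (hA.three ht) ?_ (by push_cast; omega),
            Or.inr (Or.inl ⟨ht, by push_cast; omega⟩)⟩
          rw [hsym, if_neg (by push_cast; omega), if_pos (by push_cast; omega)]
        · rcases hA.tag with ⟨ht, _⟩ | ht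
          · rw [h3] at ht
            have hk1 : k (i + 1) = k i + 1 := hH.2.1.resolve_left (not_not.2 ⟨h3, ht⟩)
            have := hkn (i + 1) (by omega)
            refine ⟨h, hh, key y (hA.three ht) ?_ (by push_cast; omega),
              Or.inr (Or.inl ⟨ht, by push_cast; omega⟩)⟩
            rw [hsym, if_neg (by push_cast; omega), if_pos (by push_cast; omega)]
          · have ht : (a (i + 1)).tag = 4 := by
              rw [h3] at ht
              exact Fin.ext ht
            have hk1 : k i = n := hH.2.2.1.resolve_left (not_not.2 ⟨h3, ht⟩)
            refine ⟨h, hh, key default (hA.four ht) ?_ (by push_cast; omega),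
              Or.inr (Or.inr ⟨ht, by push_cast; omega⟩)⟩
            rw [hsym, if_neg (by push_cast; omega), if_neg (by push_cast; omega)]
        · have ht : (a (i + 1)).tag = 4 := by
            rcases hA.tag with ⟨ht, _⟩ | ht
            · rwa [h4] at ht
            · rw [h4] at ht
              exact absurd (Fin.ext ht) hn5
          refine ⟨h, hh, key default (hA.four ht) ?_ (by push_cast; omega),
            Or.inr (Or.inr ⟨ht, by push_cast; omega⟩)⟩
          rw [hsym, if_neg (by push_cast; omega), if_neg (by push_cast; omega)]
  have hK5 : (a K).tag = 5 := by
    by_contra h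
    exact lt_irrefl _ ((hfirst K hle).1 h)
  obtain ⟨i, rfl⟩ : ∃ i, K = i + 1 := ⟨K - 1, by omega⟩
  set K := i + 1 with hKdef
  have hbase : ∃ h : ℤ, 0 < h ∧ h < K ∧ ∀ j < K, (a j).center = cell K h c₀ j := by
    have hi5 := (hfirst i (by omega)).2 (by omega)
    have ht4 : (a i).tag = 4 := by
      rcases (hadj i (by omega)).tag with ⟨ht, _⟩ | ht
      · exact absurd (ht.symm.trans hK5) hi5
      · rw [← hKdef, hK5] at ht
        refine Fin.ext ?_
        change 5 = _ + 1 at ht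
        change _ = 4
        omega
    rcases hrow i (by omega) with ⟨h0, _⟩ | ⟨h1, _⟩ | ⟨h, hh, hb, htag⟩
    · rw [ht4] at h0
      exact absurd h0 (by decide)
    · rw [ht4] at h1
      exact absurd h1 (by decide)
    · refine ⟨h, hh, ?_, fun j hj => ?_⟩
      · rcases htag with ⟨h2, _⟩ | ⟨h2, _⟩ | ⟨_, h2⟩
        · rw [ht4] at h2
          exact absurd h2 (by decide)
        · rw [ht4] at h2
          exact absurd h2 (by decide)
        · omega
      · rcases Nat.eq_zero_or_pos j with rfl | hj0
        · rw [cell_zero, hzero]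
        · rw [hb j hj0 (by omega), cell, if_neg (c := j = 0 ∨ j = K) (by omega)]
  have hleft : ∀ j < L, (a (j + 1)).left = (a j).center := fun j hj => (hadj j hj).left
  have hright : ∀ j < L, (a j).right = (a (j + 1)).center := fun j hj => (hadj j hj).right
  -- The last row may be incomplete, hence the bound by `L`.
  have hrows : ∀ t, (∃ h : ℤ, 0 < h ∧ h < K ∧ ∀ j < K, t * K + j ≤ L →
      (a (t * K + j)).center = cell K h ((next M)^[t] c₀) j) ∨
      ∀ j < K, t * K + j ≤ L → NoHead (a (t * K + j)).center := by
    intro t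
    induction t with
    | zero =>
      obtain ⟨h, h0, h1, h2⟩ := hbase
      refine Or.inl ⟨h, h0, h1, fun j hj _ => ?_⟩
      rw [zero_mul, zero_add]
      exact h2 j hj
    | succ t ih =>
      have hind : ∀ j < K, 0 < j → (t + 1) * K + j ≤ L → (a ((t + 1) * K + j)).center =
          cellNext M (a (t * K + (j - 1))).center (a (t * K + j)).center
            (a (t * K + (j + 1))).center := by
        intro j hj hj0 hL
        have e : (t + 1) * K + j = t * K + j + K := by ring
        rw [e] at hL ⊢
        rw [hver _ hL, hright _ (by omega)]
        have e2 : t * K + j = t * K + (j - 1) + 1 := by omega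
        rw [e2, hleft _ (by omega), ← e2]
        rfl
      -- The right neighbour of the last cell of a row is the boundary cell that starts the next
      -- row.
      have hcolK : (t + 1) * K ≤ L → (a (t * K + K)).center = none := by
        intro h
        have := hcol (t + 1) h
        rwa [add_mul, one_mul] at this
      rcases ih with ⟨h, h0, h1, h2⟩ | hno
      · have main : ∀ j < K, (t + 1) * K + j ≤ L → (a ((t + 1) * K + j)).center =
            cell K (h + headShift M ((next M)^[t] c₀)) ((next M)^[t + 1] c₀) j := by
          intro j hj hL
          have hm : (t + 1) * K = t * K + K := by ring
          rcases Nat.eq_zero_or_pos j with rfl | hj0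
          · rw [cell_zero]
            exact hcol _ hL
          · rw [hind j hj hj0 hL, Function.iterate_succ_apply', ← cellNext_cell M _ h0 h1 hj0 hj,
              h2 (j - 1) (by omega) (by omega), h2 j hj (by omega)]
            congr 1
            rcases Nat.lt_or_ge (j + 1) K with hj1 | hj1
            · exact h2 _ hj1 (by omega)
            · obtain hj2 : j + 1 = K := by omega
              rw [hj2, cell_self]
              exact hcolK (by omega)
        by_cases hb : 0 < h + headShift M ((next M)^[t] c₀) ∧ h + headShift M ((next M)^[t] c₀) < K
        · exact Or.inl ⟨_, hb.1, hb.2, main⟩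
        · right
          intro j hj hL
          rw [main j hj hL]
          exact noHead_cell hj.le hb
      · right
        intro j hj hL
        have hm : (t + 1) * K = t * K + K := by ring
        rcases Nat.eq_zero_or_pos j with rfl | hj0
        · have := hcol _ hL
          rw [add_zero, this]
          intro γ q h
          cases h
        · rw [hind j hj hj0 hL]
          refine (hno _ (by omega) (by omega)).cellNext (hno _ hj (by omega)) ?_
          rcases Nat.lt_or_ge (j + 1) K with hj1 | hj1
          · exact hno _ hj1 (by omega)
          · obtain hj2 : j + 1 = K := by omega
            rw [hj2, hcolK (by omega)]
            intro γ q h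
            cases h
  obtain ⟨_, γ, q, hL, hM⟩ := hfin
  have hLe : L / K * K + L % K = L := by
    rw [mul_comm]
    exact Nat.div_add_mod L K
  have hlt : L % K < K := Nat.mod_lt _ hpos
  rcases hrows (L / K) with ⟨h, h0, h1, h2⟩ | hno
  · refine ⟨L / K, ?_⟩
    have := h2 _ hlt hLe.le
    rw [hLe, hL] at this
    generalize (next M)^[L / K] c₀ = c at this ⊢
    obtain ⟨q', T⟩ := c
    unfold cell at this
    split_ifs at this with h3 h4
    · simp only [Option.some.injEq, Prod.mk.injEq] at this
      obtain ⟨rfl, rfl⟩ := this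
      rw [h4, sub_self, Tape.nth_zero] at hM
      simp [step, hM]
    · simp at this
  · have := hno _ hlt hLe.le
    rw [hLe, hL] at this
    exact absurd rfl (this γ q)

end Turing.TM0

/-! ### A halting computation gives a solution. -/

namespace Turing.TM0

variable {Γ Λ : Type} [Inhabited Γ] [Inhabited Λ]

/-- The position of the head after `t` steps from `c` with the head at `a`. -/
def headPos (M : Machine Γ Λ) (c : Cfg Γ Λ) (a : ℤ) : ℕ → ℤ
  | 0 => a
  | t + 1 => headPos M c a t + headShift M ((next M)^[t] c)

theorem abs_headShift_le (M : Machine Γ Λ) (c : Cfg Γ Λ) : |headShift M c| ≤ 1 := by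
  unfold headShift
  split <;> simp

theorem abs_headPos_le (M : Machine Γ Λ) (c : Cfg Γ Λ) (a : ℤ) (t : ℕ) :
    |headPos M c a t - a| ≤ t := by
  induction t with
  | zero => simp [headPos]
  | succ t ih =>
    have h := abs_headShift_le M ((next M)^[t] c)
    rw [abs_le] at ih h ⊢
    rw [headPos]
    push_cast
    constructor <;> linarith [ih.1, ih.2, h.1, h.2]

/-- The tag of the tile at `i` in a space-time diagram with rows of length `K`, with the head at `a`
in the first row. -/
def tagAt (K a n i : ℕ) : Fin 6 :=
  if K ≤ i then 5 else if i = 0 then 0 else if i < a then 1 else if i = a then 2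
  else if i ≤ a + n + 1 then 3 else 4

variable [Finite Γ] [Finite Λ] {M : Machine Γ Λ} {x y : Γ} {n : ℕ}

/-- In `t` steps the head moves at most `t` cells, so a sufficiently wide diagram contains the whole
computation. Since `0 < t`, the halting head lies below the first row, as the tag 5 of a final tile
demands. -/
theorem solvable_of_step_eq_none {t : ℕ} (ht0 : 0 < t)
    (ht : step M ((next M)^[t] (init (x :: List.replicate (n + 1) y))) = none) :
    (tiles M x y n).Solvable := by
  set c₀ : Cfg Γ Λ := init (x :: List.replicate (n + 1) y) with hc₀
  -- The head starts in column `a`, with room for `t` moves to the left. The width `K` leaves room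
  -- for the input and `t` moves to the right, and is a multiple of 3.
  obtain ⟨a, ha⟩ : ∃ a, a = t + 3 := ⟨_, rfl⟩
  obtain ⟨K, hK⟩ : ∃ K, K = 3 * (a + n + t + 10) := ⟨_, rfl⟩
  set h := headPos M c₀ a with hh
  have hbd : ∀ r ≤ t, 0 < h r ∧ h r < K := by
    intro r hr
    have : |h r - a| ≤ r := abs_headPos_le M c₀ a r
    rw [abs_le] at this
    constructor <;> omega
  let u : ℕ → Cell Γ Λ := fun i => cell K (h (i / K)) ((next M)^[i / K] c₀) (i % K)
  have hu0 : ∀ r j, j < K → u (r * K + j) = cell K (h r) ((next M)^[r] c₀) j := by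
    intro r j hj
    have h1 : (r * K + j) / K = r := by
      rw [mul_comm, Nat.mul_add_div (by omega), Nat.div_eq_of_lt hj, add_zero]
    have h2 : (r * K + j) % K = j := by
      rw [mul_comm, Nat.mul_add_mod, Nat.mod_eq_of_lt hj]
    simp only [u, h1, h2]
  -- The formula extends to `j = K` because both the column `K` of a row and the column 0 of the
  -- next one are boundary cells. This supplies the right neighbours of last cells.
  have hu : ∀ r j, j ≤ K → u (r * K + j) = cell K (h r) ((next M)^[r] c₀) j := by
    intro r j hj
    rcases hj.lt_or_eq with hj | rfl
    · exact hu0 r j hj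
    · have := hu0 (r + 1) 0 (by omega)
      rw [cell_zero] at this
      rw [cell_self, ← this]
      congr 1
      ring
  have hufirst : ∀ i, 0 < i → i < K →
      u i = some (c₀.Tape.nth (i - a), if i = a then some default else none) := by
    intro i h0 hi
    have := hu 0 i hi.le
    rw [zero_mul, zero_add] at this
    rw [this, cell, if_neg (c := i = 0 ∨ i = K) (by omega)]
    have e : h 0 = a := rfl
    rw [e]
    by_cases hia : i = a
    · rw [if_pos hia, if_pos (by omega)]
      rfl
    · rw [if_neg hia, if_neg (by omega)]
      rfl
  have hsym (z : ℤ) := init_nth (Λ := Λ) x y (n + 1) z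
  rw [← hc₀] at hsym
  let lb : ℕ → Label Γ Λ := fun i =>
    ⟨if i = 0 then none else u (i - 1), u i, u (i + 1), tagAt K a n i⟩
  let ctr : ℕ → ℕ := fun i => if a < i ∧ i ≤ a + n + 1 then i - a - 1 else 0
  have hctr : ∀ i, ctr i ≤ n := by
    intro i
    simp only [ctr]
    split_ifs <;> omega
  let w : ℕ → ℕ := fun i => tileNumber (lb i) (ctr i) (i % 3)
  have hlab : ∀ i, labelOf (Label Γ Λ) (w i) = lb i := fun i =>
    labelOf_tileNumber _ _ (Nat.mod_lt _ (by norm_num))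
  have hcnt : ∀ i, counterOf (Label Γ Λ) (w i) = ctr i := fun i =>
    counterOf_tileNumber _ _ (Nat.mod_lt _ (by norm_num))
  have hmod : ∀ i, w i % 3 = i % 3 := fun i =>
    tileNumber_mod _ _ (Nat.mod_lt _ (by norm_num))
  have htag1 : ∀ i, tagAt K a n i = 1 → i < a ∧ 0 < i ∧ i < K := by
    intro i hi
    unfold tagAt at hi
    split_ifs at hi <;> omega
  have htag2 : ∀ i, tagAt K a n i = 2 → i = a ∧ i < K := by
    intro i hi
    unfold tagAt at hi
    split_ifs at hi <;> omega
  have htag3 : ∀ i, tagAt K a n i = 3 → a < i ∧ i ≤ a + n + 1 ∧ i < K := by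
    intro i hi
    unfold tagAt at hi
    split_ifs at hi <;> omega
  have htag4 : ∀ i, tagAt K a n i = 4 → a + n + 1 < i ∧ i < K := by
    intro i hi
    unfold tagAt at hi
    split_ifs at hi <;> omega
  have htag5 : ∀ i, tagAt K a n i = 5 ↔ K ≤ i := by
    intro i
    constructor
    · intro hi
      unfold tagAt at hi
      split_ifs at hi <;> first | assumption | exact absurd hi (by decide)
    · intro hi
      rw [tagAt, if_pos hi]
  have htags : ∀ i, (tagAt K a n (i + 1) = tagAt K a n i ∧ tagAt K a n i ≠ 0 ∧ tagAt K a n i ≠ 2) ∨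
      (tagAt K a n (i + 1)).val = (tagAt K a n i).val + 1 := by
    intro i
    unfold tagAt
    split_ifs <;> first | (exfalso; omega) | exact Or.inr rfl | exact Or.inl ⟨rfl, by decide, by decide⟩
  -- The word stops exactly at the halted head in row `t`.
  obtain ⟨L, hL⟩ : ∃ L, L = t * K + (h t).toNat := ⟨_, rfl⟩
  have hKt : K ≤ t * K := Nat.le_mul_of_pos_left K ht0
  have hht := hbd t le_rfl
  refine ⟨L, K, w, ⟨by omega, by omega, ?_, ?_, ?_, ?_, ?_, ?_, ?_, ?_⟩⟩
  · have e : lb 0 = ⟨none, none, some (default, none), 0⟩ := by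
      have h0 : u 0 = none := by
        have := hu 0 0 (by omega)
        rwa [zero_mul, zero_add, cell_zero] at this
      have h1 := hufirst 1 (by omega) (by omega)
      rw [if_neg (by omega), hsym, if_neg (by omega), if_neg (by omega)] at h1
      have h2 : tagAt K a n 0 = 0 := by
        rw [tagAt, if_neg (by omega), if_pos rfl]
      simp only [lb, zero_add, h0, h1, h2, if_pos]
    change tileNumber (lb 0) (ctr 0) 0 = _
    rw [e]
    have : ctr 0 = 0 := if_neg (by omega)
    rw [this]
    rfl
  · exact fun i _ => tileNumber_lt _ (hctr i) (Nat.mod_lt _ (by norm_num))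
  · intro i _
    have h1 := hmod i
    have h2 := hmod (i + 1)
    omega
  · intro i hi
    simp only [tiles, decide_eq_true_eq]
    rw [hlab, hlab, hcnt, hcnt, hmod]
    refine ⟨⟨?_, rfl, htags i, fun h1 => ?_, fun h1 => ?_, fun h1 => ?_, fun h1 => ?_⟩, ?_, ?_, ?_,
      ?_⟩
    · change (if i + 1 = 0 then none else u i) = u i
      exact if_neg (Nat.succ_ne_zero i)
    · obtain ⟨h2, h3, h4⟩ := htag1 _ h1
      refine (hufirst _ h3 h4).trans ?_
      rw [if_neg (by omega), hsym, if_neg (by omega), if_neg (by omega)]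
    · obtain ⟨h2, h3⟩ := htag2 _ h1
      refine (hufirst _ (by omega) h3).trans ?_
      rw [if_pos h2, hsym, if_pos (by omega)]
    · obtain ⟨h2, h3, h4⟩ := htag3 _ h1
      refine (hufirst _ (by omega) h4).trans ?_
      rw [if_neg (by omega), hsym, if_neg (by omega), if_pos (by push_cast; omega)]
    · obtain ⟨h2, h3⟩ := htag4 _ h1
      refine (hufirst _ (by omega) h3).trans ?_
      rw [if_neg (by omega), hsym, if_neg (by omega), if_neg (by push_cast; omega)]
    · rw [← imp_iff_not_or]
      rintro ⟨h1, h2⟩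
      have h3 := htag2 _ h1
      simp only [ctr]
      split_ifs <;> omega
    · rw [← imp_iff_not_or]
      rintro ⟨h1, h2⟩
      have h3 := htag3 _ h1
      have h4 := htag3 _ h2
      simp only [ctr]
      rw [if_pos (by omega), if_pos (by omega)]
      omega
    · rw [← imp_iff_not_or]
      rintro ⟨h1, h2⟩
      have h3 := htag3 _ h1
      have h4 := htag4 _ h2
      simp only [ctr]
      rw [if_pos (by omega)]
      omega
    · rw [← imp_iff_not_or]
      rintro ⟨h1, h2⟩
      have h3 := htag4 _ h1
      have h4 := (htag5 _).1 h2
      omega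
  · intro i _
    simp only [tiles, decide_eq_true_eq, ne_eq]
    rw [hlab, ← not_le]
    exact not_congr (htag5 i)
  · have h1 := hmod K
    have h2 : (tiles M x y n).start % 3 = 0 := tileNumber_mod _ _ (by norm_num)
    omega
  · intro i hi
    simp only [tiles, decide_eq_true_eq]
    rw [hlab, hlab]
    change u (i + K) = cellNext M (if i = 0 then none else u (i - 1)) (u i) (u (i + 1))
    obtain ⟨r, j, hj, rfl⟩ : ∃ r j, j < K ∧ i = r * K + j :=
      ⟨i / K, i % K, Nat.mod_lt _ (by omega), by rw [mul_comm]; exact (Nat.div_add_mod i K).symm⟩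
    have hr : r ≤ t := by
      by_contra hr
      have := Nat.mul_le_mul_right K (Nat.succ_le_of_lt (not_le.1 hr))
      rw [Nat.succ_mul] at this
      omega
    have e : r * K + j + K = (r + 1) * K + j := by ring
    rw [e, hu _ _ hj.le, hu _ _ hj.le]
    rcases Nat.eq_zero_or_pos j with rfl | hj0
    · rw [cell_zero, cell_zero]
      rfl
    · rw [if_neg (by omega), add_assoc, hu _ _ hj, Nat.add_sub_assoc hj0, hu _ _ (by omega),
        cellNext_cell M _ (hbd r hr).1 (hbd r hr).2 hj0 hj, Function.iterate_succ_apply']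
      rfl
  · simp only [tiles, decide_eq_true_eq]
    rw [hlab]
    refine ⟨(htag5 _).2 (by omega), ?_⟩
    have h1 : u L = cell K (h t) ((next M)^[t] c₀) (h t).toNat := by
      rw [hL]
      exact hu _ _ (by omega)
    generalize (next M)^[t] c₀ = c at ht h1
    obtain ⟨q, T⟩ := c
    refine ⟨T.head, q, ?_, ?_⟩
    · change u L = _
      have h2 : (((h t).toNat : ℕ) : ℤ) = h t := Int.toNat_of_nonneg hht.1.le
      rw [h1, cell, if_neg (c := (h t).toNat = 0 ∨ (h t).toNat = K) (by omega), if_pos h2, h2,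
        sub_self, Tape.nth_zero]
    · simpa [step] using ht

theorem solvable_tiles_iff : (tiles M x y n).Solvable ↔
    (StateTransition.eval (step M) (init (x :: List.replicate (n + 1) y))).Dom := by
  rw [eval_dom_iff]
  refine ⟨exists_step_eq_none_of_solvable, fun ⟨t, ht⟩ =>
    -- A halting configuration is a fixed point of `next`, so one more step may be added to make the
    -- time positive.
    solvable_of_step_eq_none t.succ_pos ?_⟩
  rw [Function.iterate_succ_apply', next, ht]
  exact ht

end Turing.TM0

/-- For all numbers `s ≥ 2` of system players and `e ≥ 1` of environment players, the existence of a
winning strategy is undecidable for the Petri games with good and bad markings that have exactly `s`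
system players and exactly `e` environment players (and hence for every larger class of games). -/
theorem theorem2 (s e : ℕ) (hs : 2 ≤ s) (he : 1 ≤ e) :
    ¬ DecidableOn
      (fun c : PetriGameCode =>
        (PetriGameCode.toGame c).IsPetriGame ∧ (PetriGameCode.toGame c).HasPlayers s e)
      (fun c : PetriGameCode => (PetriGameCode.toGame c).HasWinningStrategy) := by
  rintro ⟨f, hf, h⟩
  obtain ⟨Γ, Λ, _, _, _, _, M, x, y, hM⟩ := exists_undecidable_machine
  refine hM ?_
  have hT := Turing.TM0.tiles_isProper M x y
  have key : ∀ n, ∃ b, b ∈ f ((Turing.TM0.tiles M x y n).code s e) ∧ (b = true ↔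
      (StateTransition.eval (Turing.TM0.step M)
        (Turing.TM0.init (x :: List.replicate (n + 1) y))).Dom) := by
    intro n
    obtain ⟨b, hb, hb'⟩ := h _ ⟨TileSystem.isPetriGame (hT n),
      TileSystem.hasPlayers (hT n) hs he⟩
    refine ⟨b, hb, hb'.trans (Iff.trans ⟨fun h => ?_, fun h => ?_⟩ Turing.TM0.solvable_tiles_iff)⟩
    · exact TileSystem.solvable_of_hasWinningStrategy (hT n) h
    · exact h.hasWinningStrategy
  choose b hb hb' using key
  -- The supposed algorithm, composed with the primitive recursive map from `n` to the game, would
  -- decide the halting of the fixed machine.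
  have hc : Computable b := by
    refine (hf.comp (Turing.TM0.primrec_code_tiles M x y s e).to_comp).of_eq fun n => ?_
    exact Part.eq_some_iff.2 (hb n)
  exact ComputablePred.computable_iff.2 ⟨b, hc, funext fun n => propext (hb' n).symm⟩
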